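/- Let $m\in\mathbb Z$, let $N\ge 1$ be an integer, let $k\in\frac12\mathbb Z$, where $4\mid N$ if $k\notin\mathbb Z$, let $s\in\mathbb C$ with $\operatorname{Re}(s)>1$, and let $z=x+iy$ lie in the upper half plane $\mathbb H$. Put $e(w)=e^{2\pi i w}$; all powers are principal, and $1/\Gamma$ denotes the entire function. Let $M_{\mu,\nu}$, $W_{\mu,\nu}$ be the Whittaker functions $$M_{\mu,\nu}(y)=e^{-y/2}y^{\nu+1/2}M(\nu-\mu+\tfrac12,1+2\nu,y),\qquad W_{\mu,\nu}(y)=e^{-y/2}y^{\nu+1/2}U(\nu-\mu+\tfrac12,1+2\nu,y),$$ with the confluent hypergeometric functions $M(a,b,y)=\sum_{j\ge0}\frac{(a)_j}{(b)_j}\frac{y^j}{j!}$ and $$U(a,b,y)=\frac{\Gamma(1-b)}{\Gamma(a-b+1)}M(a,b,y)+\frac{\Gamma(b-1)}{\Gamma(a)}y^{1-b}M(a-b+1,2-b,y)$$ (for integral $b$, the limit of this expression in $b$). For $n\in\mathbb Z$ put $$\mathcal M_{n,k}(y,s)=\begin{cases}\Gamma(2s)^{-1}(4\pi|n|y)^{-k/2}M_{\frac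 k2\mathrm{sgn}(n),\,s-\frac12}(4\pi|n|y),&n\ne0,\\ y^{s-k/2},&n=0,\end{cases}$$ $$\mathcal W_{n,k}(y,s)=\begin{cases}\Gamma(s+\frac k2\mathrm{sgn}(n))^{-1}|n|^{k/2-1}(4\pi y)^{-k/2}W_{\frac k2\mathrm{sgn}(n),\,s-\frac12}(4\pi|n|y),&n\neq0,\\ \dfrac{(4\pi)^{1-k}y^{1-s-k/2}}{(2s-1)\Gamma(s-k/2)\Gamma(s+k/2)},&n=0,\end{cases}$$ and $\varphi(z)=\mathcal M_{m,k}(y,s)e(mx)$. For $\gamma=\begin{pmatrix}a&b\\c&d\end{pmatrix}\in\Gamma_0(N)$ let $(\varphi|_k\gamma)(z)=j(\gamma,z)^{-2k}\varphi(\gamma z)$, where $j(\gamma,z)=\sqrt{cz+d}$ if $k\in\mathbb Z$ and $j(\gamma,z)=\left(\frac cd\right)\varepsilon_d^{-1}\sqrt{cz+d}$ if $k\notin\mathbb Z$. Here $\varepsilon_d=1$ for $d\equiv1$ and $\varepsilon_d=i$ for $d\equiv3\pmod 4$, and $\left(\frac cd\right)$ is the Jacobi symbol for $d>0$, $\left(\frac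 cd\right)=\left(\frac c{|d|}\right)$ for $c\ge 0>d$, $\left(\frac cd\right)=-\left(\frac c{|d|}\right)$ for $c,d<0$. Let $\Gamma_\infty=\{\pm\begin{pmatrix}1&r\\0&1\end{pmatrix}:r\in\mathbb Z\}$ and $$F_{m,k,N}(z,s)=\sum_{\gamma\in\Gamma_\infty\backslash\Gamma_0(N)}(\varphi|_k\gamma)(z),$$ the sum being over any set of representatives; if $k$ is an odd integer, when $\varphi|_k(-\gamma)=-\varphi|_k\gamma$, the representatives are taken with $c>0$, or $c=0$ and $d=1$. Then this series converges absolutely and $$F_{m,k,N}(z,s)=\mathcal M_{m,k}(y,s)e(mx)+\sum_{n\in\mathbb Z}c_{m,k}(n,s)\,\mathcal W_{n,k}(y,s)\,e(nx),$$ where $c_{m,k}(n,s)$ equals $$2\pi i^{-k}\sum_{c>0}\frac{K_k(m,n,Nc)}{Nc}\times\begin{cases}|mn|^{\frac{1-k}2}J_{2s-1}\!\left(\frac{4\pi\sqrt{|mn|}}{Nc}\right),&mn>0,\\ |mn|^{\frac{1-k}2}I_{2s-1}\!\left(\frac{4\pi\sqrt{|mn|}}{Nc}\right),&mn<0,\\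 2^{k-1}\pi^{s+\frac k2-1}|m+n|^{s-\frac k2}(Nc)^{1-2s},&mn=0,\ m+n\ne0,\\ 2^{2k-2}\pi^{k-1}\Gamma(2s)(2Nc)^{1-2s},&m=n=0.\end{cases}$$ The sum over $n$ and the sums over $c$ converge absolutely. Here $J_\alpha$ and $I_\alpha$ are the usual Bessel functions, and $$K_k(m,n,c)=\begin{cases}\sum_{v\,(c)^*}e\!\left(\frac{m\bar v+nv}c\right),&k\in\mathbb Z,\\ \sum_{v\,(c)^*}\left(\frac cv\right)^{2k}\varepsilon_v^{2k}\,e\!\left(\frac{m\bar v+nv}c\right),&k\notin\mathbb Z,\end{cases}$$ where $v$ runs through the primitive residue classes modulo $c$ and $v\bar v\equiv1\pmod c$. -/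

import Mathlib

open Filter Topology
open scoped UpperHalfPlane MatrixGroups

noncomputable section

namespace MaassPoincare

/-- `e(w) = exp(2πiw)`. -/
def e (w : ℂ) : ℂ := Complex.exp (2 * Real.pi * Complex.I * w)

/-! ### Confluent hypergeometric, Whittaker and Bessel functions -/

/-- Kummer's function `M(a, b, x) = ∑ₙ (a)ₙ / (b)ₙ · xⁿ / n!` (for `b ∉ {0, -1, -2, …}`). -/
def kummerM (a b x : ℂ) : ℂ :=
  ∑' n : ℕ, (ascPochhammer ℂ n).eval a / (ascPochhammer ℂ n).eval b * (x ^ n / (n.factorial : ℂ))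

/-- The right-hand side of the formula for `U(a, b, x)` when `b` is not an integer:
`Γ(1-b)/Γ(a-b+1) M(a,b,x) + Γ(b-1)/Γ(a) x^(1-b) M(a-b+1,2-b,x)`.
Mathlib's `Γ` is `0` at its poles, so `1/Γ` is the entire reciprocal Gamma function. -/
def kummerUFormula (a b x : ℂ) : ℂ :=
  Complex.Gamma (1 - b) / Complex.Gamma (a - b + 1) * kummerM a b x +
    Complex.Gamma (b - 1) / Complex.Gamma a * x ^ (1 - b) * kummerM (a - b + 1) (2 - b) x

/-- The confluent hypergeometric function `U(a, b, x)`, `x > 0`: the formula above, which is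
continuous in `b` off the integers, extended to integral `b` by taking the limit, as usual. -/
def kummerU (a b x : ℂ) : ℂ :=
  limUnder (𝓝[≠] b) (fun b' : ℂ => kummerUFormula a b' x)

/-- The Whittaker function `M_{μ,ν}(y)`, `y > 0`. -/
def whittakerM (μ ν : ℂ) (y : ℝ) : ℂ :=
  Complex.exp (-(y : ℂ) / 2) * (y : ℂ) ^ (ν + 1 / 2) * kummerM (ν - μ + 1 / 2) (1 + 2 * ν) y

/-- The Whittaker function `W_{μ,ν}(y)`, `y > 0`. -/
def whittakerW (μ ν : ℂ) (y : ℝ) : ℂ :=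
  Complex.exp (-(y : ℂ) / 2) * (y : ℂ) ^ (ν + 1 / 2) * kummerU (ν - μ + 1 / 2) (1 + 2 * ν) y

/-- The Bessel function `J_α(x) = ∑ⱼ (-1)^j / (j! Γ(j+α+1)) (x/2)^(2j+α)`, `x > 0`. -/
def besselJ (α : ℂ) (x : ℝ) : ℂ :=
  ((x : ℂ) / 2) ^ α * ∑' j : ℕ, (-1 : ℂ) ^ j /
    ((j.factorial : ℂ) * Complex.Gamma (j + α + 1)) * ((x : ℂ) / 2) ^ (2 * j)

/-- The modified Bessel function `I_α(x) = ∑ⱼ 1 / (j! Γ(j+α+1)) (x/2)^(2j+α)`, `x > 0`. -/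
def besselI (α : ℂ) (x : ℝ) : ℂ :=
  ((x : ℂ) / 2) ^ α * ∑' j : ℕ, 1 /
    ((j.factorial : ℂ) * Complex.Gamma (j + α + 1)) * ((x : ℂ) / 2) ^ (2 * j)

/-! ### The functions `𝓜_{n,k}`, `𝓦_{n,k}` and `φ_{m,k}` -/

/-- `𝓜_{n,k}(y, s)`. -/
def maassM (n : ℤ) (k : ℂ) (y : ℝ) (s : ℂ) : ℂ :=
  if n = 0 then (y : ℂ) ^ (s - k / 2)
  else (Complex.Gamma (2 * s))⁻¹ * ((4 * Real.pi * |(n : ℝ)| * y : ℝ) : ℂ) ^ (-k / 2) *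
    whittakerM (k / 2 * (n.sign : ℂ)) (s - 1 / 2) (4 * Real.pi * |(n : ℝ)| * y)

/-- `𝓦_{n,k}(y, s)`. The factors `1/Γ` vanish at the poles of `Γ`. -/
def maassW (n : ℤ) (k : ℂ) (y : ℝ) (s : ℂ) : ℂ :=
  if n = 0 then
    ((4 * Real.pi : ℝ) : ℂ) ^ (1 - k) * (y : ℂ) ^ (1 - s - k / 2) /
      ((2 * s - 1) * Complex.Gamma (s - k / 2) * Complex.Gamma (s + k / 2))
  else (Complex.Gamma (s + k / 2 * (n.sign : ℂ)))⁻¹ * ((|(n : ℝ)| : ℝ) : ℂ) ^ (k / 2 - 1) *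
    ((4 * Real.pi * y : ℝ) : ℂ) ^ (-k / 2) *
    whittakerW (k / 2 * (n.sign : ℂ)) (s - 1 / 2) (4 * Real.pi * |(n : ℝ)| * y)

/-- `φ_{m,k}(z, s) = 𝓜_{m,k}(y, s) e(mx)` for `z = x + iy` in the upper half plane. -/
def phi (m : ℤ) (k s : ℂ) (z : ℍ) : ℂ := maassM m k z.im s * e (m * (z.re : ℂ))

/-! ### The slash operator and the Poincaré series

The weight `k ∈ ½ℤ` is encoded by the integer `κ = 2k`, so `k ∈ ℤ` if and only if `κ` is even. -/

/-- The extended quadratic symbol `(c/d)` for odd `d`: the Jacobi symbol for `d > 0`, with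
`(c/d) = -(c/|d|)` if `c, d < 0`, `(c/d) = (c/|d|)` if `c ≥ 0 > d`, and `(0/±1) = 1`. -/
def quadSymbol (c d : ℤ) : ℤ :=
  (if c < 0 ∧ d < 0 then -1 else 1) * jacobiSym c d.natAbs

/-- `ε_d = 1` if `d ≡ 1 (mod 4)` and `ε_d = i` if `d ≡ 3 (mod 4)`. -/
def eps (d : ℤ) : ℂ := if d % 4 = 1 then 1 else Complex.I

/-- The automorphy factor `j(γ, z)` in weight `k = κ/2`, with the principal square root. -/
def autFactor (κ : ℤ) (γ : SL(2, ℤ)) (z : ℍ) : ℂ :=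
  if Even κ then ((γ 1 0 : ℂ) * z + (γ 1 1 : ℂ)) ^ (1 / 2 : ℂ)
  else (quadSymbol (γ 1 0) (γ 1 1) : ℂ) * (eps (γ 1 1))⁻¹ *
    ((γ 1 0 : ℂ) * z + (γ 1 1 : ℂ)) ^ (1 / 2 : ℂ)

/-- `(f|_k γ)(z) = j(γ, z)^(-2k) f(γz)` for `k = κ/2`. -/
def slash (κ : ℤ) (f : ℍ → ℂ) (γ : SL(2, ℤ)) (z : ℍ) : ℂ :=
  autFactor κ γ z ^ (-κ) * f (γ • z)

/-- The group `Γ_∞ = {±(1 n; 0 1) : n ∈ ℤ}`, as a subgroup of `SL₂(ℤ)`. -/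
def translationGroup : Subgroup SL(2, ℤ) where
  carrier := {γ | ∃ n : ℤ, (γ : Matrix (Fin 2) (Fin 2) ℤ) = !![1, n; 0, 1] ∨
    (γ : Matrix (Fin 2) (Fin 2) ℤ) = -!![1, n; 0, 1]}
  one_mem' := ⟨0, Or.inl (by simp [Matrix.one_fin_two])⟩
  mul_mem' := by
    rintro a b ⟨n, hn⟩ ⟨m, hm⟩
    refine ⟨n + m, ?_⟩
    rcases hn with hn | hn <;> rcases hm with hm | hm <;>
      simp [Matrix.SpecialLinearGroup.coe_mul, hn, hm, add_comm]
  inv_mem' := by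
    rintro a ⟨n, hn⟩
    refine ⟨-n, ?_⟩
    rcases hn with hn | hn <;>
      simp [Matrix.SpecialLinearGroup.coe_inv, hn, Matrix.adjugate_fin_two]

/-- `Γ_∞` as a subgroup of `Γ₀(N)`. -/
def gammaInf (N : ℕ) : Subgroup (CongruenceSubgroup.Gamma0 N) :=
  translationGroup.subgroupOf (CongruenceSubgroup.Gamma0 N)

/-- The Poincaré series `F_{m,k,N}(z, s) = ∑_{γ ∈ Γ_∞ \ Γ₀(N)} (φ_{m,k}|_k γ)(z)`, `k = κ/2`,
summed over a set `R` of representatives of `Γ_∞ \ Γ₀(N)`. -/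
def poincareSeries (m κ : ℤ) (N : ℕ) (R : Set (CongruenceSubgroup.Gamma0 N)) (z : ℍ) (s : ℂ) : ℂ :=
  ∑' γ : R, slash κ (phi m ((κ : ℂ) / 2) s) (γ : CongruenceSubgroup.Gamma0 N) z

/-! ### Kloosterman sums and the Fourier coefficients -/

/-- The (generalized) Kloosterman sum `K_k(m, n, c)` with `k = κ/2`; it is used for `c ≥ 1`, and
for `4 ∣ c` if `κ` is odd. The sum runs over the residues `0 ≤ v < c` prime to `c`, and
`((v : ZMod c)⁻¹).val` is the inverse of `v` modulo `c`. -/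
def kloosterman (κ m n : ℤ) (c : ℕ) : ℂ :=
  ∑ v ∈ (Finset.range c).filter (fun v => Nat.Coprime v c),
    (if Even κ then 1 else (quadSymbol c v : ℂ) ^ κ * eps v ^ κ) *
      e (((m : ℂ) * (((v : ZMod c)⁻¹).val : ℂ) + (n : ℂ) * (v : ℂ)) / (c : ℂ))

/-- The factor of the coefficient formula that follows the Kloosterman sum, at modulus `q = Nc`. -/
def coeffFactor (m n : ℤ) (k s : ℂ) (q : ℝ) : ℂ :=
  if 0 < m * n then
    ((|(m * n : ℝ)| : ℝ) : ℂ) ^ ((1 - k) / 2) *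
      besselJ (2 * s - 1) (4 * Real.pi * Real.sqrt |(m * n : ℝ)| / q)
  else if m * n < 0 then
    ((|(m * n : ℝ)| : ℝ) : ℂ) ^ ((1 - k) / 2) *
      besselI (2 * s - 1) (4 * Real.pi * Real.sqrt |(m * n : ℝ)| / q)
  else if m + n ≠ 0 then
    (2 : ℂ) ^ (k - 1) * (Real.pi : ℂ) ^ (s + k / 2 - 1) *
      ((|(m + n : ℝ)| : ℝ) : ℂ) ^ (s - k / 2) * (q : ℂ) ^ (1 - 2 * s)
  else
    (2 : ℂ) ^ (2 * k - 2) * (Real.pi : ℂ) ^ (k - 1) * Complex.Gamma (2 * s) *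
      ((2 * q : ℝ) : ℂ) ^ (1 - 2 * s)

/-- The `c`-th term `K_k(m, n, Nc) / (Nc) × {…}` of the series for `c_{m,k}(n, s)`, `k = κ/2`. -/
def coeffTerm (m κ : ℤ) (N : ℕ) (n : ℤ) (s : ℂ) (c : ℕ+) : ℂ :=
  kloosterman κ m n (N * c) / ((N * c : ℕ) : ℂ) * coeffFactor m n ((κ : ℂ) / 2) s ((N * c : ℕ) : ℝ)

/-- The coefficient `c_{m,k}(n, s) = 2π i^(-k) ∑_{c > 0} K_k(m, n, Nc) / (Nc) × {…}`, `k = κ/2`,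
with the principal value `i^(-k) = exp(-πik/2)`. -/
def coeff (m κ : ℤ) (N : ℕ) (n : ℤ) (s : ℂ) : ℂ :=
  2 * Real.pi * Complex.I ^ (-((κ : ℂ) / 2)) * ∑' c : ℕ+, coeffTerm m κ N n s c

end MaassPoincare

end

open Filter Topology
open scoped UpperHalfPlane MatrixGroups

noncomputable section

namespace MaassPoincare

/-! ### Entire power series and Kummer's function -/

/-! Put α = s + k/2 and β = s - k/2, so that α + β = 2s. The identity coset contributes φ. Every
other coset of Γ_∞ in Γ₀(N) is determined by its bottom row up to sign, a coprime pair (q, d) with q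
= Nc > 0. Put w = z + d/q. Since γz = a/q - 1/(q²w), the term of γ is, up to a multiplier, e(ma/q)
and a power of q, the product of w^{-α} w̄^{-β}, an exponential and a Kummer function in 1/w and
1/w̄.

The central observation is that this product is a series of derivatives. The Humbert-type expansion
e^v M(A, A+B, u-v) = ∑ (A)_p (B)_r / (A+B)_{p+r} · u^p v^r / (p! r!) (`exp_mul_kummerM`) identifies
it with `hSer`, that is ∑_j t^j/(2s)_j · (1/j!) ∂_x^j (w^{-α} w̄^{-β}) with t = 2πi m/q²
(`phi_smul`). All signs of m are covered at once. On the Fourier side each ∂_x becomes 2πi n, so the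
transform factors (`fourier_hSer`) into the transform of w^{-α} w̄^{-β}, which does not involve m or
q, and the series ₀F₁(2s; -4π²mn/q²), which does not involve y. The second factor is a J- or
I-Bessel function, or 1 if mn = 0.

The first factor is a Whittaker function (`fourier_gKer_of_pos`). For Re α > 1 and Re β > 0, the
Gamma integral for w̄^{-β} and Fourier inversion for w^{-α} give a Laplace integral. This integral
is Γ(a) U(a, b, ·): it solves Kummer's equation, and Wronskians at 0 determine its two coefficients
(`lapInt_eq_kummerUFormula_of_lt_two`), followed by a recursion in b. With α + β fixed both sides
are entire in β, which removes the restriction on the exponents, and integral b is reached by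
continuity.

Finally, the sum over d is split modulo q and Poisson summation is applied to each class
(`tsum_periodic_mul_hSer`). The finite sum over the classes is the Kloosterman sum, because a is
inverse to d modulo q and the multiplier is periodic in d. The sum over (c, d) is dominated by an
Eisenstein series of exponent 2 Re s > 2. After Poisson summation, two extra derivatives give decay
n^{-2} uniformly in c, so the sums over c and n may be exchanged (`tsum_mul_hSer`). -/

theorem hasDerivAt_tsum_mul_pow {c : ℕ → ℂ} (hc : ∀ r : ℝ, 0 < r → Summable fun n => ‖c n‖ * r ^ n)
    (x : ℂ) :
    HasDerivAt (fun x : ℂ => ∑' n, c n * x ^ n) (∑' n : ℕ, (n + 1 : ℂ) * c (n + 1) * x ^ n) x := by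
  set r : ℝ := ‖x‖ + 1 with hr
  have hr1 : 1 ≤ r := by simp [hr]
  have key : HasDerivAt (fun x : ℂ => ∑' n, c n * x ^ n) (∑' n, c n * (n * x ^ (n - 1))) x := by
    -- The factor n produced by differentiation is absorbed by 2^n, and r ≥ 1 allows r^(n-1) to be
    -- replaced by r^n.
    refine hasDerivAt_tsum_of_isPreconnected (u := fun n => ‖c n‖ * (2 * r) ^ n)
      (t := Metric.ball 0 r) (hc _ (by positivity)) Metric.isOpen_ball
      (convex_ball _ _).isPreconnected (fun n y _ => (hasDerivAt_pow n y).const_mul (c n))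
      (fun n y hy => ?_) (y₀ := 0) (by simp; positivity) ?_ (by simp [hr])
    · rw [norm_mul, norm_mul, norm_pow, Complex.norm_natCast]
      gcongr
      rw [mul_pow]
      have hy' : ‖y‖ ≤ r := by simpa using (Metric.mem_ball.1 hy).le
      gcongr
      · exact_mod_cast Nat.lt_two_pow_self.le
      · calc ‖y‖ ^ (n - 1) ≤ r ^ (n - 1) := by gcongr
          _ ≤ r ^ n := pow_le_pow_right₀ hr1 (by omega)
    · refine summable_of_ne_finset_zero (s := {0}) fun n hn => ?_
      simp at hn
      simp [hn]
  have hs : Summable fun n => c n * (n * x ^ (n - 1)) := by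
    refine Summable.of_norm_bounded (hc (2 * r) (by positivity)) fun n => ?_
    rw [norm_mul, norm_mul, norm_pow, Complex.norm_natCast, mul_pow]
    gcongr
    · exact_mod_cast Nat.lt_two_pow_self.le
    · calc ‖x‖ ^ (n - 1) ≤ r ^ (n - 1) := by gcongr; simp [hr]
          _ ≤ r ^ n := pow_le_pow_right₀ hr1 (by omega)
  convert key using 1
  rw [hs.tsum_eq_zero_add]
  simp only [Nat.cast_zero, zero_mul, mul_zero, zero_add]
  refine tsum_congr fun n => ?_
  push_cast
  ring

/-- The coefficients `(a)ₙ / ((b)ₙ n!)` of Kummer's function. -/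
def kummerCoeff (a b : ℂ) (n : ℕ) : ℂ :=
  (ascPochhammer ℂ n).eval a / ((ascPochhammer ℂ n).eval b * n.factorial)

theorem kummerM_eq (a b x : ℂ) : kummerM a b x = ∑' n, kummerCoeff a b n * x ^ n := by
  unfold kummerM kummerCoeff
  refine tsum_congr fun n => ?_
  rw [div_mul_eq_div_div]
  ring

theorem ascPochhammer_eval_succ' (a : ℂ) (n : ℕ) :
    (ascPochhammer ℂ (n + 1)).eval a = (ascPochhammer ℂ n).eval a * (a + n) := by
  rw [ascPochhammer_succ_eval]

theorem ascPochhammer_eval_succ_left (a : ℂ) (n : ℕ) :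
    (ascPochhammer ℂ (n + 1)).eval a = a * (ascPochhammer ℂ n).eval (a + 1) := by
  rw [ascPochhammer_succ_left]; simp

theorem ascPochhammer_eval_ne_zero {b : ℂ} (hb : ∀ m : ℕ, b ≠ -m) (n : ℕ) :
    (ascPochhammer ℂ n).eval b ≠ 0 := by
  induction n with
  | zero => simp
  | succ n ih =>
    rw [ascPochhammer_eval_succ']
    exact mul_ne_zero ih fun h => hb n (eq_neg_of_add_eq_zero_left h)

theorem norm_ascPochhammer_eval_le {a : ℂ} {A : ℝ} (h : ‖a‖ ≤ A) (n : ℕ) :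
    ‖(ascPochhammer ℂ n).eval a‖ ≤ (ascPochhammer ℝ n).eval A := by
  induction n with
  | zero => simp
  | succ n ih =>
    rw [ascPochhammer_eval_succ', ascPochhammer_succ_eval, norm_mul]
    refine mul_le_mul ih ?_ (norm_nonneg _) ((norm_nonneg _).trans ih)
    exact (norm_add_le _ _).trans (by simpa using h)

/-- This is the ratio of consecutive terms of the majorant below. The factors |A + n| and ‖b + n‖
are both asymptotic to n, so the n + 1 coming from the factorial decides. -/
theorem tendsto_ratio_zero (A r : ℝ) (b : ℂ) :
    Tendsto (fun n : ℕ => |A + n| / ‖b + n‖ / (n + 1) * r) atTop (𝓝 0) := by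
  have h1 : Tendsto (fun n : ℕ => ‖(n : ℂ)‖ / ‖b + n‖) atTop (𝓝 1) := by
    have hlim : Tendsto (fun n : ℕ => b / (n : ℂ) + 1) atTop (𝓝 (0 + 1)) :=
      (tendsto_const_div_atTop_nhds_zero_nat b).add_const 1
    have := (hlim.inv₀ (by simp)).norm
    simp only [zero_add, inv_one, norm_one] at this
    refine this.congr' ?_
    filter_upwards [eventually_ne_atTop 0] with n hn
    have : (n : ℂ) ≠ 0 := by exact_mod_cast hn
    rw [← norm_div, ← inv_div (b + n : ℂ), add_div, div_self this]
  have h2 : Tendsto (fun n : ℕ => |A / n + 1| / (n + 1)) atTop (𝓝 0) := by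
    have := ((tendsto_const_div_atTop_nhds_zero_nat A).add_const 1).abs.mul
      (tendsto_one_div_add_atTop_nhds_zero_nat (𝕜 := ℝ))
    simpa [div_eq_mul_inv] using this
  have := (h1.mul h2).mul_const r
  simp only [mul_zero, zero_mul] at this
  refine this.congr' ?_
  filter_upwards [eventually_gt_atTop 0] with n hn
  have hn' : (0 : ℝ) < n := by exact_mod_cast hn
  have : |A + n| = n * |A / n + 1| := by
    rw [← abs_of_pos hn', ← abs_mul, abs_of_pos hn']
    congr 1
    field_simp
  rw [this, Complex.norm_natCast]
  ring

/-- The numerator parameter enters only through a bound A, so the majorant is uniform for ‖a‖ ≤ A.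
It controls Kummer's series, its dependence on a, the derivative series `hSer` and the Bessel
series. -/
theorem summable_kummer_majorant {A r : ℝ} (hA : 0 < A) {b : ℂ} (hb : ∀ m : ℕ, b ≠ -m)
    (hr : 0 < r) :
    Summable fun n => (ascPochhammer ℝ n).eval A / (‖(ascPochhammer ℂ n).eval b‖ * n.factorial)
      * r ^ n := by
  have hpos : ∀ n, 0 < (ascPochhammer ℝ n).eval A := fun n => ascPochhammer_pos n A hA
  refine summable_of_ratio_test_tendsto_lt_one (l := 0) one_pos ?_ ?_
  · refine Eventually.of_forall fun n => ?_
    have := hpos n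
    have := norm_pos_iff.2 (ascPochhammer_eval_ne_zero hb n)
    positivity
  · refine (tendsto_ratio_zero A r b).congr fun n => ?_
    have h1 := hpos n
    have h2 := norm_pos_iff.2 (ascPochhammer_eval_ne_zero hb n)
    have h3 : 0 < ‖b + n‖ := norm_pos_iff.2 fun h => hb n (eq_neg_of_add_eq_zero_left h)
    rw [ascPochhammer_succ_eval, ascPochhammer_eval_succ']
    simp only [norm_mul, Real.norm_eq_abs, norm_div, norm_pow, abs_of_pos h1, abs_of_pos hr,
      Nat.factorial_succ, Nat.cast_mul, Nat.cast_add, Nat.cast_one,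
      RCLike.norm_natCast, pow_succ]
    rw [abs_of_pos (by positivity : (0:ℝ) < n + 1)]
    rw [abs_of_pos h3]
    field_simp

theorem norm_kummerCoeff_le {a : ℂ} {A : ℝ} (h : ‖a‖ ≤ A) (b : ℂ) (n : ℕ) :
    ‖kummerCoeff a b n‖ ≤
      (ascPochhammer ℝ n).eval A / (‖(ascPochhammer ℂ n).eval b‖ * n.factorial) := by
  unfold kummerCoeff
  rw [norm_div, norm_mul, Complex.norm_natCast]
  gcongr
  exact norm_ascPochhammer_eval_le h n

theorem summable_norm_kummerCoeff (a : ℂ) {b : ℂ} (hb : ∀ m : ℕ, b ≠ -m) {r : ℝ} (hr : 0 < r) :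
    Summable fun n => ‖kummerCoeff a b n‖ * r ^ n :=
  (summable_kummer_majorant (A := ‖a‖ + 1) (by positivity) hb hr).of_nonneg_of_le
    (fun n => by positivity) fun n => by
      gcongr
      exact norm_kummerCoeff_le (by simp) b n

theorem summable_kummerCoeff (a : ℂ) {b : ℂ} (hb : ∀ m : ℕ, b ≠ -m) (x : ℂ) :
    Summable fun n => kummerCoeff a b n * x ^ n := by
  refine Summable.of_norm_bounded
    (summable_norm_kummerCoeff a hb (r := ‖x‖ + 1) (by positivity)) fun n => ?_
  rw [norm_mul, norm_pow]
  gcongr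
  simp

theorem kummerCoeff_zero (a b : ℂ) : kummerCoeff a b 0 = 1 := by simp [kummerCoeff]

theorem kummerCoeff_succ (a : ℂ) {b : ℂ} (hb : ∀ m : ℕ, b ≠ -m) (n : ℕ) :
    (n + 1 : ℂ) * (b + n) * kummerCoeff a b (n + 1) = (a + n) * kummerCoeff a b n := by
  unfold kummerCoeff
  have h2 := ascPochhammer_eval_ne_zero hb n
  have h3 : b + n ≠ 0 := fun h => hb n (eq_neg_of_add_eq_zero_left h)
  have h4 : (n + 1 : ℂ) ≠ 0 := by exact_mod_cast n.succ_ne_zero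
  have h5 : (n.factorial : ℂ) ≠ 0 := by exact_mod_cast n.factorial_ne_zero
  rw [ascPochhammer_eval_succ', ascPochhammer_eval_succ', Nat.factorial_succ]
  push_cast
  field_simp

theorem kummerCoeff_succ' (a : ℂ) {b : ℂ} (hb : ∀ m : ℕ, b ≠ -m) (n : ℕ) :
    (n + 1 : ℂ) * kummerCoeff a b (n + 1) = a / b * kummerCoeff (a + 1) (b + 1) n := by
  unfold kummerCoeff
  have hb' : ∀ m : ℕ, b + 1 ≠ -m := fun m h => hb (m + 1) (by push_cast; linear_combination h)
  have h2 := ascPochhammer_eval_ne_zero hb' n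
  have h3 : b ≠ 0 := by simpa using hb 0
  have h4 : (n + 1 : ℂ) ≠ 0 := by exact_mod_cast n.succ_ne_zero
  have h5 : (n.factorial : ℂ) ≠ 0 := by exact_mod_cast n.factorial_ne_zero
  rw [ascPochhammer_eval_succ_left, ascPochhammer_eval_succ_left, Nat.factorial_succ]
  push_cast
  field_simp

theorem add_one_ne_neg_nat {b : ℂ} (hb : ∀ m : ℕ, b ≠ -m) : ∀ m : ℕ, b + 1 ≠ -m :=
  fun m h => hb (m + 1) (by push_cast; linear_combination h)

theorem kummerM_zero (a b : ℂ) : kummerM a b 0 = 1 := by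
  rw [kummerM_eq, tsum_eq_single 0]
  · simp [kummerCoeff_zero]
  · intro n hn; simp [hn]

theorem hasDerivAt_kummerM (a : ℂ) {b : ℂ} (hb : ∀ m : ℕ, b ≠ -m) (x : ℂ) :
    HasDerivAt (kummerM a b) (a / b * kummerM (a + 1) (b + 1) x) x := by
  have h := hasDerivAt_tsum_mul_pow (fun r hr => summable_norm_kummerCoeff a hb hr) x
  rw [funext (kummerM_eq a b)]
  convert h using 1
  rw [kummerM_eq, ← tsum_mul_left]
  refine tsum_congr fun n => ?_
  rw [kummerCoeff_succ' a hb]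
  ring

/-- Passes from the series of f' to that of the Euler operator x f', so that differential and
contiguous relations can be compared coefficient by coefficient. -/
theorem hasSum_mul_of_hasSum_succ {d : ℕ → ℂ} {x S : ℂ}
    (h : HasSum (fun n : ℕ => (n + 1 : ℂ) * d (n + 1) * x ^ n) S) :
    HasSum (fun n : ℕ => (n : ℂ) * d n * x ^ n) (x * S) := by
  rw [← hasSum_nat_add_iff' 1]
  simp only [Finset.range_one, Finset.sum_singleton, Nat.cast_zero, zero_mul, sub_zero]
  refine HasSum.congr_fun (h.mul_left x) fun n => ?_
  push_cast
  ring

/-- Kummer's differential equation, in terms of contiguous functions. -/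
theorem kummerM_ode (a : ℂ) {b : ℂ} (hb : ∀ m : ℕ, b ≠ -m) (x : ℂ) :
    x * (a / b * ((a + 1) / (b + 1) * kummerM (a + 1 + 1) (b + 1 + 1) x)) +
      (b - x) * (a / b * kummerM (a + 1) (b + 1) x) = a * kummerM a b x := by
  have hb1 := add_one_ne_neg_nat hb
  have hb2 := add_one_ne_neg_nat hb1
  have hbc := summable_kummerCoeff a hb x
  have s0 : HasSum (fun n => a * (kummerCoeff a b n * x ^ n)) (a * kummerM a b x) := by
    rw [kummerM_eq]; exact hbc.hasSum.mul_left _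
  have s1 : HasSum (fun n : ℕ => (n + 1 : ℂ) * kummerCoeff a b (n + 1) * x ^ n)
      (a / b * kummerM (a + 1) (b + 1) x) := by
    have := (summable_kummerCoeff (a + 1) hb1 x).hasSum.mul_left (a / b)
    rw [kummerM_eq]
    refine HasSum.congr_fun this fun n => ?_
    rw [kummerCoeff_succ' a hb]; ring
  have s2 : HasSum (fun n : ℕ => (n + 1 : ℂ) * ((n + 1 + 1 : ℂ) * kummerCoeff a b (n + 1 + 1))
      * x ^ n) (a / b * ((a + 1) / (b + 1) * kummerM (a + 1 + 1) (b + 1 + 1) x)) := by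
    have := ((summable_kummerCoeff (a + 1 + 1) hb2 x).hasSum.mul_left
      ((a + 1) / (b + 1))).mul_left (a / b)
    rw [kummerM_eq]
    refine HasSum.congr_fun this fun n => ?_
    have h1 := kummerCoeff_succ' a hb (n + 1)
    have h2 := kummerCoeff_succ' (a + 1) hb1 n
    push_cast at h1
    rw [h1]
    linear_combination (a / b) * x ^ n * h2
  have s1' := hasSum_mul_of_hasSum_succ (d := kummerCoeff a b) s1
  have s2' := hasSum_mul_of_hasSum_succ (d := fun n => (n + 1 : ℂ) * kummerCoeff a b (n + 1))
    (x := x) (HasSum.congr_fun s2 fun n => by push_cast; ring)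
  have := (s2'.add (s1.mul_left b)).sub s1'
  rw [sub_mul, ← add_sub_assoc]
  refine this.unique (HasSum.congr_fun s0 fun n => ?_)
  linear_combination x ^ n * kummerCoeff_succ a hb n

/-- Each coefficient is a polynomial in a and the majorant is uniform on discs. Holomorphy in a is
what the later analytic continuation needs. -/
theorem differentiable_kummerM_left {b : ℂ} (hb : ∀ m : ℕ, b ≠ -m) (x : ℂ) :
    Differentiable ℂ fun a => kummerM a b x := by
  intro a
  set A : ℝ := ‖a‖ + 1
  have : DifferentiableOn ℂ (fun a => ∑' n, kummerCoeff a b n * x ^ n) (Metric.ball 0 A) := by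
    refine Complex.differentiableOn_tsum_of_summable_norm
      (summable_kummer_majorant (A := A) (r := ‖x‖ + 1) (by positivity) hb (by positivity))
      (fun n => ?_) Metric.isOpen_ball fun n w hw => ?_
    · unfold kummerCoeff
      refine Differentiable.differentiableOn ?_
      exact (((ascPochhammer ℂ n).differentiable).div_const _).mul_const _
    · rw [norm_mul, norm_pow]
      refine mul_le_mul (norm_kummerCoeff_le (by simpa using (Metric.mem_ball.1 hw).le) b n)
        (by gcongr; simp) (by positivity) ?_
      have := ascPochhammer_pos n A (by positivity)
      positivity
  simp_rw [kummerM_eq]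
  exact (this.differentiableAt (Metric.isOpen_ball.mem_nhds (by simp [A])))

end MaassPoincare

namespace MaassPoincare

open Set MeasureTheory

/-! ### The Laplace integral `∫₀^∞ e^{-xt} t^{p-1} (1+t)^{q-1} dt` -/

/-- The integrand `e^{-xt} t^{p-1} (1+t)^{q-1}`. -/
def lapKer (p q : ℂ) (x t : ℝ) : ℂ :=
  Complex.exp (-(x * t : ℝ)) * (t : ℂ) ^ (p - 1) * ((1 + t : ℝ) : ℂ) ^ (q - 1)

/-- The Laplace integral `∫₀^∞ e^{-xt} t^{p-1} (1+t)^{q-1} dt = Γ(p) U(p, p+q, x)`. -/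
def lapInt (p q : ℂ) (x : ℝ) : ℂ := ∫ t in Ioi 0, lapKer p q x t

theorem norm_lapKer (p q : ℂ) (x : ℝ) {t : ℝ} (ht : 0 < t) :
    ‖lapKer p q x t‖ = Real.exp (-(x * t)) * t ^ (p.re - 1) * (1 + t) ^ (q.re - 1) := by
  unfold lapKer
  rw [norm_mul, norm_mul, Complex.norm_exp, Complex.norm_cpow_eq_rpow_re_of_pos ht,
    Complex.norm_cpow_eq_rpow_re_of_pos (by linarith)]
  simp

theorem measurable_lapKer (p q : ℂ) (x : ℝ) : Measurable (lapKer p q x) := by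
  unfold lapKer
  fun_prop

theorem exists_rpow_one_add_mul_exp_le (Q : ℝ) {x : ℝ} (hx : 0 < x) :
    ∃ C, 0 ≤ C ∧ ∀ t : ℝ, 0 ≤ t →
      (1 + t) ^ Q * Real.exp (-(x * t)) ≤ C * Real.exp (-(x / 2) * t) := by
  obtain ⟨n, hn⟩ := exists_nat_ge Q
  -- One term of the exponential series, u^n / n! ≤ e^u at u = (x/2)(1 + t), bounds the power at the
  -- cost of half the exponential rate.
  refine ⟨n.factorial * (2 / x) ^ n * Real.exp (x / 2), by positivity, fun t ht => ?_⟩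
  have h1 : (1 + t) ^ Q ≤ (1 + t) ^ n := by
    rw [← Real.rpow_natCast]
    exact Real.rpow_le_rpow_of_exponent_le (by linarith) hn
  have h2 := Real.pow_div_factorial_le_exp (x / 2 * (1 + t)) (by positivity) n
  rw [div_le_iff₀ (by positivity), mul_pow] at h2
  have h3 : (1 + t) ^ n ≤ n.factorial * (2 / x) ^ n * Real.exp (x / 2 * (1 + t)) := by
    have : (1 + t) ^ n = (2 / x) ^ n * ((x / 2) ^ n * (1 + t) ^ n) := by
      rw [← mul_assoc, ← mul_pow]; field_simp; simp
    rw [this]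
    calc _ ≤ (2 / x) ^ n * (Real.exp (x / 2 * (1 + t)) * n.factorial) := by gcongr
      _ = _ := by ring
  calc _ ≤ n.factorial * (2 / x) ^ n * Real.exp (x / 2 * (1 + t)) * Real.exp (-(x * t)) := by
        gcongr; exact h1.trans h3
    _ = _ := by
        rw [mul_assoc, ← Real.exp_add, mul_assoc _ (Real.exp _), ← Real.exp_add]
        congr 2; ring

theorem integrableOn_exp_mul_rpow_mul_rpow {P : ℝ} (hP : 0 < P) (Q : ℝ) {x : ℝ} (hx : 0 < x) :
    IntegrableOn (fun t : ℝ => Real.exp (-(x * t)) * t ^ (P - 1) * (1 + t) ^ Q) (Ioi 0) := by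
  obtain ⟨C, hC0, hC⟩ := exists_rpow_one_add_mul_exp_le Q hx
  have h := (integrableOn_rpow_mul_exp_neg_mul_rpow (p := 1) (s := P - 1) (b := x / 2)
    (by linarith) one_pos (by positivity)).const_mul C
  refine h.mono' (by fun_prop) ((ae_restrict_mem measurableSet_Ioi).mono fun t ht => ?_)
  have ht' : 0 < t := ht
  rw [Real.norm_of_nonneg (by positivity), Real.rpow_one]
  calc _ = t ^ (P - 1) * ((1 + t) ^ Q * Real.exp (-(x * t))) := by ring
    _ ≤ t ^ (P - 1) * (C * Real.exp (-(x / 2) * t)) := mul_le_mul_of_nonneg_left (hC t ht'.le) (by positivity)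
    _ = _ := by ring

theorem integrableOn_lapKer {p : ℂ} (hp : 0 < p.re) (q : ℂ) {x : ℝ} (hx : 0 < x) :
    IntegrableOn (lapKer p q x) (Ioi 0) := by
  refine (integrableOn_exp_mul_rpow_mul_rpow hp (q.re - 1) hx).mono'
    (measurable_lapKer p q x).aestronglyMeasurable
    ((ae_restrict_mem measurableSet_Ioi).mono fun t ht => (norm_lapKer p q x ht).le)

theorem integrableOn_rpow_mul_one_add_rpow {P R : ℝ} (hP : 0 < P) (hR : P < R) :
    IntegrableOn (fun t : ℝ => t ^ (P - 1) * (1 + t) ^ (-R)) (Ioi 0) := by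
  rw [← Ioc_union_Ioi_eq_Ioi (zero_le_one' ℝ)]
  refine IntegrableOn.union ?_ ?_
  · have h : IntegrableOn (fun t : ℝ => t ^ (P - 1)) (Ioc 0 1) := by
      rw [← intervalIntegrable_iff_integrableOn_Ioc_of_le zero_le_one]
      exact intervalIntegral.intervalIntegrable_rpow' (by linarith)
    refine h.mono' (by fun_prop) ((ae_restrict_mem measurableSet_Ioc).mono fun t ht => ?_)
    have ht' : 0 < t := ht.1
    rw [Real.norm_of_nonneg (by positivity)]
    exact mul_le_of_le_one_right (by positivity)
      (Real.rpow_le_one_of_one_le_of_nonpos (by linarith) (by linarith))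
  · have h : IntegrableOn (fun t : ℝ => t ^ (P - 1 - R)) (Ioi 1) :=
      integrableOn_Ioi_rpow_of_lt (by linarith) one_pos
    refine h.mono' (by fun_prop) ((ae_restrict_mem measurableSet_Ioi).mono fun t ht => ?_)
    have ht' : 0 < t := one_pos.trans ht
    rw [Real.norm_of_nonneg (by positivity), sub_eq_add_neg _ R, Real.rpow_add ht']
    exact mul_le_mul_of_nonneg_left
      (Real.rpow_le_rpow_of_nonpos ht' (by linarith) (by linarith)) (by positivity)

/-- `L(p, q+1) = L(p, q) + L(p+1, q)`. -/
theorem lapInt_add_one_right {p : ℂ} (hp : 0 < p.re) (q : ℂ) {x : ℝ} (hx : 0 < x) :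
    lapInt p (q + 1) x = lapInt p q x + lapInt (p + 1) q x := by
  unfold lapInt
  rw [← integral_add (integrableOn_lapKer hp q hx)
    (integrableOn_lapKer (by simp; linarith) q hx)]
  refine setIntegral_congr_fun measurableSet_Ioi fun t ht => ?_
  have ht' : 0 < t := ht
  have h1 : (t : ℂ) ≠ 0 := by exact_mod_cast ht'.ne'
  have h2 : ((1 + t : ℝ) : ℂ) ≠ 0 := by exact_mod_cast (by linarith : (1 + t) ≠ 0)
  simp only [lapKer]
  rw [show q + 1 - 1 = (q - 1) + 1 by ring, show p + 1 - 1 = (p - 1) + 1 by ring,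
    Complex.cpow_add _ _ h1, Complex.cpow_add _ _ h2, Complex.cpow_one, Complex.cpow_one]
  push_cast
  ring

theorem hasDerivAt_ofReal_cpow_const_pos (c : ℂ) {t : ℝ} (ht : 0 < t) :
    HasDerivAt (fun t : ℝ => (t : ℂ) ^ c) (c * (t : ℂ) ^ (c - 1)) t := by
  have := (hasDerivAt_id (t : ℂ)).cpow_const (c := c) (Or.inl (by simpa using ht))
  simpa using this.comp_ofReal

/-- Integration by parts: `p L(p, q+1) + q L(p+1, q) = x L(p+1, q+1)`. -/
theorem lapInt_parts {p : ℂ} (hp : 0 < p.re) (q : ℂ) {x : ℝ} (hx : 0 < x) :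
    p * lapInt p (q + 1) x + q * lapInt (p + 1) q x = x * lapInt (p + 1) (q + 1) x := by
  have hp1 : 0 < (p + 1).re := by simp; linarith
  have i1 := (integrableOn_lapKer hp (q + 1) hx).const_mul p
  have i2 := (integrableOn_lapKer hp1 q hx).const_mul q
  have i3 := (integrableOn_lapKer hp1 (q + 1) hx).const_mul (x : ℂ)
  -- The function e^{-xt} t^p (1+t)^q is differentiated. It vanishes at 0 because Re p > 0 and at
  -- infinity because x > 0, so its derivative integrates to 0.
  have hd : ∀ t ∈ Ioi (0 : ℝ), HasDerivAt (lapKer (p + 1) (q + 1) x)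
      (p * lapKer p (q + 1) x t + q * lapKer (p + 1) q x t
        - x * lapKer (p + 1) (q + 1) x t) t := by
    intro t ht
    have ht' : 0 < t := ht
    have h1 := hasDerivAt_ofReal_cpow_const_pos p ht'
    have h2 := (hasDerivAt_ofReal_cpow_const_pos q (by linarith : 0 < 1 + t)).scomp t
      ((hasDerivAt_id t).const_add 1)
    have h3 : HasDerivAt (fun t : ℝ => Complex.exp (-(x * t : ℝ)))
        (Complex.exp (-(x * t : ℝ)) * (-x)) t := by
      have : HasDerivAt (fun t : ℝ => (-(x * t : ℝ) : ℂ)) (-x) t := by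
        have := ((hasDerivAt_id t).const_mul x).neg.ofReal_comp
        simpa using this
      exact this.cexp
    have := (h3.mul h1).mul h2
    have e : lapKer (p + 1) (q + 1) x = fun t : ℝ => Complex.exp (-(x * t : ℝ)) *
        (t : ℂ) ^ p * ((1 + t : ℝ) : ℂ) ^ q := by
      funext t; simp [lapKer]
    rw [e]
    convert! this using 1
    simp only [lapKer, add_sub_cancel_right, Function.comp_apply, one_smul, Pi.mul_apply]
    ring
  have hlim : Tendsto (lapKer (p + 1) (q + 1) x) atTop (𝓝 0) := by
    obtain ⟨C, hC0, hC⟩ := exists_rpow_one_add_mul_exp_le q.re hx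
    rw [tendsto_zero_iff_norm_tendsto_zero]
    have h := (tendsto_rpow_mul_exp_neg_mul_atTop_nhds_zero p.re (x / 2) (by positivity)).const_mul C
    rw [mul_zero] at h
    refine squeeze_zero' (Eventually.of_forall fun _ => norm_nonneg _) ?_ h
    filter_upwards [eventually_gt_atTop 0] with t ht
    rw [norm_lapKer _ _ _ ht]
    simp only [Complex.add_re, Complex.one_re, add_sub_cancel_right]
    calc _ = t ^ p.re * ((1 + t) ^ q.re * Real.exp (-(x * t))) := by ring
      _ ≤ t ^ p.re * (C * Real.exp (-(x / 2) * t)) := mul_le_mul_of_nonneg_left (hC t ht.le) (by positivity)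
      _ = _ := by ring
  have hcont : ContinuousWithinAt (lapKer (p + 1) (q + 1) x) (Ici 0) 0 := by
    apply ContinuousAt.continuousWithinAt
    unfold lapKer
    refine ContinuousAt.mul (ContinuousAt.mul (by fun_prop) ?_) ?_
    · exact Complex.continuousAt_ofReal_cpow_const _ _ (Or.inl (by simpa using hp))
    · refine ContinuousAt.cpow (by fun_prop) (by fun_prop) (Or.inl (by simp))
  have key := integral_Ioi_of_hasDerivAt_of_tendsto hcont hd ((i1.add i2).sub i3) hlim
  have h0 : lapKer (p + 1) (q + 1) x 0 = 0 := by
    have : p ≠ 0 := by rintro rfl; simp at hp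
    simp [lapKer, Complex.zero_cpow this]
  have e1 := integral_sub (i1.add i2) i3
  simp only [Pi.add_apply] at e1
  rw [e1, integral_add i1 i2, integral_const_mul, integral_const_mul,
    integral_const_mul, h0, sub_zero] at key
  exact sub_eq_zero.1 key

/-- Differentiation under the integral brings down -t, which raises p by one. For arguments above
x/2 the integrand at x/2 dominates. -/
theorem hasDerivAt_lapInt {p : ℂ} (hp : 0 < p.re) (q : ℂ) {x : ℝ} (hx : 0 < x) :
    HasDerivAt (lapInt p q) (-lapInt (p + 1) q x) x := by
  have hp1 : 0 < (p + 1).re := by simp; linarith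
  have hx2 : 0 < x / 2 := by positivity
  have key := (hasDerivAt_integral_of_dominated_loc_of_deriv_le (μ := volume.restrict (Ioi (0 : ℝ)))
    (F := lapKer p q) (F' := fun x t => -lapKer (p + 1) q x t) (x₀ := x) (s := Ioi (x / 2))
    (bound := fun t => Real.exp (-(x / 2 * t)) * t ^ ((p + 1).re - 1) * (1 + t) ^ (q.re - 1))
    (Ioi_mem_nhds (by linarith))
    (Eventually.of_forall fun y => (measurable_lapKer p q y).aestronglyMeasurable)
    (integrableOn_lapKer hp q hx) (measurable_lapKer _ q x).neg.aestronglyMeasurable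
    ((ae_restrict_mem measurableSet_Ioi).mono fun t ht y hy => ?_)
    (integrableOn_exp_mul_rpow_mul_rpow hp1 _ hx2)
    ((ae_restrict_mem measurableSet_Ioi).mono fun t ht y hy => ?_)).2
  · rw [integral_neg] at key
    exact key
  · have ht' : 0 < t := ht
    have hy' : x / 2 < y := hy
    rw [norm_neg, norm_lapKer _ _ _ ht']
    gcongr
  · have ht' : (t : ℂ) ≠ 0 := by exact_mod_cast (ne_of_gt ht)
    have h3 : HasDerivAt (fun y : ℝ => Complex.exp (-(y * t : ℝ)))
        (Complex.exp (-(y * t : ℝ)) * (-t)) y := by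
      have : HasDerivAt (fun y : ℝ => (-(y * t : ℝ) : ℂ)) (-t) y := by
        have := ((hasDerivAt_id y).mul_const t).neg.ofReal_comp
        simpa using this
      exact this.cexp
    have := (h3.mul_const ((t : ℂ) ^ (p - 1))).mul_const (((1 + t : ℝ) : ℂ) ^ (q - 1))
    convert! this using 1
    simp only [lapKer]
    rw [show p + 1 - 1 = (p - 1) + 1 by ring, Complex.cpow_add _ _ ht', Complex.cpow_one]
    ring

/-- Kummer's differential equation for the Laplace integral. -/
theorem lapInt_ode {p : ℂ} (hp : 0 < p.re) (q : ℂ) {x : ℝ} (hx : 0 < x) :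
    x * lapInt (p + 1 + 1) q x - (p + q - x) * lapInt (p + 1) q x = p * lapInt p q x := by
  have h := lapInt_parts hp q hx
  rw [lapInt_add_one_right hp q hx,
    lapInt_add_one_right (p := p + 1) (by simp; linarith) q hx] at h
  linear_combination -h

/-- `(θ + p + q - 1) L(p, q) = (q - 1) L(p, q - 1)`. -/
theorem lapInt_theta {p : ℂ} (hp : 0 < p.re) (q : ℂ) {x : ℝ} (hx : 0 < x) :
    (p + q - 1) * lapInt p q x - x * lapInt (p + 1) q x = (q - 1) * lapInt p (q - 1) x := by
  have h := lapInt_parts hp (q - 1) hx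
  have h2 := lapInt_add_one_right hp (q - 1) hx
  rw [sub_add_cancel] at h h2
  linear_combination h + (q - 1) * h2

/-- Boundedness of u^δ e^{-u} at u = x(1+t) gives x^δ e^{-xt} ≪ (1+t)^{-δ} for x < 1. This trades
the factor x^δ for enough decay in t to dominate the integral, while x^δ → 0 pointwise. -/
theorem tendsto_rpow_mul_lapInt {p q : ℂ} (hp : 0 < p.re) {δ : ℝ} (hδ : 0 < δ)
    (h : (p + q).re - 1 < δ) :
    Tendsto (fun x : ℝ => ((x ^ δ : ℝ) : ℂ) * lapInt p q x) (𝓝[>] 0) (𝓝 0) := by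
  obtain ⟨C, hC0, hC⟩ := exists_rpow_one_add_mul_exp_le δ one_pos
  have key : Tendsto (fun x : ℝ => ∫ t in Ioi 0, ((x ^ δ : ℝ) : ℂ) * lapKer p q x t) (𝓝[>] 0)
      (𝓝 (∫ t in Ioi (0 : ℝ), (0 : ℂ))) := by
    refine tendsto_integral_filter_of_dominated_convergence (fun t => C * Real.exp 1 *
      (t ^ (p.re - 1) * (1 + t) ^ (-(δ + 1 - q.re)))) ?_ ?_ ?_ ?_
    · exact Eventually.of_forall fun x =>
        ((measurable_lapKer p q x).const_mul _).aestronglyMeasurable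
    · filter_upwards [Ioo_mem_nhdsGT (zero_lt_one' ℝ)] with x hx
      refine (ae_restrict_mem measurableSet_Ioi).mono fun t ht => ?_
      have ht' : 0 < t := ht
      have hx0 : 0 < x := hx.1
      rw [norm_mul, norm_lapKer _ _ _ ht', Complex.norm_real, Real.norm_of_nonneg (by positivity)]
      have e1 : x ^ δ * Real.exp (-(x * t)) ≤ C * Real.exp 1 * (1 + t) ^ (-δ) := by
        have h1 := hC (x * (1 + t)) (by positivity)
        have h2 : (x * (1 + t)) ^ δ ≤ (1 + x * (1 + t)) ^ δ :=
          Real.rpow_le_rpow (by positivity) (by linarith) hδ.le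
        have h3 : (x * (1 + t)) ^ δ * Real.exp (-(x * (1 + t))) ≤ C := by
          calc _ ≤ (1 + x * (1 + t)) ^ δ * Real.exp (-(1 * (x * (1 + t)))) := by
                rw [one_mul]; gcongr
            _ ≤ _ := h1
            _ ≤ C * 1 := by
                gcongr
                apply Real.exp_le_one_iff.2
                have : 0 ≤ x * (1 + t) := by positivity
                linarith
            _ = C := mul_one C
        rw [Real.mul_rpow hx0.le (by linarith), mul_add, mul_one, neg_add, Real.exp_add] at h3
        have h4 : Real.exp (-x) * Real.exp 1 ≥ 1 := by
          rw [← Real.exp_add]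
          exact Real.one_le_exp (by linarith [hx.2])
        have h5 : (1 + t) ^ δ * (1 + t) ^ (-δ) = 1 := by
          rw [← Real.rpow_add (by linarith)]; simp
        calc x ^ δ * Real.exp (-(x * t))
            ≤ x ^ δ * Real.exp (-(x * t)) * (Real.exp (-x) * Real.exp 1) :=
              le_mul_of_one_le_right (by positivity) h4
          _ = (x ^ δ * (1 + t) ^ δ * (Real.exp (-x) * Real.exp (-(x * t)))) * Real.exp 1
                * (1 + t) ^ (-δ) := by linear_combination (-x ^ δ * Real.exp (-(x * t)) *
                  (Real.exp (-x) * Real.exp 1)) * h5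
          _ ≤ _ := by gcongr
      calc _ = (x ^ δ * Real.exp (-(x * t))) * (t ^ (p.re - 1) * (1 + t) ^ (q.re - 1)) := by ring
        _ ≤ (C * Real.exp 1 * (1 + t) ^ (-δ)) * (t ^ (p.re - 1) * (1 + t) ^ (q.re - 1)) := by
            gcongr
        _ = _ := by
            rw [show -(δ + 1 - q.re) = -δ + (q.re - 1) by ring, Real.rpow_add (by linarith)]
            ring
    · exact (integrableOn_rpow_mul_one_add_rpow hp (by simp at h; linarith)).const_mul _
    · refine (ae_restrict_mem measurableSet_Ioi).mono fun t ht => ?_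
      have e1 : Tendsto (fun x : ℝ => ((x ^ δ : ℝ) : ℂ)) (𝓝[>] 0) (𝓝 0) := by
        have : ContinuousAt (fun x : ℝ => x ^ δ) 0 := Real.continuousAt_rpow_const _ _ (Or.inr hδ.le)
        have := (Complex.continuous_ofReal.continuousAt.comp this).tendsto
        simp only [Function.comp_apply, Real.zero_rpow hδ.ne', Complex.ofReal_zero] at this
        exact this.mono_left nhdsWithin_le_nhds
      have e2 : Tendsto (fun x : ℝ => lapKer p q x t) (𝓝[>] 0) (𝓝 (lapKer p q 0 t)) := by
        have : Continuous fun x : ℝ => lapKer p q x t := by unfold lapKer; fun_prop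
        exact (this.tendsto 0).mono_left nhdsWithin_le_nhds
      simpa using e1.mul e2
  simp only [integral_zero, integral_const_mul] at key
  exact key

/-- The substitution t ↦ t/x turns the left side into ∫ e^{-t} t^{p-1} (x+t)^{q-1} dt, which becomes
a Gamma integral as x → 0. -/
theorem tendsto_cpow_mul_lapInt {p q : ℂ} (hp : 0 < p.re) (h : 1 < (p + q).re) :
    Tendsto (fun x : ℝ => (x : ℂ) ^ (p + q - 1) * lapInt p q x) (𝓝[>] 0)
      (𝓝 (Complex.Gamma (p + q - 1))) := by
  rw [Complex.Gamma_eq_integral (by simp at h ⊢; linarith), Complex.GammaIntegral]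
  have hs : ∀ x : ℝ, 0 < x → (x : ℂ) ^ (p + q - 1) * lapInt p q x =
      ∫ t in Ioi (0 : ℝ), Complex.exp (-(t : ℝ)) * (t : ℂ) ^ (p - 1)
        * ((x + t : ℝ) : ℂ) ^ (q - 1) := by
    intro x hx
    have hxc : (x : ℂ) ≠ 0 := by exact_mod_cast hx.ne'
    have := integral_comp_mul_left_Ioi (fun t => lapKer p q x t) 0 (inv_pos.2 hx)
    rw [inv_inv, mul_zero] at this
    unfold lapInt
    rw [show (∫ t in Ioi (0 : ℝ), lapKer p q x t) = (x : ℂ)⁻¹ *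
      (x • ∫ t in Ioi (0 : ℝ), lapKer p q x t) by
        rw [Complex.real_smul, inv_mul_cancel_left₀ hxc], ← this, ← mul_assoc,
      ← integral_const_mul]
    refine setIntegral_congr_fun measurableSet_Ioi fun t ht => ?_
    have ht' : 0 < t := ht
    simp only [lapKer]
    have e1 : ((1 + x⁻¹ * t : ℝ) : ℂ) ^ (q - 1) = ((x⁻¹ : ℝ) : ℂ) ^ (q - 1) *
        ((x + t : ℝ) : ℂ) ^ (q - 1) := by
      rw [← Complex.mul_cpow_ofReal_nonneg (by positivity) (by positivity), ← Complex.ofReal_mul]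
      congr 2; field_simp
    have e2 : ((x⁻¹ * t : ℝ) : ℂ) ^ (p - 1) = ((x⁻¹ : ℝ) : ℂ) ^ (p - 1) * (t : ℂ) ^ (p - 1) := by
      rw [← Complex.mul_cpow_ofReal_nonneg (by positivity) (by positivity), ← Complex.ofReal_mul]
    have e3 : x * (x⁻¹ * t) = t := by field_simp
    have e4 : (x : ℂ) ^ (p + q - 1) * (x : ℂ)⁻¹ *
        (((x⁻¹ : ℝ) : ℂ) ^ (p - 1) * ((x⁻¹ : ℝ) : ℂ) ^ (q - 1)) = 1 := by
      have harg : Complex.arg x ≠ Real.pi := by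
        rw [Complex.arg_ofReal_of_nonneg hx.le]; exact Real.pi_pos.ne
      rw [Complex.ofReal_inv, Complex.inv_cpow _ _ harg, Complex.inv_cpow _ _ harg,
        show p + q - 1 = (p - 1) + (q - 1) + 1 by ring, Complex.cpow_add _ _ hxc,
        Complex.cpow_add _ _ hxc, Complex.cpow_one]
      have h1 : (x : ℂ) ^ (p - 1) ≠ 0 := by simp [Complex.cpow_eq_zero_iff, hxc]
      have h2 : (x : ℂ) ^ (q - 1) ≠ 0 := by simp [Complex.cpow_eq_zero_iff, hxc]
      field_simp
    rw [e1, e2, e3]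
    linear_combination (Complex.exp (-(t : ℝ)) * (t : ℂ) ^ (p - 1)
        * ((x + t : ℝ) : ℂ) ^ (q - 1)) * e4
  have hlim : Tendsto (fun x : ℝ => ∫ t in Ioi (0 : ℝ), Complex.exp (-(t : ℝ)) * (t : ℂ) ^ (p - 1)
        * ((x + t : ℝ) : ℂ) ^ (q - 1)) (𝓝[>] 0)
      (𝓝 (∫ t in Ioi (0 : ℝ), ((Real.exp (-t) : ℝ) : ℂ) * (t : ℂ) ^ (p + q - 1 - 1))) := by
    -- For 0 < x < 1 the power (x+t)^{Re q - 1} lies below its value at x = 1 or at x = 0 according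
    -- to the sign of Re q - 1. The sum of both values serves in either case.
    refine tendsto_integral_filter_of_dominated_convergence
      (fun t => Real.exp (-(1 * t)) * t ^ (p.re + q.re - 1 - 1) * (1 + t) ^ (0 : ℝ) +
        Real.exp (-(1 * t)) * t ^ (p.re - 1) * (1 + t) ^ (q.re - 1)) ?_ ?_ ?_ ?_
    · exact Eventually.of_forall fun x => by fun_prop
    · filter_upwards [Ioo_mem_nhdsGT (zero_lt_one' ℝ)] with x hx
      refine (ae_restrict_mem measurableSet_Ioi).mono fun t ht => ?_
      have ht' : 0 < t := ht
      have hx0 : 0 < x := hx.1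
      rw [norm_mul, norm_mul, Complex.norm_exp, Complex.norm_cpow_eq_rpow_re_of_pos ht',
        Complex.norm_cpow_eq_rpow_re_of_pos (by linarith), Real.rpow_zero, mul_one, one_mul,
        show p.re + q.re - 1 - 1 = (p.re - 1) + (q.re - 1) by ring, Real.rpow_add ht',
        ← mul_assoc, ← mul_add]
      simp only [Complex.sub_re, Complex.one_re, Complex.neg_re, Complex.ofReal_re]
      gcongr
      have n1 := Real.rpow_nonneg ht'.le (q.re - 1)
      have n2 := Real.rpow_nonneg (by linarith : 0 ≤ 1 + t) (q.re - 1)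
      rcases le_total 0 (q.re - 1) with hq | hq
      · have := Real.rpow_le_rpow (by positivity) (by linarith [hx.2] : x + t ≤ 1 + t) hq
        linarith
      · have := Real.rpow_le_rpow_of_nonpos ht' (by linarith : t ≤ x + t) hq
        linarith
    · exact (integrableOn_exp_mul_rpow_mul_rpow (by simp at h; linarith) _ one_pos).add
        (integrableOn_exp_mul_rpow_mul_rpow hp _ one_pos)
    · refine (ae_restrict_mem measurableSet_Ioi).mono fun t ht => ?_
      have ht' : 0 < t := ht
      have htc : (t : ℂ) ≠ 0 := by exact_mod_cast ht'.ne'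
      have e : ((Real.exp (-t) : ℝ) : ℂ) * (t : ℂ) ^ (p + q - 1 - 1) =
          Complex.exp (-(t : ℝ)) * (t : ℂ) ^ (p - 1) * ((0 + t : ℝ) : ℂ) ^ (q - 1) := by
        rw [zero_add, mul_assoc, ← Complex.cpow_add _ _ htc, Complex.ofReal_exp]
        push_cast
        congr 2
        ring
      rw [e]
      refine Tendsto.mono_left ?_ nhdsWithin_le_nhds
      refine Tendsto.const_mul _ ?_
      have : ContinuousAt (fun x : ℝ => ((x + t : ℝ) : ℂ) ^ (q - 1)) 0 :=
        ContinuousAt.cpow (by fun_prop) (by fun_prop) (Or.inl (by simpa using ht'))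
      exact this.tendsto
  refine hlim.congr' ?_
  filter_upwards [self_mem_nhdsWithin] with x hx
  exact (hs x hx).symm

end MaassPoincare

namespace MaassPoincare

open Set MeasureTheory

/-! ### Connection formula for the confluent hypergeometric function -/

theorem cpow_add_one' (c : ℂ) {x : ℂ} (hx : x ≠ 0) : x ^ (c + 1) = x ^ c * x := by
  rw [Complex.cpow_add _ _ hx, Complex.cpow_one]

/-- The substitution t = u/(1-u) gives Euler's Beta integral with parameters p and 1 - p - q. -/
theorem integral_cpow_mul_one_add_cpow {p q : ℂ} (hp : 0 < p.re) (h : (p + q).re < 1) :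
    ∫ t in Ioi (0 : ℝ), (t : ℂ) ^ (p - 1) * ((1 + t : ℝ) : ℂ) ^ (q - 1) =
      Complex.Gamma p * Complex.Gamma (1 - p - q) / Complex.Gamma (1 - q) := by
  have hv : 0 < (1 - p - q).re := by simp at h ⊢; linarith
  have hβ := Complex.betaIntegral_eq_Gamma_mul_div p (1 - p - q) hp hv
  rw [show p + (1 - p - q) = 1 - q by ring] at hβ
  rw [← hβ, Complex.betaIntegral, intervalIntegral.integral_of_le zero_le_one,
    integral_Ioc_eq_integral_Ioo]
  have himg : (fun u : ℝ => u / (1 - u)) '' Ioo 0 1 = Ioi 0 := by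
    ext t
    simp only [mem_image, mem_Ioo, mem_Ioi]
    constructor
    · rintro ⟨u, ⟨hu0, hu1⟩, rfl⟩
      exact div_pos hu0 (by linarith)
    · intro ht
      refine ⟨t / (1 + t), ⟨by positivity, by rw [div_lt_one (by linarith)]; linarith⟩, ?_⟩
      field_simp
      ring
  have hinj : InjOn (fun u : ℝ => u / (1 - u)) (Ioo 0 1) := by
    intro u hu v hv huv
    have h1 : 1 - u ≠ 0 := by linarith [hu.2]
    have h2 : 1 - v ≠ 0 := by linarith [hv.2]
    simp only [div_eq_div_iff h1 h2] at huv
    linarith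
  have hder : ∀ u ∈ Ioo (0 : ℝ) 1,
      HasDerivWithinAt (fun u : ℝ => u / (1 - u)) (1 / (1 - u) ^ 2) (Ioo 0 1) u := by
    intro u hu
    have h1 : 1 - u ≠ 0 := by linarith [hu.2]
    have := ((hasDerivAt_id u).div ((hasDerivAt_id u).const_sub 1) h1).hasDerivWithinAt
      (s := Ioo 0 1)
    convert! this using 1
    simp
  rw [← himg, integral_image_eq_integral_abs_deriv_smul measurableSet_Ioo hder hinj]
  refine setIntegral_congr_fun measurableSet_Ioo fun u hu => ?_
  obtain ⟨hu0, hu1⟩ := hu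
  have h1 : 0 < 1 - u := by linarith
  have h1c : ((1 - u : ℝ) : ℂ) ≠ 0 := by exact_mod_cast h1.ne'
  have harg : Complex.arg ((1 - u : ℝ) : ℂ) ≠ Real.pi := by
    rw [Complex.arg_ofReal_of_nonneg h1.le]; exact Real.pi_pos.ne
  have e1 : 1 + u / (1 - u) = (1 - u)⁻¹ := by field_simp; ring
  have e2 : ((u / (1 - u) : ℝ) : ℂ) ^ (p - 1) =
      (u : ℂ) ^ (p - 1) * (((1 - u : ℝ) : ℂ) ^ (p - 1))⁻¹ := by
    rw [div_eq_mul_inv, Complex.ofReal_mul, Complex.mul_cpow_ofReal_nonneg hu0.le (by positivity),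
      Complex.ofReal_inv, Complex.inv_cpow _ _ harg]
  have e3 : ((1 - u : ℝ) : ℂ) ^ (1 - p - q - 1) = (((1 - u : ℝ) : ℂ) ^ (p - 1))⁻¹ *
      (((1 - u : ℝ) : ℂ) ^ (q - 1))⁻¹ * (((1 - u : ℝ) : ℂ) ^ 2)⁻¹ := by
    rw [← Complex.cpow_neg, ← Complex.cpow_neg, ← Complex.cpow_add _ _ h1c,
      ← Complex.cpow_natCast, ← Complex.cpow_neg, ← Complex.cpow_add _ _ h1c]
    congr 1
    push_cast
    ring
  rw [e1, e2, abs_of_pos (by positivity), Complex.real_smul, Complex.ofReal_inv,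
    Complex.inv_cpow _ _ harg, show (1 - (u : ℂ)) = ((1 - u : ℝ) : ℂ) by push_cast; rfl, e3]
  push_cast
  ring

/-- When Re(p+q) < 1 the integral still converges at x = 0, and that integrand dominates all others.
-/
theorem tendsto_lapInt_zero {p q : ℂ} (hp : 0 < p.re) (h : (p + q).re < 1) :
    Tendsto (lapInt p q) (𝓝[>] 0)
      (𝓝 (Complex.Gamma p * Complex.Gamma (1 - p - q) / Complex.Gamma (1 - q))) := by
  rw [← integral_cpow_mul_one_add_cpow hp h]
  refine tendsto_integral_filter_of_dominated_convergence
    (fun t => t ^ (p.re - 1) * (1 + t) ^ (-(1 - q.re))) ?_ ?_ ?_ ?_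
  · exact Eventually.of_forall fun x => (measurable_lapKer p q x).aestronglyMeasurable
  · filter_upwards [self_mem_nhdsWithin] with x hx
    refine (ae_restrict_mem measurableSet_Ioi).mono fun t ht => ?_
    have ht' : 0 < t := ht
    have hx' : 0 < x := hx
    rw [norm_lapKer _ _ _ ht', neg_sub, mul_assoc]
    exact mul_le_of_le_one_left (by positivity)
      (Real.exp_le_one_iff.2 (by have := mul_pos hx' ht'; linarith))
  · exact integrableOn_rpow_mul_one_add_rpow hp (by simp at h; linarith)
  · refine (ae_restrict_mem measurableSet_Ioi).mono fun t ht => ?_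
    have : Continuous fun x : ℝ => lapKer p q x t := by unfold lapKer; fun_prop
    have := (this.tendsto 0).mono_left (nhdsWithin_le_nhds (s := Ioi 0))
    simpa [lapKer] using this

/-- Abel's identity: x^b e^{-x} is the integrating factor of Kummer's equation, so the weighted
Wronskian has derivative 0 and its value can be read off at 0+. -/
theorem wronskian_const {a b : ℂ} {f f1 f2 g g1 g2 : ℝ → ℂ}
    (hf : ∀ x, 0 < x → HasDerivAt f (f1 x) x) (hf1 : ∀ x, 0 < x → HasDerivAt f1 (f2 x) x)
    (hg : ∀ x, 0 < x → HasDerivAt g (g1 x) x) (hg1 : ∀ x, 0 < x → HasDerivAt g1 (g2 x) x)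
    (of : ∀ x : ℝ, 0 < x → x * f2 x + (b - x) * f1 x = a * f x)
    (og : ∀ x : ℝ, 0 < x → x * g2 x + (b - x) * g1 x = a * g x) {C : ℂ}
    (hC : Tendsto (fun x : ℝ => (x : ℂ) ^ b * Complex.exp (-x) * (f x * g1 x - f1 x * g x))
      (𝓝[>] 0) (𝓝 C)) {x : ℝ} (hx : 0 < x) :
    (x : ℂ) ^ b * Complex.exp (-x) * (f x * g1 x - f1 x * g x) = C := by
  set w : ℝ → ℂ := fun x : ℝ => (x : ℂ) ^ b * Complex.exp (-x) * (f x * g1 x - f1 x * g x)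
  have hd : ∀ x, 0 < x → HasDerivAt w 0 x := by
    intro x hx
    have hxc : (x : ℂ) ≠ 0 := by exact_mod_cast hx.ne'
    have h1 := hasDerivAt_ofReal_cpow_const_pos b hx
    have h2 : HasDerivAt (fun x : ℝ => Complex.exp (-x)) (Complex.exp (-x) * (-1)) x := by
      have : HasDerivAt (fun x : ℝ => (-x : ℂ)) (-1) x := by
        simpa using (hasDerivAt_id x).neg.ofReal_comp
      exact this.cexp
    have := (h1.mul h2).mul (((hf x hx).mul (hg1 x hx)).sub ((hf1 x hx).mul (hg x hx)))
    convert! this using 1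
    simp only [Pi.mul_apply, Pi.sub_apply]
    have e : (x : ℂ) ^ b = (x : ℂ) ^ (b - 1) * x := by
      rw [← cpow_add_one' _ hxc, sub_add_cancel]
    rw [e]
    linear_combination (-(x : ℂ) ^ (b - 1) * Complex.exp (-x)) * (f x * og x hx - g x * of x hx)
  obtain ⟨D, hD⟩ := isOpen_Ioi.exists_is_const_of_deriv_eq_zero isPreconnected_Ioi
    (f := w) (fun x hx => (hd x hx).differentiableAt.differentiableWithinAt)
    (fun x hx => (hd x hx).deriv)
  have : Tendsto w (𝓝[>] 0) (𝓝 D) :=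
    tendsto_const_nhds.congr' (by filter_upwards [self_mem_nhdsWithin] with y hy using (hD y hy).symm)
  rw [tendsto_nhds_unique hC this]
  exact hD x hx

theorem ne_neg_nat_of_re_pos {b : ℂ} (hb : 0 < b.re) : ∀ m : ℕ, b ≠ -m := by
  rintro m rfl
  simp at hb
  have : (0 : ℝ) ≤ m := m.cast_nonneg
  linarith

theorem tendsto_kummerM_zero (a : ℂ) {b : ℂ} (hb : ∀ m : ℕ, b ≠ -m) :
    Tendsto (fun x : ℝ => kummerM a b x) (𝓝[>] 0) (𝓝 1) := by
  have h := ((hasDerivAt_kummerM a hb ((0 : ℝ) : ℂ)).comp_ofReal).continuousAt.tendsto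
  simp only [Complex.ofReal_zero, kummerM_zero] at h
  exact h.mono_left nhdsWithin_le_nhds

/-- The Laplace integral f, the function g = M(a, b, x) and h = x^{1-b} M(a-b+1, 2-b, x) all solve
Kummer's equation. Their three Wronskians, found from the asymptotics at 0+, express f through g and
h. The strip 0 < Re b < 2 makes the required limits exist, and b ≠ 1 makes g and h independent. -/
theorem lapInt_eq_kummerUFormula_of_lt_two {a b : ℂ} (ha : 0 < a.re) (hb0 : 0 < b.re)
    (hb2 : b.re < 2) (hb1 : b ≠ 1) {x : ℝ} (hx : 0 < x) :
    lapInt a (b - a) x = Complex.Gamma a * kummerUFormula a b x := by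
  have ha1 : 0 < (a + 1).re := by simp; linarith
  have hbn := ne_neg_nat_of_re_pos hb0
  have hbn1 := add_one_ne_neg_nat hbn
  have hBn : ∀ m : ℕ, 2 - b ≠ -m := ne_neg_nat_of_re_pos (by simp; linarith)
  have hBn1 := add_one_ne_neg_nat hBn
  have hΓ : 1 - b ≠ 0 := sub_ne_zero.2 hb1.symm
  set A := a - b + 1 with hA
  set N : ℝ → ℂ := fun x => kummerM A (2 - b) x with hN
  set N1 : ℝ → ℂ := fun x => A / (2 - b) * kummerM (A + 1) (2 - b + 1) x with hN1
  set N2 : ℝ → ℂ := fun x =>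
    A / (2 - b) * ((A + 1) / (2 - b + 1) * kummerM (A + 1 + 1) (2 - b + 1 + 1) x) with hN2
  have dN : ∀ x, HasDerivAt N (N1 x) x := fun x => (hasDerivAt_kummerM A hBn x).comp_ofReal
  have dN1 : ∀ x, HasDerivAt N1 (N2 x) x := fun x =>
    ((hasDerivAt_kummerM (A + 1) hBn1 x).comp_ofReal).const_mul _
  have oN : ∀ x : ℝ, x * N2 x + (2 - b - x) * N1 x = A * N x := fun x => kummerM_ode A hBn x
  have tN : Tendsto N (𝓝[>] 0) (𝓝 1) := tendsto_kummerM_zero A hBn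
  have tN1 : Tendsto N1 (𝓝[>] 0) (𝓝 (A / (2 - b) * 1)) :=
    (tendsto_kummerM_zero (A + 1) hBn1).const_mul _
  set g : ℝ → ℂ := fun x => kummerM a b x with hg
  set g1 : ℝ → ℂ := fun x => a / b * kummerM (a + 1) (b + 1) x with hg1
  set g2 : ℝ → ℂ := fun x =>
    a / b * ((a + 1) / (b + 1) * kummerM (a + 1 + 1) (b + 1 + 1) x) with hg2
  have dg : ∀ x : ℝ, 0 < x → HasDerivAt g (g1 x) x :=
    fun x _ => (hasDerivAt_kummerM a hbn x).comp_ofReal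
  have dg1 : ∀ x : ℝ, 0 < x → HasDerivAt g1 (g2 x) x := fun x _ =>
    ((hasDerivAt_kummerM (a + 1) hbn1 x).comp_ofReal).const_mul _
  have og : ∀ x : ℝ, 0 < x → x * g2 x + (b - x) * g1 x = a * g x :=
    fun x _ => kummerM_ode a hbn x
  have tg : Tendsto g (𝓝[>] 0) (𝓝 1) := tendsto_kummerM_zero a hbn
  have tg1 : Tendsto g1 (𝓝[>] 0) (𝓝 (a / b * 1)) :=
    (tendsto_kummerM_zero (a + 1) hbn1).const_mul _
  set h : ℝ → ℂ := fun x => (x : ℂ) ^ (1 - b) * N x with hh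
  set h1 : ℝ → ℂ := fun x => (1 - b) * (x : ℂ) ^ (1 - b - 1) * N x + (x : ℂ) ^ (1 - b) * N1 x
    with hh1
  set h2 : ℝ → ℂ := fun x =>
    (1 - b) * ((1 - b - 1) * (x : ℂ) ^ (1 - b - 1 - 1)) * N x
      + (1 - b) * (x : ℂ) ^ (1 - b - 1) * N1 x
      + ((1 - b) * (x : ℂ) ^ (1 - b - 1) * N1 x + (x : ℂ) ^ (1 - b) * N2 x) with hh2
  have dh : ∀ x : ℝ, 0 < x → HasDerivAt h (h1 x) x := fun x hx =>
    (hasDerivAt_ofReal_cpow_const_pos (1 - b) hx).mul (dN x)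
  have dh1 : ∀ x : ℝ, 0 < x → HasDerivAt h1 (h2 x) x := fun x hx =>
    (((hasDerivAt_ofReal_cpow_const_pos (1 - b - 1) hx).const_mul (1 - b)).mul (dN x)).add
      ((hasDerivAt_ofReal_cpow_const_pos (1 - b) hx).mul (dN1 x))
  have oh : ∀ x : ℝ, 0 < x → x * h2 x + (b - x) * h1 x = a * h x := by
    intro x hx
    have hxc : (x : ℂ) ≠ 0 := by exact_mod_cast hx.ne'
    have e1 : (x : ℂ) ^ (1 - b - 1) = (x : ℂ) ^ (1 - b - 1 - 1) * x := by
      rw [← cpow_add_one' _ hxc, sub_add_cancel]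
    have e0 : (x : ℂ) ^ (1 - b) = (x : ℂ) ^ (1 - b - 1 - 1) * x * x := by
      rw [← e1, ← cpow_add_one' _ hxc, sub_add_cancel]
    simp only [hh, hh1, hh2, e0, e1]
    linear_combination (x : ℂ) ^ (1 - b - 1 - 1) * x * x * oN x
  set f : ℝ → ℂ := lapInt a (b - a) with hf
  set f1 : ℝ → ℂ := fun x => -lapInt (a + 1) (b - a) x with hf1
  set f2 : ℝ → ℂ := fun x => - -lapInt (a + 1 + 1) (b - a) x with hf2
  have df : ∀ x : ℝ, 0 < x → HasDerivAt f (f1 x) x := fun x hx => hasDerivAt_lapInt ha _ hx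
  have df1 : ∀ x : ℝ, 0 < x → HasDerivAt f1 (f2 x) x := fun x hx =>
    (hasDerivAt_lapInt ha1 _ hx).neg
  have of : ∀ x : ℝ, 0 < x → x * f2 x + (b - x) * f1 x = a * f x := by
    intro x hx
    have := lapInt_ode ha (b - a) hx
    simp only [hf, hf1, hf2]
    linear_combination this
  have tx : Tendsto (fun x : ℝ => (x : ℂ)) (𝓝[>] 0) (𝓝 0) :=
    (Complex.continuous_ofReal.tendsto' 0 0 (by simp)).mono_left nhdsWithin_le_nhds
  have te : Tendsto (fun x : ℝ => Complex.exp (-x)) (𝓝[>] 0) (𝓝 1) := by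
    simpa using (tx.neg).cexp
  have tf1 : Tendsto (fun x : ℝ => (x : ℂ) ^ b * f1 x) (𝓝[>] 0) (𝓝 (-Complex.Gamma b)) := by
    have := (tendsto_cpow_mul_lapInt (p := a + 1) (q := b - a) ha1 (by simp; linarith)).neg
    rw [show a + 1 + (b - a) - 1 = b by ring] at this
    simpa only [hf1, mul_neg] using this
  have tf : Tendsto (fun x : ℝ => (x : ℂ) ^ b * f x) (𝓝[>] 0) (𝓝 0) := by
    have := tendsto_rpow_mul_lapInt (p := a) (q := b - a) ha hb0 (by simp)
    rw [tendsto_zero_iff_norm_tendsto_zero] at this ⊢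
    refine this.congr' ?_
    filter_upwards [self_mem_nhdsWithin] with y hy
    have hy' : 0 < y := hy
    rw [norm_mul, norm_mul, Complex.norm_cpow_eq_rpow_re_of_pos hy', Complex.norm_real,
      Real.norm_of_nonneg (by positivity)]
  have txf : Tendsto (fun x : ℝ => (x : ℂ) * f x) (𝓝[>] 0) (𝓝 0) := by
    have := tendsto_rpow_mul_lapInt (p := a) (q := b - a) ha one_pos (by simp; linarith)
    simpa using this
  set C2 := -((b - a - 1) * (Complex.Gamma a * Complex.Gamma (1 - a - (b - a - 1)) /
    Complex.Gamma (1 - (b - a - 1)))) with hC2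
  -- Only the combination need converge. By `lapInt_theta` it is a Laplace integral whose parameters
  -- add up to b - 1, and Re(b - 1) < 1 makes that one finite at 0.
  have tθ : Tendsto (fun x : ℝ => (1 - b) * f x - x * f1 x) (𝓝[>] 0) (𝓝 C2) := by
    have := ((tendsto_lapInt_zero (p := a) (q := b - a - 1) ha
      (by simp; linarith)).const_mul (b - a - 1)).neg
    refine this.congr' ?_
    filter_upwards [self_mem_nhdsWithin] with y hy
    have := lapInt_theta ha (b - a) hy
    simp only [hf, hf1]
    linear_combination this
  have hcancel : ∀ x : ℝ, 0 < x → (x : ℂ) ^ b * (x : ℂ) ^ (1 - b - 1) = 1 ∧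
      (x : ℂ) ^ b * (x : ℂ) ^ (1 - b) = x := by
    intro x hx
    have hxc : (x : ℂ) ≠ 0 := by exact_mod_cast hx.ne'
    rw [← Complex.cpow_add _ _ hxc, ← Complex.cpow_add _ _ hxc]
    constructor
    · rw [show b + (1 - b - 1) = 0 by ring, Complex.cpow_zero]
    · rw [show b + (1 - b) = 1 by ring, Complex.cpow_one]
  have wfg := wronskian_const df df1 dg dg1 of og (C := Complex.Gamma b) (by
    have := te.mul ((tf.mul tg1).sub (tf1.mul tg))
    simp only [zero_mul, mul_one, zero_sub, neg_neg, one_mul] at this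
    exact this.congr fun x => by ring) hx
  have wfh := wronskian_const df df1 dh dh1 of oh (C := C2) (by
    have := te.mul ((tN.mul tθ).add (txf.mul tN1))
    simp only [zero_mul, add_zero, one_mul] at this
    refine this.congr' ?_
    filter_upwards [self_mem_nhdsWithin] with y hy
    obtain ⟨e1, e2⟩ := hcancel y hy
    simp only [hh, hh1]
    linear_combination (-Complex.exp (-y) * f y * (1 - b) * N y) * e1 -
      (Complex.exp (-y) * (f y * N1 y - f1 y * N y)) * e2) hx
  have wgh := wronskian_const dg dg1 dh dh1 og oh (C := 1 - b) (by
    have := te.mul ((tg.mul ((tN.const_mul (1 - b)).add (tx.mul tN1))).sub ((tx.mul tg1).mul tN))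
    simp only [zero_mul, add_zero, one_mul, mul_one, sub_zero] at this
    refine this.congr' ?_
    filter_upwards [self_mem_nhdsWithin] with y hy
    obtain ⟨e1, e2⟩ := hcancel y hy
    simp only [hh, hh1]
    linear_combination (-Complex.exp (-y) * g y * (1 - b) * N y) * e1 -
      (Complex.exp (-y) * (g y * N1 y - g1 y * N y)) * e2) hx
  -- The identity f W(g,h) = g W(f,h) - h W(f,g), with the constant values inserted.
  have key : f x * (1 - b) = g x * C2 - h x * Complex.Gamma b := by
    rw [← wfg, ← wfh, ← wgh]; ring
  -- The recursion of 1/Γ is used for Γ(A), since it also holds at the poles. The point A may well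
  -- be one of them.
  have hC2' : C2 = (1 - b) * (Complex.Gamma a * Complex.Gamma (1 - b) / Complex.Gamma A) := by
    have h1 := Complex.one_div_Gamma_eq_self_mul_one_div_Gamma_add_one A
    rw [hC2, show 1 - a - (b - a - 1) = (1 - b) + 1 by ring, Complex.Gamma_add_one _ hΓ,
      show 1 - (b - a - 1) = A + 1 by rw [hA]; ring, div_eq_mul_inv, div_eq_mul_inv, h1,
      show b - a - 1 = -A by rw [hA]; ring]
    ring
  have hΓb : Complex.Gamma b = (b - 1) * Complex.Gamma (b - 1) := by
    rw [← Complex.Gamma_add_one _ (sub_ne_zero.2 hb1), sub_add_cancel]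
  have hΓa : Complex.Gamma a ≠ 0 := Complex.Gamma_ne_zero_of_re_pos ha
  rw [hC2', hΓb] at key
  have : f x = g x * (Complex.Gamma a * Complex.Gamma (1 - b) / Complex.Gamma A) +
      h x * Complex.Gamma (b - 1) := by
    apply mul_right_cancel₀ hΓ
    rw [key]; ring
  rw [this]
  unfold kummerUFormula
  simp only [hg, hh, hN, ← hA]
  field_simp

/-! ### Contiguous relations, and the connection formula for all non-integral b with positive real
part -/

theorem kummerM_contiguous (A : ℂ) {B : ℂ} (hB : ∀ m : ℕ, B ≠ -m) (x : ℂ) :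
    B * kummerM A (B + 1) x + x * (A / (B + 1) * kummerM (A + 1) (B + 1 + 1) x) =
      B * kummerM A B x := by
  have hB1 := add_one_ne_neg_nat hB
  have s1 : HasSum (fun n : ℕ => (n + 1 : ℂ) * kummerCoeff A (B + 1) (n + 1) * x ^ n)
      (A / (B + 1) * kummerM (A + 1) (B + 1 + 1) x) := by
    have := (summable_kummerCoeff (A + 1) (add_one_ne_neg_nat hB1) x).hasSum.mul_left (A / (B + 1))
    rw [kummerM_eq]
    refine HasSum.congr_fun this fun n => ?_
    rw [kummerCoeff_succ' A hB1]; ring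
  have s2 := hasSum_mul_of_hasSum_succ (d := kummerCoeff A (B + 1)) s1
  have s3 := (summable_kummerCoeff A hB1 x).hasSum.mul_left B
  have s4 := (summable_kummerCoeff A hB x).hasSum.mul_left B
  rw [← kummerM_eq] at s3 s4
  refine (s3.add s2).unique (HasSum.congr_fun s4 fun n => ?_)
  have h1 : (ascPochhammer ℂ n).eval B * (B + n) = B * (ascPochhammer ℂ n).eval (B + 1) := by
    rw [← ascPochhammer_eval_succ', ascPochhammer_eval_succ_left]
  have h2 := ascPochhammer_eval_ne_zero hB n
  have h3 := ascPochhammer_eval_ne_zero hB1 n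
  have h5 : (n.factorial : ℂ) ≠ 0 := by exact_mod_cast n.factorial_ne_zero
  unfold kummerCoeff
  field_simp
  linear_combination (ascPochhammer ℂ n).eval A * x ^ n * h1

theorem kummerM_contiguous_left (a : ℂ) {b : ℂ} (hb : ∀ m : ℕ, b ≠ -m) (x : ℂ) :
    a * kummerM (a + 1) (b + 1) x + (b - a) * kummerM a (b + 1) x = b * kummerM a b x := by
  have hb1 := add_one_ne_neg_nat hb
  have s1 := (summable_kummerCoeff (a + 1) hb1 x).hasSum.mul_left a
  have s2 := (summable_kummerCoeff a hb1 x).hasSum.mul_left (b - a)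
  have s3 := (summable_kummerCoeff a hb x).hasSum.mul_left b
  rw [← kummerM_eq] at s1 s2 s3
  refine (s1.add s2).unique (HasSum.congr_fun s3 fun n => ?_)
  have h1 : (ascPochhammer ℂ n).eval b * (b + n) = b * (ascPochhammer ℂ n).eval (b + 1) := by
    rw [← ascPochhammer_eval_succ', ascPochhammer_eval_succ_left]
  have h1' : (ascPochhammer ℂ n).eval a * (a + n) = a * (ascPochhammer ℂ n).eval (a + 1) := by
    rw [← ascPochhammer_eval_succ', ascPochhammer_eval_succ_left]
  have h2 := ascPochhammer_eval_ne_zero hb n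
  have h3 := ascPochhammer_eval_ne_zero hb1 n
  have h5 : (n.factorial : ℂ) ≠ 0 := by exact_mod_cast n.factorial_ne_zero
  unfold kummerCoeff
  field_simp
  linear_combination x ^ n * ((ascPochhammer ℂ n).eval a * h1 - (ascPochhammer ℂ n).eval b * h1')

theorem kummerM_contiguous_right (A : ℂ) {B : ℂ} (hB : ∀ m : ℕ, B ≠ -m) (x : ℂ) :
    B * kummerM (A + 1) B x - B * kummerM A B x = x * kummerM (A + 1) (B + 1) x := by
  have hB1 := add_one_ne_neg_nat hB
  have hB0 : B ≠ 0 := by simpa using hB 0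
  have s1 := (summable_kummerCoeff (A + 1) hB x).hasSum.mul_left B
  have s2 := (summable_kummerCoeff A hB x).hasSum.mul_left B
  have s3 := (summable_kummerCoeff (A + 1) hB1 x).hasSum.mul_left x
  rw [← kummerM_eq] at s1 s2 s3
  refine (s1.sub s2).unique ?_
  rw [← hasSum_nat_add_iff' 1]
  simp only [Finset.range_one, Finset.sum_singleton, kummerCoeff_zero, sub_self, sub_zero]
  refine HasSum.congr_fun s3 fun n => ?_
  have h2 := ascPochhammer_eval_ne_zero hB1 n
  have h4 : (n + 1 : ℂ) ≠ 0 := by exact_mod_cast n.succ_ne_zero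
  have h5 : (n.factorial : ℂ) ≠ 0 := by exact_mod_cast n.factorial_ne_zero
  unfold kummerCoeff
  rw [ascPochhammer_eval_succ' (A + 1), ascPochhammer_eval_succ_left B,
    ascPochhammer_eval_succ_left A, Nat.factorial_succ]
  push_cast
  field_simp
  ring

/-- Raising b by one is differentiation: L(a, b+1-a) = L(a, b-a) + L(a+1, b-a), and the last term is
minus the x-derivative of L(a, b-a). The contiguous relations say that `kummerUFormula` obeys the
same rule. The base case is the strip 0 < Re b < 2. -/
theorem lapInt_eq_kummerUFormula_of_lt (l : ℕ) {a b : ℂ} (ha : 0 < a.re) (hb0 : l < b.re)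
    (hb2 : b.re < l + 2) (hb : ∀ n : ℤ, b ≠ n) {x : ℝ} (hx : 0 < x) :
    lapInt a (b - a) x = Complex.Gamma a * kummerUFormula a b x := by
  induction l generalizing b x with
  | zero =>
    simp at hb0 hb2
    exact lapInt_eq_kummerUFormula_of_lt_two ha hb0 hb2 (by simpa using hb 1) hx
  | succ l ih =>
    obtain ⟨b, rfl⟩ : ∃ b', b = b' + 1 := ⟨b - 1, by ring⟩
    simp only [Complex.add_re, Complex.one_re, Nat.cast_add, Nat.cast_one] at hb0 hb2
    have hbZ : ∀ n : ℤ, b ≠ n := fun n h => hb (n + 1) (by rw [h]; push_cast; ring)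
    have hbn : ∀ m : ℕ, b ≠ -m := fun m => by simpa using hbZ (-m)
    have hBn : ∀ m : ℕ, 1 - b ≠ -m := fun m h =>
      hbZ (1 + m) (by push_cast; linear_combination -h)
    have hBn1 := add_one_ne_neg_nat hBn
    have hb0' : b ≠ 0 := by simpa using hbZ 0
    have hb1 : b - 1 ≠ 0 := sub_ne_zero.2 (by simpa using hbZ 1)
    have hxc : (x : ℂ) ≠ 0 := by exact_mod_cast hx.ne'
    have ga : Complex.Gamma a ≠ 0 := Complex.Gamma_ne_zero_of_re_pos ha
    have d1 := hasDerivAt_lapInt ha (b - a) hx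
    -- The induction hypothesis holds at all nearby points, so it may be differentiated in x. This
    -- is why x is generalized.
    have d2 : HasDerivAt (fun x : ℝ => Complex.Gamma a * kummerUFormula a b x)
        (-lapInt (a + 1) (b - a) x) x := by
      refine d1.congr_of_eventuallyEq ?_
      filter_upwards [Ioi_mem_nhds hx] with y hy
      exact (ih (by linarith) (by linarith) hbZ hy).symm
    have d3 : HasDerivAt (fun x : ℝ => Complex.Gamma a * kummerUFormula a b x)
        (Complex.Gamma a * (Complex.Gamma (1 - b) / Complex.Gamma (a - b + 1) *
          (a / b * kummerM (a + 1) (b + 1) x) +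
          (Complex.Gamma (b - 1) / Complex.Gamma a) *
          ((1 - b) * (x : ℂ) ^ (1 - b - 1) * kummerM (a - b + 1) (1 - b + 1) x +
          (x : ℂ) ^ (1 - b) * ((a - b + 1) / (1 - b + 1) *
            kummerM (a - b + 1 + 1) (1 - b + 1 + 1) x)))) x := by
      have e1 := ((hasDerivAt_kummerM a hbn x).comp_ofReal).const_mul
        (Complex.Gamma (1 - b) / Complex.Gamma (a - b + 1))
      have e2 := ((hasDerivAt_ofReal_cpow_const_pos (1 - b) hx).mul
        (hasDerivAt_kummerM (a - b + 1) hBn1 x).comp_ofReal).const_mul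
        (Complex.Gamma (b - 1) / Complex.Gamma a)
      refine ((e1.add e2).const_mul (Complex.Gamma a)).congr_of_eventuallyEq
        (Eventually.of_forall fun y => ?_)
      simp only [kummerUFormula, Pi.add_apply, Pi.mul_apply, show 2 - b = 1 - b + 1 by ring]
      ring
    have hd := d2.unique d3
    have hc1 := kummerM_contiguous (a - b + 1) hBn x
    have hc2 := kummerM_contiguous_left a hbn x
    have hc3 := kummerM_contiguous_right (a - b) hBn x
    have e0 : (x : ℂ) ^ (1 - b) = (x : ℂ) ^ (-b) * x := by
      rw [← cpow_add_one' _ hxc, neg_add_eq_sub]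
    have g1 : Complex.Gamma (1 - b) = -b * Complex.Gamma (-b) := by
      rw [← Complex.Gamma_add_one _ (neg_ne_zero.2 hb0')]; congr 1; ring
    have g2 : Complex.Gamma b = (b - 1) * Complex.Gamma (b - 1) := by
      rw [← Complex.Gamma_add_one _ hb1, sub_add_cancel]
    have g3 : (Complex.Gamma (a - b))⁻¹ = (a - b) * (Complex.Gamma (a - b + 1))⁻¹ := by
      have := Complex.one_div_Gamma_eq_self_mul_one_div_Gamma_add_one (a - b)
      simpa only [one_div] using this
    rw [show b + 1 - a = (b - a) + 1 by ring, lapInt_add_one_right ha _ hx,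
      ih (by linarith) (by linarith) hbZ hx, neg_eq_iff_eq_neg.1 hd]
    unfold kummerUFormula
    rw [show 1 - (b + 1) = -b by ring, show a - (b + 1) + 1 = a - b by ring,
      show b + 1 - 1 = b by ring, show 2 - (b + 1) = 1 - b by ring,
      show 2 - b = 1 - b + 1 by ring, g2, g1, e0, show 1 - b - 1 = -b by ring, div_eq_mul_inv _
      (Complex.Gamma (a - b)), g3, div_eq_mul_inv _ (Complex.Gamma (a - b + 1))]
    have hbb : a / b = a * b⁻¹ := div_eq_mul_inv _ _
    have hb' : b * b⁻¹ = 1 := mul_inv_cancel₀ hb0'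
    have hga : Complex.Gamma a * (Complex.Gamma a)⁻¹ = 1 := mul_inv_cancel₀ ga
    rw [hbb, div_eq_mul_inv _ (Complex.Gamma a), div_eq_mul_inv _ (Complex.Gamma a)]
    set G := (Complex.Gamma (a - b + 1))⁻¹
    linear_combination (Complex.Gamma a * Complex.Gamma (-b) * G) * hc2
      + (Complex.Gamma a * Complex.Gamma (-b) * G * a * kummerM (a + 1) (b + 1) x) * hb'
      + (-Complex.Gamma a * (Complex.Gamma a)⁻¹ * Complex.Gamma (b - 1) * (x : ℂ) ^ (-b)) * hc1
      - (Complex.Gamma a * (Complex.Gamma a)⁻¹ * Complex.Gamma (b - 1) * (x : ℂ) ^ (-b)) * hc3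

theorem lapInt_eq_kummerUFormula {a b : ℂ} (ha : 0 < a.re) (hb0 : 0 < b.re)
    (hb : ∀ n : ℤ, b ≠ n) {x : ℝ} (hx : 0 < x) :
    lapInt a (b - a) x = Complex.Gamma a * kummerUFormula a b x := by
  have h1 : 0 < ⌈b.re⌉₊ := Nat.ceil_pos.2 hb0
  have h2 := Nat.ceil_lt_add_one hb0.le
  have h3 := Nat.le_ceil b.re
  have h4 : ((⌈b.re⌉₊ - 1 : ℕ) : ℝ) = ⌈b.re⌉₊ - 1 := by rw [Nat.cast_sub h1]; simp
  -- With l = ⌈Re b⌉ - 1 one has l < Re b ≤ l + 1.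
  exact lapInt_eq_kummerUFormula_of_lt (⌈b.re⌉₊ - 1) ha (by rw [h4]; linarith)
    (by rw [h4]; linarith) hb hx

end MaassPoincare

namespace MaassPoincare

open Set MeasureTheory
open scoped FourierTransform

/-! ### The Fourier transform of `z^{-α} z̄^{-β}` -/

/-- The function `x ↦ z^{-α} z̄^{-β}`, `z = x + iy`. -/
def gKer (α β : ℂ) (y x : ℝ) : ℂ :=
  ((x : ℂ) + y * Complex.I) ^ (-α) * ((x : ℂ) - y * Complex.I) ^ (-β)

theorem add_mul_I_ne_zero {y : ℝ} (hy : y ≠ 0) (x : ℝ) : (x : ℂ) + y * Complex.I ≠ 0 := by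
  intro h; apply hy; simpa using congrArg Complex.im h

theorem sub_mul_I_ne_zero {y : ℝ} (hy : y ≠ 0) (x : ℝ) : (x : ℂ) - y * Complex.I ≠ 0 := by
  intro h; apply hy; simpa using congrArg Complex.im h

theorem norm_add_mul_I (x y : ℝ) : ‖(x : ℂ) + y * Complex.I‖ = (x ^ 2 + y ^ 2) ^ (1 / 2 : ℝ) := by
  rw [Complex.norm_add_mul_I, Real.sqrt_eq_rpow]

theorem norm_sub_mul_I (x y : ℝ) : ‖(x : ℂ) - y * Complex.I‖ = (x ^ 2 + y ^ 2) ^ (1 / 2 : ℝ) := by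
  have := norm_add_mul_I x (-y)
  rw [neg_sq] at this
  rw [← this]; push_cast; ring_nf

theorem norm_cpow_neg_le {z : ℂ} (hz : z ≠ 0) (α : ℂ) :
    ‖z ^ (-α)‖ ≤ ‖z‖ ^ (-α.re) * Real.exp (Real.pi * |α.im|) := by
  rw [Complex.norm_cpow_of_ne_zero hz, div_eq_mul_inv, ← Real.exp_neg]
  simp only [Complex.neg_re, Complex.neg_im, mul_neg, neg_neg]
  refine mul_le_mul_of_nonneg_left (Real.exp_le_exp.2 ?_) (by positivity)
  calc z.arg * α.im ≤ |z.arg * α.im| := le_abs_self _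
    _ = |z.arg| * |α.im| := abs_mul _ _
    _ ≤ _ := mul_le_mul_of_nonneg_right (Complex.abs_arg_le_pi z) (abs_nonneg _)

theorem norm_gKer_le (α β : ℂ) {y : ℝ} (hy : 0 < y) (x : ℝ) :
    ‖gKer α β y x‖ ≤
      Real.exp (Real.pi * (|α.im| + |β.im|)) * (x ^ 2 + y ^ 2) ^ (-(α + β).re / 2) := by
  have hpos : 0 < x ^ 2 + y ^ 2 := by positivity
  unfold gKer
  rw [norm_mul]
  have h1 := norm_cpow_neg_le (add_mul_I_ne_zero hy.ne' x) α
  have h2 := norm_cpow_neg_le (sub_mul_I_ne_zero hy.ne' x) β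
  rw [norm_add_mul_I, ← Real.rpow_mul hpos.le] at h1
  rw [norm_sub_mul_I, ← Real.rpow_mul hpos.le] at h2
  refine (mul_le_mul h1 h2 (norm_nonneg _) (by positivity)).trans_eq ?_
  rw [mul_add, Real.exp_add, show -(α + β).re / 2 = 1 / 2 * -α.re + 1 / 2 * -β.re by
    simp; ring, Real.rpow_add hpos]
  ring

/-- The right side does not depend on r ∈ [ρ, R], so one integrable function dominates `gKer` for a
whole range of exponents. -/
theorem rpow_sq_add_sq_le {y : ℝ} (hy : 0 < y) {ρ r R : ℝ} (hρ : ρ ≤ r) (hr : 0 ≤ r) (hR : r ≤ R)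
    (x : ℝ) :
    (x ^ 2 + y ^ 2) ^ (-r / 2) ≤ (min 1 (y ^ 2)) ^ (-R / 2) * (1 + x ^ 2) ^ (-ρ / 2) := by
  set c := min 1 (y ^ 2)
  have hc : 0 < c := lt_min one_pos (by positivity)
  have hc1 : c ≤ 1 := min_le_left _ _
  have h1 : c * (1 + x ^ 2) ≤ x ^ 2 + y ^ 2 := by
    have := min_le_right 1 (y ^ 2)
    nlinarith [sq_nonneg x]
  calc (x ^ 2 + y ^ 2) ^ (-r / 2) ≤ (c * (1 + x ^ 2)) ^ (-r / 2) :=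
        Real.rpow_le_rpow_of_nonpos (by positivity) h1 (by linarith)
    _ = c ^ (-r / 2) * (1 + x ^ 2) ^ (-r / 2) := Real.mul_rpow hc.le (by positivity)
    _ ≤ _ := by
      gcongr ?_ * ?_
      · exact Real.rpow_le_rpow_of_exponent_ge hc hc1 (by linarith)
      · exact Real.rpow_le_rpow_of_exponent_le (by nlinarith [sq_nonneg x]) (by linarith)

theorem integrable_japanese {ρ : ℝ} (hρ : 1 < ρ) :
    Integrable fun x : ℝ => (1 + x ^ 2) ^ (-ρ / 2) := by
  have := integrable_rpow_neg_one_add_norm_sq (E := ℝ) (μ := volume) (r := ρ) (by simpa using hρ)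
  simpa using this

theorem continuous_gKer (α β : ℂ) {y : ℝ} (hy : 0 < y) : Continuous (gKer α β y) := by
  unfold gKer
  refine Continuous.mul ?_ ?_
  · exact Continuous.cpow (by fun_prop) continuous_const fun x => Or.inr (by simp [hy.ne'])
  · exact Continuous.cpow (by fun_prop) continuous_const fun x => Or.inr (by simp [hy.ne'])

theorem integrable_gKer {α β : ℂ} (h : 1 < (α + β).re) {y : ℝ} (hy : 0 < y) :
    Integrable (gKer α β y) := by
  refine ((integrable_japanese h).const_mul (Real.exp (Real.pi * (|α.im| + |β.im|)) *
    (min 1 (y ^ 2)) ^ (-(α + β).re / 2))).mono' (continuous_gKer α β hy).aestronglyMeasurable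
    (Eventually.of_forall fun x => ?_)
  rw [mul_assoc]
  refine (norm_gKer_le α β hy x).trans ?_
  gcongr
  exact rpow_sq_add_sq_le hy le_rfl (by linarith) le_rfl x

theorem fourier_eq_integral (f : ℝ → ℂ) (n : ℝ) :
    𝓕 f n = ∫ x : ℝ, Complex.exp (-2 * Real.pi * n * x * Complex.I) * f x := by
  rw [Real.fourier_real_eq_integral_exp_smul]
  congr 1
  funext x
  rw [smul_eq_mul]
  congr 2
  push_cast
  ring

theorem norm_exp_mul_I' (n x : ℝ) : ‖Complex.exp (-2 * Real.pi * n * x * Complex.I)‖ = 1 := by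
  rw [show (-2 * Real.pi * n * x * Complex.I : ℂ) = ((-2 * Real.pi * n * x : ℝ) : ℂ) * Complex.I by
    push_cast; ring]
  exact Complex.norm_exp_ofReal_mul_I _

/-- Joint continuity in the exponents. -/
theorem continuousAt_fourier_gKer {α β : ℂ} (h : 1 < (α + β).re) {y : ℝ} (hy : 0 < y) (n : ℝ) :
    ContinuousAt (fun p : ℂ × ℂ => 𝓕 (gKer p.1 p.2 y) n) (α, β) := by
  simp_rw [fourier_eq_integral]
  -- A decay exponent halfway between 1 and Re(α+β) is still integrable and is exceeded by all
  -- nearby exponents.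
  set ρ := (1 + (α + β).re) / 2 with hρ
  set R := (α + β).re + 1 with hR
  set K := Real.exp (Real.pi * ((|α.im| + 1) + (|β.im| + 1))) with hK
  refine tendsto_integral_filter_of_dominated_convergence
    (fun x => K * ((min 1 (y ^ 2)) ^ (-R / 2) * (1 + x ^ 2) ^ (-ρ / 2))) ?_ ?_ ?_ ?_
  · refine Eventually.of_forall fun p => ?_
    exact ((by fun_prop : Continuous fun x : ℝ =>
      Complex.exp (-2 * Real.pi * n * x * Complex.I)).mul
        (continuous_gKer _ _ hy)).aestronglyMeasurable
  · have c1 : ∀ᶠ p : ℂ × ℂ in 𝓝 (α, β), ρ < (p.1 + p.2).re ∧ (p.1 + p.2).re < R := by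
      have : ContinuousAt (fun p : ℂ × ℂ => (p.1 + p.2).re) (α, β) := by fun_prop
      exact (this.eventually (lt_mem_nhds (by rw [hρ]; linarith))).and
        (this.eventually (gt_mem_nhds (by rw [hR]; linarith)))
    have c2 : ∀ᶠ p : ℂ × ℂ in 𝓝 (α, β), |p.1.im| < |α.im| + 1 := by
      have : ContinuousAt (fun p : ℂ × ℂ => |p.1.im|) (α, β) := by fun_prop
      exact this.eventually (gt_mem_nhds (by simp))
    have c3 : ∀ᶠ p : ℂ × ℂ in 𝓝 (α, β), |p.2.im| < |β.im| + 1 := by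
      have : ContinuousAt (fun p : ℂ × ℂ => |p.2.im|) (α, β) := by fun_prop
      exact this.eventually (gt_mem_nhds (by simp))
    filter_upwards [c1, c2, c3] with p h1 h2 h3
    refine Eventually.of_forall fun x => ?_
    rw [norm_mul, norm_exp_mul_I', one_mul]
    refine (norm_gKer_le _ _ hy x).trans ?_
    have := Real.pi_pos
    gcongr ?_ * ?_
    · rw [hK]; gcongr
    · exact rpow_sq_add_sq_le hy h1.1.le (by linarith [h1.1]) h1.2.le x
  · exact ((integrable_japanese (by linarith)).const_mul _).const_mul _
  · refine Eventually.of_forall fun x => ?_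
    refine Tendsto.const_mul _ ?_
    have hz := add_mul_I_ne_zero hy.ne' x
    have hz' := sub_mul_I_ne_zero hy.ne' x
    have : ContinuousAt (fun p : ℂ × ℂ => gKer p.1 p.2 y x) (α, β) := by
      unfold gKer
      refine ContinuousAt.mul ?_ ?_
      · exact (ContinuousAt.const_cpow (by fun_prop) (Or.inl hz))
      · exact (ContinuousAt.const_cpow (by fun_prop) (Or.inl hz'))
    exact this

theorem differentiable_integral_mul_cexp {h L : ℝ → ℂ} (hh : Integrable h) (hL : Measurable L)
    {M : ℝ} (hM : ∀ x, ‖L x‖ ≤ M) :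
    Differentiable ℂ fun a => ∫ x, h x * Complex.exp (a * L x) := by
  intro a
  have hM0 : 0 ≤ M := (norm_nonneg _).trans (hM 0)
  have hb : ∀ w : ℂ, ∀ x, ‖Complex.exp (w * L x)‖ ≤ Real.exp (‖w‖ * M) := fun w x => by
    refine (Complex.norm_exp_le_exp_norm _).trans ?_
    rw [norm_mul]
    gcongr
    exact hM x
  have hm : ∀ w : ℂ, AEStronglyMeasurable (fun x => Complex.exp (w * L x)) volume := fun w =>
    (Complex.measurable_exp.comp (hL.const_mul w)).aestronglyMeasurable
  refine (hasDerivAt_integral_of_dominated_loc_of_deriv_le (μ := volume)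
    (F := fun w x => h x * Complex.exp (w * L x))
    (F' := fun w x => h x * (Complex.exp (w * L x) * L x)) (x₀ := a) (s := Metric.ball a 1)
    (bound := fun x => ‖h x‖ * (Real.exp ((‖a‖ + 1) * M) * M))
    (Metric.ball_mem_nhds _ one_pos)
    (Eventually.of_forall fun w => hh.aestronglyMeasurable.mul (hm w)) ?_
    (hh.aestronglyMeasurable.mul ((hm a).mul hL.aestronglyMeasurable))
    (Eventually.of_forall fun x w hw => ?_) (hh.norm.mul_const _)
    (Eventually.of_forall fun x w hw => ?_)).2.differentiableAt
  · have := hh.bdd_mul (hm a) (Eventually.of_forall (hb a))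
    exact this.congr (Eventually.of_forall fun x => mul_comm _ _)
  · rw [norm_mul, norm_mul]
    have hw' : ‖w‖ ≤ ‖a‖ + 1 := by
      have := norm_le_norm_add_norm_sub' w a
      have h2 : ‖w - a‖ < 1 := by simpa [dist_eq_norm] using hw
      linarith
    have h3 : ‖Complex.exp (w * L x)‖ ≤ Real.exp ((‖a‖ + 1) * M) := (hb w x).trans (by gcongr)
    gcongr
    exact hM x
  · have : HasDerivAt (fun w : ℂ => w * L x) (L x) w := by
      simpa using (hasDerivAt_id w).mul_const (L x)
    exact this.cexp.const_mul _

/-- With b fixed, z^{-(b-a)} z̄^{-a} = z^{-b} exp(a (log z - log z̄)). The difference of logarithms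
is i times a difference of arguments, hence bounded, so the integral is entire in a. -/
theorem differentiable_fourier_gKer {b : ℂ} (hb : 1 < b.re) {y : ℝ} (hy : 0 < y) (n : ℝ) :
    Differentiable ℂ fun a => 𝓕 (gKer (b - a) a y) n := by
  have key := differentiable_integral_mul_cexp
    (h := fun x : ℝ => Complex.exp (-2 * Real.pi * n * x * Complex.I) * gKer b 0 y x)
    (L := fun x : ℝ => Complex.log (x + y * Complex.I) - Complex.log (x - y * Complex.I))
    (M := 2 * Real.pi)
    ((integrable_gKer (by simpa using hb) hy).bdd_mul (c := 1) (by fun_prop)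
      (Eventually.of_forall fun x => (norm_exp_mul_I' n x).le))
    (by fun_prop) (fun x => by
      have hn : ‖(x : ℂ) + y * Complex.I‖ = ‖(x : ℂ) - y * Complex.I‖ := by
        rw [norm_add_mul_I, norm_sub_mul_I]
      have : Complex.log (x + y * Complex.I) - Complex.log (x - y * Complex.I) =
          ((Complex.arg (x + y * Complex.I) - Complex.arg (x - y * Complex.I) : ℝ) : ℂ) *
            Complex.I := by
        rw [Complex.log, Complex.log, hn]; push_cast; ring
      rw [this, norm_mul, Complex.norm_I, mul_one, Complex.norm_real, Real.norm_eq_abs]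
      exact (Complex.abs_arg_sub_arg_lt _ _).le)
  convert key using 2 with a
  rw [fourier_eq_integral]
  congr 1
  funext x
  have hz := add_mul_I_ne_zero hy.ne' x
  have hz' := sub_mul_I_ne_zero hy.ne' x
  rw [mul_assoc _ (gKer b 0 y x)]
  congr 1
  unfold gKer
  rw [Complex.cpow_def_of_ne_zero hz, Complex.cpow_def_of_ne_zero hz',
    Complex.cpow_def_of_ne_zero hz, neg_zero, Complex.cpow_zero, mul_one, ← Complex.exp_add,
    ← Complex.exp_add]
  congr 1
  ring

/-- The Gamma integral with a complex parameter in the right half plane. -/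
theorem integral_cpow_mul_cexp_neg_mul {a r : ℂ} (ha : 0 < a.re) (hr : 0 < r.re) :
    ∫ t in Ioi (0 : ℝ), (t : ℂ) ^ (a - 1) * Complex.exp (-(r * t)) = r ^ (-a) * Complex.Gamma a := by
  set U : Set ℂ := {r | 0 < r.re} with hU
  have hUo : IsOpen U := isOpen_lt continuous_const Complex.continuous_re
  have hUc : IsPreconnected U := (convex_halfSpace_re_gt 0).isPreconnected
  have hint : ∀ (c : ℂ) (w : ℂ), 0 < c.re → 0 < w.re →
      IntegrableOn (fun t : ℝ => (t : ℂ) ^ (c - 1) * Complex.exp (-(w * t))) (Ioi 0) := by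
    intro c w hc hw
    refine (integrableOn_exp_mul_rpow_mul_rpow hc 0 hw).mono' (by fun_prop)
      ((ae_restrict_mem measurableSet_Ioi).mono fun t ht => ?_)
    rw [norm_mul, Complex.norm_exp, Complex.norm_cpow_eq_rpow_re_of_pos ht]
    simp [mul_comm]
  have hd : DifferentiableOn ℂ
      (fun r : ℂ => ∫ t in Ioi (0 : ℝ), (t : ℂ) ^ (a - 1) * Complex.exp (-(r * t))) U := by
    intro w hw
    have hw' : 0 < w.re := hw
    refine DifferentiableAt.differentiableWithinAt ?_
    refine (hasDerivAt_integral_of_dominated_loc_of_deriv_le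
      (μ := volume.restrict (Ioi (0 : ℝ)))
      (F := fun r (t : ℝ) => (t : ℂ) ^ (a - 1) * Complex.exp (-(r * t)))
      (F' := fun r (t : ℝ) => (t : ℂ) ^ (a - 1) * (Complex.exp (-(r * t)) * (-t)))
      (x₀ := w) (s := {r | w.re / 2 < r.re})
      (bound := fun t => Real.exp (-(w.re / 2 * t)) * t ^ ((a.re + 1) - 1) * (1 + t) ^ (0 : ℝ))
      ((isOpen_lt continuous_const Complex.continuous_re).mem_nhds (by simp; linarith))
      (Eventually.of_forall fun w => by fun_prop) (hint a w ha hw') (by fun_prop)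
      ((ae_restrict_mem measurableSet_Ioi).mono fun t ht r hr => ?_)
      (integrableOn_exp_mul_rpow_mul_rpow (by linarith) 0 (by linarith))
      ((ae_restrict_mem measurableSet_Ioi).mono fun t ht r hr => ?_)).2.differentiableAt
    · have ht' : 0 < t := ht
      have hr' : w.re / 2 < r.re := hr
      rw [norm_mul, norm_mul, Complex.norm_exp, Complex.norm_cpow_eq_rpow_re_of_pos ht', norm_neg,
        Complex.norm_real, Real.norm_of_nonneg ht'.le, Real.rpow_zero, mul_one,
        show a.re + 1 - 1 = (a - 1).re + 1 by simp, Real.rpow_add_one ht'.ne']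
      have : Real.exp (-(r * t)).re ≤ Real.exp (-(w.re / 2 * t)) := by
        simp; gcongr
      calc _ ≤ t ^ (a - 1).re * (Real.exp (-(w.re / 2 * t)) * t) := by gcongr
        _ = _ := by ring
    · have : HasDerivAt (fun r : ℂ => -(r * t)) (-t) r := by
        have h := ((hasDerivAt_id r).mul_const (t : ℂ)).neg
        rw [one_mul] at h
        exact h
      exact this.cexp.const_mul _
  have hd2 : DifferentiableOn ℂ (fun r : ℂ => r ^ (-a) * Complex.Gamma a) U := by
    intro w hw
    refine DifferentiableAt.differentiableWithinAt ?_
    exact (differentiableAt_id.cpow_const (Or.inl hw)).mul_const _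
  have h1 : (1 : ℂ) ∈ U := by simp [hU]
  -- For real positive r the formula is the classical Gamma integral. Such r accumulate at 1, and
  -- the identity theorem extends it to the half plane.
  refine AnalyticOnNhd.eqOn_of_preconnected_of_frequently_eq (hd.analyticOnNhd hUo)
    (hd2.analyticOnNhd hUo) hUc h1 ?_ hr
  have ht : Tendsto (fun x : ℝ => (x : ℂ)) (𝓝[≠] 1) (𝓝[≠] 1) := by
    refine tendsto_nhdsWithin_iff.2 ⟨?_, ?_⟩
    · exact (Complex.continuous_ofReal.tendsto' 1 1 (by simp)).mono_left nhdsWithin_le_nhds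
    · filter_upwards [self_mem_nhdsWithin] with x hx
      simpa using hx
  refine ht.frequently (Eventually.frequently ?_)
  filter_upwards [nhdsWithin_le_nhds (Ioi_mem_nhds (zero_lt_one' ℝ))] with x hx
  have hx' : 0 < x := hx
  rw [Complex.integral_cpow_mul_exp_neg_mul_Ioi ha hx', Complex.cpow_neg, one_div,
    Complex.inv_cpow]
  rw [Complex.arg_ofReal_of_nonneg hx'.le]; exact Real.pi_pos.ne

theorem ofReal_mul_cpow {r : ℝ} (hr : 0 < r) (w c : ℂ) :
    ((r : ℂ) * w) ^ c = (r : ℂ) ^ c * w ^ c := by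
  have hrc : (r : ℂ) ≠ 0 := by exact_mod_cast hr.ne'
  rcases eq_or_ne w 0 with rfl | hw
  · rcases eq_or_ne c 0 with rfl | hc
    · simp
    · simp [Complex.zero_cpow hc]
  · rw [Complex.cpow_def_of_ne_zero (mul_ne_zero hrc hw), Complex.cpow_def_of_ne_zero hrc,
      Complex.cpow_def_of_ne_zero hw, Complex.log_ofReal_mul hr hw, ← Complex.exp_add,
      Complex.ofReal_log hr.le]
    congr 1; ring

/-- Here x + iy = i (y - ix), and y - ix lies in the right half plane, so the arguments add without
crossing the cut. The phases e^{±πiα/2} produced here and in the conjugate version become i^{-k}. -/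
theorem cpow_add_mul_I {y : ℝ} (hy : 0 < y) (x : ℝ) (α : ℂ) :
    ((x : ℂ) + y * Complex.I) ^ α =
      Complex.exp (Real.pi * Complex.I / 2 * α) * ((y : ℂ) - x * Complex.I) ^ α := by
  have hw : ((y : ℂ) - x * Complex.I) ≠ 0 := fun h => hy.ne' (by simpa using congrArg Complex.re h)
  have hz := add_mul_I_ne_zero hy.ne' x
  have e : (x : ℂ) + y * Complex.I = Complex.I * ((y : ℂ) - x * Complex.I) := by
    linear_combination (x : ℂ) * Complex.I_mul_I
  have harg := Complex.abs_arg_lt_pi_div_two_iff.2 (Or.inl (by simpa using hy) :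
    0 < ((y : ℂ) - x * Complex.I).re ∨ (y : ℂ) - x * Complex.I = 0)
  rw [abs_lt] at harg
  rw [Complex.cpow_def_of_ne_zero hz, Complex.cpow_def_of_ne_zero hw, ← Complex.exp_add, e,
    (Complex.log_mul_eq_add_log_iff Complex.I_ne_zero hw).2, Complex.log_I]
  · congr 1; ring
  · rw [Complex.arg_I]
    constructor <;> linarith [harg.1, harg.2]

theorem cpow_sub_mul_I {y : ℝ} (hy : 0 < y) (x : ℝ) (α : ℂ) :
    ((x : ℂ) - y * Complex.I) ^ α =
      Complex.exp (-(Real.pi * Complex.I / 2) * α) * ((y : ℂ) + x * Complex.I) ^ α := by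
  have hw : ((y : ℂ) + x * Complex.I) ≠ 0 := fun h => hy.ne' (by simpa using congrArg Complex.re h)
  have hz := sub_mul_I_ne_zero hy.ne' x
  have e : (x : ℂ) - y * Complex.I = -Complex.I * ((y : ℂ) + x * Complex.I) := by
    linear_combination (x : ℂ) * Complex.I_mul_I
  have harg := Complex.abs_arg_lt_pi_div_two_iff.2 (Or.inl (by simpa using hy) :
    0 < ((y : ℂ) + x * Complex.I).re ∨ (y : ℂ) + x * Complex.I = 0)
  rw [abs_lt] at harg
  rw [Complex.cpow_def_of_ne_zero hz, Complex.cpow_def_of_ne_zero hw, ← Complex.exp_add, e,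
    (Complex.log_mul_eq_add_log_iff (neg_ne_zero.2 Complex.I_ne_zero) hw).2, Complex.log_neg_I]
  · congr 1; ring
  · rw [Complex.arg_neg_I]
    constructor <;> linarith [harg.1, harg.2]

/-- The Fourier transform of `z^{-α}` at positive frequencies. -/
theorem fourier_cpow_neg {α : ℂ} (hα : 1 < α.re) {y : ℝ} (hy : 0 < y) {ξ : ℝ} (hξ : 0 < ξ) :
    ∫ x : ℝ, Complex.exp (-2 * Real.pi * ξ * x * Complex.I) * gKer α 0 y x =
      Complex.exp (-(Real.pi * Complex.I / 2) * α) * (2 * Real.pi : ℂ) ^ α / Complex.Gamma α *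
        ((ξ : ℂ) ^ (α - 1) * Complex.exp (-(2 * Real.pi * y * ξ : ℝ))) := by
  have hα0 : 0 < α.re := by linarith
  have hΓ : Complex.Gamma α ≠ 0 := Complex.Gamma_ne_zero_of_re_pos hα0
  have h2π : (2 * Real.pi : ℂ) ≠ 0 := by
    have := Real.pi_ne_zero; simp [this]
  -- The Gamma integral shows that the inverse transform of this one-sided function is a constant
  -- times z^{-α}. Inversion at a point of continuity ξ > 0 then gives the claim, and Re α > 1
  -- provides integrability of the transform.
  set f : ℝ → ℂ := (Ioi 0).indicator
    fun ξ : ℝ => (ξ : ℂ) ^ (α - 1) * Complex.exp (-(2 * Real.pi * y * ξ : ℝ)) with hf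
  set D : ℂ := Complex.exp (Real.pi * Complex.I / 2 * α) * (2 * Real.pi : ℂ) ^ (-α) *
    Complex.Gamma α with hD
  have hinv : 𝓕⁻ f = fun x => D * gKer α 0 y x := by
    funext x
    rw [Real.fourierInv_eq']
    have : ∀ v : ℝ, Complex.exp (((2 * Real.pi * inner ℝ v x : ℝ) : ℂ) * Complex.I) • f v =
        (Ioi 0).indicator (fun ξ : ℝ => (ξ : ℂ) ^ (α - 1) *
          Complex.exp (-(((2 * Real.pi : ℝ) * ((y : ℂ) - x * Complex.I)) * ξ))) v := by
      intro v
      by_cases hv : v ∈ Ioi (0 : ℝ)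
      · rw [hf, indicator_of_mem hv, indicator_of_mem hv, smul_eq_mul, mul_left_comm,
          ← Complex.exp_add, RCLike.inner_apply]
        congr 2
        simp only [conj_trivial]
        push_cast
        ring
      · rw [hf, indicator_of_notMem hv, indicator_of_notMem hv, smul_zero]
    rw [integral_congr_ae (Eventually.of_forall this), integral_indicator measurableSet_Ioi,
      integral_cpow_mul_cexp_neg_mul hα0 (by simp; positivity),
      ofReal_mul_cpow (by positivity), hD, gKer, neg_zero, Complex.cpow_zero, mul_one,
      cpow_add_mul_I hy]
    have : Complex.exp (Real.pi * Complex.I / 2 * α) *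
        Complex.exp (Real.pi * Complex.I / 2 * -α) = 1 := by
      rw [← Complex.exp_add, mul_neg, add_neg_cancel, Complex.exp_zero]
    push_cast
    linear_combination (-(2 * Real.pi : ℂ) ^ (-α) * Complex.Gamma α *
      ((y : ℂ) - x * Complex.I) ^ (-α)) * this
  have hfi : Integrable f := by
    rw [hf, integrable_indicator_iff measurableSet_Ioi]
    refine (integrableOn_exp_mul_rpow_mul_rpow hα0 0 (x := 2 * Real.pi * y) (by positivity)).mono'
      (by fun_prop) ((ae_restrict_mem measurableSet_Ioi).mono fun t ht => ?_)
    rw [norm_mul, Complex.norm_exp, Complex.norm_cpow_eq_rpow_re_of_pos ht]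
    simp [mul_comm]
  have hG : Integrable (gKer α 0 y) := integrable_gKer (by simpa using hα) hy
  have hFi : Integrable (𝓕 f) := by
    have : 𝓕 f = fun x => D * gKer α 0 y (-x) := by
      funext x
      have := congrFun hinv (-x)
      rwa [Real.fourierInv_eq_fourier_neg, neg_neg] at this
    rw [this]
    exact hG.comp_neg.const_mul D
  have hcont : ContinuousAt f ξ := by
    have h1 : ContinuousAt (fun ξ : ℝ => (ξ : ℂ) ^ (α - 1) *
        Complex.exp (-(2 * Real.pi * y * ξ : ℝ))) ξ := by
      refine ContinuousAt.mul ?_ (by fun_prop)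
      exact Complex.continuousAt_ofReal_cpow_const _ _ (Or.inr hξ.ne')
    refine h1.congr ?_
    filter_upwards [Ioi_mem_nhds hξ] with v hv
    rw [hf, indicator_of_mem hv]
  have key := hfi.fourier_fourierInv_eq hFi hcont
  rw [hinv, fourier_eq_integral, hf, indicator_of_mem (mem_Ioi.2 hξ)] at key
  rw [← key]
  simp_rw [mul_left_comm _ D]
  rw [integral_const_mul, ← mul_assoc, hD]
  have e1 : Complex.exp (-(Real.pi * Complex.I / 2) * α) *
      Complex.exp (Real.pi * Complex.I / 2 * α) = 1 := by
    rw [← Complex.exp_add, neg_mul, neg_add_cancel, Complex.exp_zero]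
  have e2 : (2 * Real.pi : ℂ) ^ α * (2 * Real.pi : ℂ) ^ (-α) = 1 := by
    rw [← Complex.cpow_add _ _ h2π, add_neg_cancel, Complex.cpow_zero]
  have : Complex.exp (-(Real.pi * Complex.I / 2) * α) * (2 * Real.pi : ℂ) ^ α / Complex.Gamma α *
      (Complex.exp (Real.pi * Complex.I / 2 * α) * (2 * Real.pi : ℂ) ^ (-α) *
        Complex.Gamma α) = 1 := by
    rw [div_mul_eq_mul_div, div_eq_iff hΓ]
    linear_combination Complex.Gamma α * ((2 * Real.pi : ℂ) ^ α * (2 * Real.pi : ℂ) ^ (-α)) * e1 +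
      Complex.Gamma α * e2
  rw [this, one_mul]

/-- The Fourier transform of `z^{-α} z̄^{-β}` as a one-sided integral. -/
theorem fourier_gKer_eq_integral {α β : ℂ} (hα : 1 < α.re) (hβ : 0 < β.re) {y : ℝ} (hy : 0 < y)
    {n : ℝ} (hn : 0 ≤ n) :
    𝓕 (gKer α β y) n = Complex.exp (-(Real.pi * Complex.I / 2) * (α - β)) *
      (2 * Real.pi : ℂ) ^ (α + β) / (Complex.Gamma α * Complex.Gamma β) *
      ∫ t in Ioi (0 : ℝ), (t : ℂ) ^ (β - 1) * ((t + n : ℝ) : ℂ) ^ (α - 1) *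
        Complex.exp (-(2 * Real.pi * y * (2 * t + n) : ℝ)) := by
  have hΓβ : Complex.Gamma β ≠ 0 := Complex.Gamma_ne_zero_of_re_pos hβ
  have h2π : (2 * Real.pi : ℂ) ≠ 0 := by
    have := Real.pi_ne_zero; simp [this]
  set E : ℂ := Complex.exp (Real.pi * Complex.I / 2 * β) * (2 * Real.pi : ℂ) ^ β /
    Complex.Gamma β with hE
  -- The Gamma integral with parameter 2π(y + ix) writes z̄^{-β} as a superposition of exponentials
  -- e^{-2π(y+ix)t}.
  have hrep : ∀ x : ℝ, gKer α β y x = E * ∫ t in Ioi (0 : ℝ), gKer α 0 y x *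
      ((t : ℂ) ^ (β - 1) * Complex.exp (-(((2 * Real.pi : ℝ) * ((y : ℂ) + x * Complex.I)) * t))) := by
    intro x
    rw [integral_const_mul, integral_cpow_mul_cexp_neg_mul hβ (by simp; positivity),
      ofReal_mul_cpow (by positivity), hE, gKer, gKer, neg_zero, Complex.cpow_zero, mul_one,
      cpow_sub_mul_I hy]
    have e2 : (2 * Real.pi : ℂ) ^ β * (2 * Real.pi : ℂ) ^ (-β) = 1 := by
      rw [← Complex.cpow_add _ _ h2π, add_neg_cancel, Complex.cpow_zero]
    push_cast
    rw [neg_mul_neg]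
    generalize (2 * Real.pi : ℂ) ^ β = P at e2 ⊢
    generalize (2 * Real.pi : ℂ) ^ (-β) = Q at e2 ⊢
    field_simp
    linear_combination (-((x : ℂ) + y * Complex.I) ^ (-α) * ((y : ℂ) + x * Complex.I) ^ (-β)) * e2
  have hswap : Integrable (Function.uncurry fun (x t : ℝ) =>
      Complex.exp (-2 * Real.pi * n * x * Complex.I) * (gKer α 0 y x *
      ((t : ℂ) ^ (β - 1) * Complex.exp (-(((2 * Real.pi : ℝ) * ((y : ℂ) + x * Complex.I)) * t)))))
      (volume.prod (volume.restrict (Ioi (0 : ℝ)))) := by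
    have h1 := ((integrable_gKer (α := α) (β := 0) (by simpa using hα) hy).mul_prod
      (integrableOn_lapKer hβ 1 (x := 2 * Real.pi * y) (by positivity))).bdd_mul
      (f := fun p : ℝ × ℝ => Complex.exp (-2 * Real.pi * (n + p.2 : ℝ) * p.1 * Complex.I)) (c := 1)
      (by fun_prop) (Eventually.of_forall fun p => (norm_exp_mul_I' _ _).le)
    refine h1.congr (Eventually.of_forall fun p => ?_)
    simp only [Function.uncurry, lapKer, sub_self, Complex.cpow_zero, mul_one]
    have : Complex.exp (-2 * Real.pi * (n + p.2 : ℝ) * p.1 * Complex.I) *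
        Complex.exp (-(2 * Real.pi * y * p.2 : ℝ)) =
        Complex.exp (-2 * Real.pi * n * p.1 * Complex.I) *
        Complex.exp (-(((2 * Real.pi : ℝ) * ((y : ℂ) + p.1 * Complex.I)) * p.2)) := by
      rw [← Complex.exp_add, ← Complex.exp_add]
      congr 1
      push_cast
      ring
    linear_combination gKer α 0 y p.1 * (p.2 : ℂ) ^ (β - 1) * this
  rw [fourier_eq_integral]
  calc _ = E * ∫ x : ℝ, ∫ t in Ioi (0 : ℝ),
        Complex.exp (-2 * Real.pi * n * x * Complex.I) * (gKer α 0 y x *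
        ((t : ℂ) ^ (β - 1) *
          Complex.exp (-(((2 * Real.pi : ℝ) * ((y : ℂ) + x * Complex.I)) * t)))) := by
        rw [← integral_const_mul]
        congr 1
        funext x
        rw [hrep x, integral_const_mul (Complex.exp (-2 * Real.pi * n * x * Complex.I))]
        ring
    _ = E * ∫ t in Ioi (0 : ℝ), ∫ x : ℝ,
        Complex.exp (-2 * Real.pi * n * x * Complex.I) * (gKer α 0 y x *
        ((t : ℂ) ^ (β - 1) *
          Complex.exp (-(((2 * Real.pi : ℝ) * ((y : ℂ) + x * Complex.I)) * t)))) := by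
        rw [integral_integral_swap hswap]
    _ = E * ∫ t in Ioi (0 : ℝ), (Complex.exp (-(Real.pi * Complex.I / 2) * α) *
          (2 * Real.pi : ℂ) ^ α / Complex.Gamma α) *
          ((t : ℂ) ^ (β - 1) * ((t + n : ℝ) : ℂ) ^ (α - 1) *
        Complex.exp (-(2 * Real.pi * y * (2 * t + n) : ℝ))) := by
        congr 1
        refine setIntegral_congr_fun measurableSet_Ioi fun t ht => ?_
        have ht' : 0 < t := ht
        -- The factor e^{-2πixt} shifts the frequency from n to t + n, which is positive because n ≥
        -- 0.
        have hf := fourier_cpow_neg hα hy (by linarith : 0 < t + n)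
        have : ∀ x : ℝ, Complex.exp (-2 * Real.pi * n * x * Complex.I) * (gKer α 0 y x *
            ((t : ℂ) ^ (β - 1) *
              Complex.exp (-(((2 * Real.pi : ℝ) * ((y : ℂ) + x * Complex.I)) * t)))) =
            ((t : ℂ) ^ (β - 1) * Complex.exp (-(2 * Real.pi * y * t : ℝ))) *
            (Complex.exp (-2 * Real.pi * (t + n : ℝ) * x * Complex.I) * gKer α 0 y x) := by
          intro x
          have : Complex.exp (-(2 * Real.pi * y * t : ℝ)) *
              Complex.exp (-2 * Real.pi * (t + n : ℝ) * x * Complex.I) =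
              Complex.exp (-2 * Real.pi * n * x * Complex.I) *
              Complex.exp (-(((2 * Real.pi : ℝ) * ((y : ℂ) + x * Complex.I)) * t)) := by
            rw [← Complex.exp_add, ← Complex.exp_add]
            congr 1
            push_cast
            ring
          linear_combination (-gKer α 0 y x * (t : ℂ) ^ (β - 1)) * this
        simp_rw [this]
        rw [integral_const_mul, hf]
        have : Complex.exp (-(2 * Real.pi * y * t : ℝ)) *
            Complex.exp (-(2 * Real.pi * y * (t + n) : ℝ)) =
            Complex.exp (-(2 * Real.pi * y * (2 * t + n) : ℝ)) := by
          rw [← Complex.exp_add]; congr 1; push_cast; ring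
        rw [← this]
        ring
    _ = _ := by
        rw [integral_const_mul, ← mul_assoc, hE, mul_sub, sub_eq_add_neg (_ * α), Complex.exp_add,
          Complex.cpow_add _ _ h2π, show -(-(Real.pi * Complex.I / 2) * β) =
            Real.pi * Complex.I / 2 * β by ring]
        ring

end MaassPoincare

/-! ### The transform of z^{-α} z̄^{-β} for all exponents, by analytic continuation and continuity
-/

namespace MaassPoincare

open Set MeasureTheory
open scoped FourierTransform

theorem eq_of_differentiable_of_eqOn_strip {f g : ℂ → ℂ} (hf : Differentiable ℂ f)
    (hg : Differentiable ℂ g) {r : ℝ} (hr : 0 < r)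
    (h : ∀ a : ℂ, 0 < a.re → a.re < r → f a = g a) (a : ℂ) : f a = g a := by
  have hfa : AnalyticOnNhd ℂ f univ := fun z _ => hf.analyticAt z
  have hga : AnalyticOnNhd ℂ g univ := fun z _ => hg.analyticAt z
  refine congrFun (hfa.eq_of_eventuallyEq hga (z₀ := ((r / 2 : ℝ) : ℂ)) ?_) a
  have h1 : ∀ᶠ z : ℂ in 𝓝 ((r / 2 : ℝ) : ℂ), 0 < z.re :=
    Complex.continuous_re.continuousAt.eventually (lt_mem_nhds (by
      rw [Complex.ofReal_re]; linarith))
  have h2 : ∀ᶠ z : ℂ in 𝓝 ((r / 2 : ℝ) : ℂ), z.re < r :=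
    Complex.continuous_re.continuousAt.eventually (gt_mem_nhds (by
      rw [Complex.ofReal_re]; linarith))
  filter_upwards [h1, h2] with z hz1 hz2 using h z hz1 hz2

theorem two_pi_ne_zero' : (2 * Real.pi : ℂ) ≠ 0 := by
  have := Real.pi_ne_zero; simp [this]

theorem differentiable_one_div_Gamma_sub (b : ℂ) :
    Differentiable ℂ fun a => (Complex.Gamma (b - a))⁻¹ :=
  Complex.differentiable_one_div_Gamma.comp (differentiable_id.const_sub b)

/-- In the strip 0 < Re a < Re b - 1 the one-sided formula applies, and at frequency 0 its two
powers of t merge into a single Gamma integral. Both sides are entire in a. -/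
theorem fourier_gKer_zero {b : ℂ} (hb : 2 < b.re) {y : ℝ} (hy : 0 < y) (a : ℂ) :
    𝓕 (gKer (b - a) a y) 0 = Complex.exp (-(Real.pi * Complex.I / 2) * (b - a - a)) *
      (2 * Real.pi : ℂ) ^ b * Complex.Gamma (b - 1) * ((4 * Real.pi * y : ℝ) : ℂ) ^ (1 - b) *
      (Complex.Gamma (b - a))⁻¹ * (Complex.Gamma a)⁻¹ := by
  refine eq_of_differentiable_of_eqOn_strip (differentiable_fourier_gKer (by linarith) hy 0)
    (g := fun a => Complex.exp (-(Real.pi * Complex.I / 2) * (b - a - a)) *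
      (2 * Real.pi : ℂ) ^ b * Complex.Gamma (b - 1) * ((4 * Real.pi * y : ℝ) : ℂ) ^ (1 - b) *
      (Complex.Gamma (b - a))⁻¹ * (Complex.Gamma a)⁻¹) ?_ (r := b.re - 1) (by linarith) ?_ a
  · have h1 := differentiable_one_div_Gamma_sub b
    have h2 := Complex.differentiable_one_div_Gamma
    fun_prop
  · intro a ha0 ha1
    have hα : 1 < (b - a).re := by simp; linarith
    have hr : 0 < 4 * Real.pi * y := by have := Real.pi_pos; positivity
    rw [fourier_gKer_eq_integral hα ha0 hy le_rfl, sub_add_cancel]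
    have : ∫ t in Ioi (0 : ℝ), (t : ℂ) ^ (a - 1) * ((t + 0 : ℝ) : ℂ) ^ (b - a - 1) *
        Complex.exp (-(2 * Real.pi * y * (2 * t + 0) : ℝ)) =
        ((4 * Real.pi * y : ℝ) : ℂ) ^ (-(b - 1)) * Complex.Gamma (b - 1) := by
      rw [← integral_cpow_mul_cexp_neg_mul (by simp; linarith) (by simpa using hr)]
      refine setIntegral_congr_fun measurableSet_Ioi fun t ht => ?_
      have htc : (t : ℂ) ≠ 0 := by exact_mod_cast (ne_of_gt ht)
      rw [add_zero, ← Complex.cpow_add _ _ htc]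
      congr 2
      · ring
      · push_cast; ring
    rw [this, neg_sub]
    field_simp

/-- The substitution t ↦ nt. -/
theorem scaled_integral_eq_lapInt {α β : ℂ} {y n : ℝ} (hn : 0 < n) :
    ∫ t in Ioi (0 : ℝ), (t : ℂ) ^ (β - 1) * ((t + n : ℝ) : ℂ) ^ (α - 1) *
        Complex.exp (-(2 * Real.pi * y * (2 * t + n) : ℝ)) =
      (n : ℂ) ^ (α + β - 1) * Complex.exp (-(2 * Real.pi * n * y : ℝ)) *
        lapInt β α (4 * Real.pi * n * y) := by
  have hnc : (n : ℂ) ≠ 0 := by exact_mod_cast hn.ne'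
  have := integral_comp_mul_left_Ioi (fun t : ℝ => (t : ℂ) ^ (β - 1) *
    ((t + n : ℝ) : ℂ) ^ (α - 1) * Complex.exp (-(2 * Real.pi * y * (2 * t + n) : ℝ))) 0 hn
  rw [mul_zero] at this
  rw [show (∫ t in Ioi (0 : ℝ), (t : ℂ) ^ (β - 1) * ((t + n : ℝ) : ℂ) ^ (α - 1) *
        Complex.exp (-(2 * Real.pi * y * (2 * t + n) : ℝ))) = (n : ℂ) * (n⁻¹ •
        ∫ t in Ioi (0 : ℝ), (t : ℂ) ^ (β - 1) * ((t + n : ℝ) : ℂ) ^ (α - 1) *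
        Complex.exp (-(2 * Real.pi * y * (2 * t + n) : ℝ))) by
      rw [Complex.real_smul, Complex.ofReal_inv, mul_inv_cancel_left₀ hnc], ← this, lapInt,
    ← integral_const_mul, ← integral_const_mul]
  refine setIntegral_congr_fun measurableSet_Ioi fun t ht => ?_
  have ht' : 0 < t := ht
  simp only [lapKer]
  have e1 : ((n * t : ℝ) : ℂ) ^ (β - 1) = (n : ℂ) ^ (β - 1) * (t : ℂ) ^ (β - 1) := by
    rw [Complex.ofReal_mul, ofReal_mul_cpow hn]
  have e2 : ((n * t + n : ℝ) : ℂ) ^ (α - 1) = (n : ℂ) ^ (α - 1) * ((1 + t : ℝ) : ℂ) ^ (α - 1) := by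
    rw [show n * t + n = n * (1 + t) by ring, Complex.ofReal_mul, ofReal_mul_cpow hn]
  have e3 : (n : ℂ) ^ (α + β - 1) = n * ((n : ℂ) ^ (β - 1) * (n : ℂ) ^ (α - 1)) := by
    rw [show α + β - 1 = (β - 1) + (α - 1) + 1 by ring, cpow_add_one' _ hnc,
      Complex.cpow_add _ _ hnc]; ring
  have e4 : Complex.exp (-(2 * Real.pi * y * (2 * (n * t) + n) : ℝ)) =
      Complex.exp (-(2 * Real.pi * n * y : ℝ)) * Complex.exp (-(4 * Real.pi * n * y * t : ℝ)) := by
    rw [← Complex.exp_add]; congr 1; push_cast; ring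
  rw [e1, e2, e3, e4]
  ring

theorem differentiable_mul_kummerUFormula {b : ℂ} (hb : ∀ n : ℤ, b ≠ n) {x : ℂ} :
    Differentiable ℂ fun a => kummerUFormula a b x := by
  have hbn : ∀ m : ℕ, b ≠ -m := fun m => by simpa using hb (-m)
  have hBn : ∀ m : ℕ, 2 - b ≠ -m := fun m h => hb (2 + m) (by push_cast; linear_combination -h)
  have h1 := differentiable_kummerM_left hbn x
  have h2 : Differentiable ℂ fun a => kummerM (a - b + 1) (2 - b) x :=
    (differentiable_kummerM_left hBn x).comp (by fun_prop)
  have h3 := Complex.differentiable_one_div_Gamma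
  have h4 : Differentiable ℂ fun a => (Complex.Gamma (a - b + 1))⁻¹ :=
    h3.comp (by fun_prop)
  unfold kummerUFormula
  simp only [div_eq_mul_inv]
  fun_prop

theorem fourier_gKer_eq_kummerUFormula {b : ℂ} (hb2 : 2 < b.re) (hb : ∀ n : ℤ, b ≠ n) {y n : ℝ}
    (hy : 0 < y) (hn : 0 < n) (a : ℂ) :
    𝓕 (gKer (b - a) a y) n = Complex.exp (-(Real.pi * Complex.I / 2) * (b - a - a)) *
      (2 * Real.pi : ℂ) ^ b * (n : ℂ) ^ (b - 1) * Complex.exp (-(2 * Real.pi * n * y : ℝ)) *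
      (Complex.Gamma (b - a))⁻¹ * kummerUFormula a b ((4 * Real.pi * n * y : ℝ) : ℂ) := by
  have hx : 0 < 4 * Real.pi * n * y := by have := Real.pi_pos; positivity
  refine eq_of_differentiable_of_eqOn_strip (differentiable_fourier_gKer (by linarith) hy n)
    (g := fun a => Complex.exp (-(Real.pi * Complex.I / 2) * (b - a - a)) *
      (2 * Real.pi : ℂ) ^ b * (n : ℂ) ^ (b - 1) * Complex.exp (-(2 * Real.pi * n * y : ℝ)) *
      (Complex.Gamma (b - a))⁻¹ * kummerUFormula a b ((4 * Real.pi * n * y : ℝ) : ℂ))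
    ?_ (r := b.re - 1) (by linarith) ?_ a
  · have h1 := differentiable_one_div_Gamma_sub b
    have h2 := differentiable_mul_kummerUFormula hb (x := ((4 * Real.pi * n * y : ℝ) : ℂ))
    fun_prop
  · intro a ha0 ha1
    have hα : 1 < (b - a).re := by simp; linarith
    have hΓ := Complex.Gamma_ne_zero_of_re_pos ha0
    rw [fourier_gKer_eq_integral hα ha0 hy hn.le, scaled_integral_eq_lapInt hn,
      lapInt_eq_kummerUFormula ha0 (by linarith) hb hx, sub_add_cancel]
    field_simp

/-- The integers other than b form a closed set avoiding b. Hence the limit defining `kummerU` only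
sees parameters where the connection formula is proved. -/
theorem eventually_ne_intCast (b : ℂ) : ∀ᶠ w : ℂ in 𝓝[≠] b, ∀ n : ℤ, w ≠ n := by
  have hc : IsClosed ((fun n : ℤ => (n : ℂ)) '' {n : ℤ | (n : ℂ) ≠ b}) :=
    Complex.isClosedEmbedding_intCast.isClosedMap _ (isClosed_discrete _)
  have : ((fun n : ℤ => (n : ℂ)) '' {n : ℤ | (n : ℂ) ≠ b})ᶜ ∈ 𝓝 b :=
    hc.isOpen_compl.mem_nhds (by simp)
  filter_upwards [nhdsWithin_le_nhds this, self_mem_nhdsWithin] with w hw hwb n hwn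
  exact hw ⟨n, fun h => hwb (hwn.trans h), hwn.symm⟩

theorem continuousAt_fourier_gKer_comp {u v : ℂ → ℂ} {w : ℂ} (hu : ContinuousAt u w)
    (hv : ContinuousAt v w) (h : 1 < (u w + v w).re) {y : ℝ} (hy : 0 < y) (n : ℝ) :
    ContinuousAt (fun w => 𝓕 (gKer (u w) (v w) y) n) w := by
  have hc := continuousAt_fourier_gKer h hy n
  obtain ⟨F, hF⟩ : ∃ F : ℂ → ℂ → ℂ, ∀ a b, 𝓕 (gKer a b y) n = F a b := ⟨_, fun _ _ => rfl⟩
  simp only [hF] at hc ⊢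
  exact hc.tendsto.comp (hu.prodMk_nhds hv)

/-- The exponent α = b - a is kept fixed while the other one moves, so that the sum of the exponents
passes through non-integral values. There the formula contains the factor 1/Γ(α) = 0, and continuity
gives the value at b. -/
theorem fourier_gKer_eq_zero {b : ℂ} (hb2 : 2 < b.re) {y n : ℝ} (hy : 0 < y) (hn : 0 < n) {a : ℂ}
    (h : Complex.Gamma (b - a) = 0) : 𝓕 (gKer (b - a) a y) n = 0 := by
  have ht : Tendsto (fun w : ℂ => 𝓕 (gKer (b - a) (w - (b - a)) y) n) (𝓝[≠] b)
      (𝓝 (𝓕 (gKer (b - a) a y) n)) := by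
    have h2 := (continuousAt_fourier_gKer_comp (u := fun _ => b - a) (v := fun w => w - (b - a))
      (w := b) (by fun_prop) (by fun_prop) (by simp; linarith) hy n).tendsto.mono_left
      (nhdsWithin_le_nhds (s := {b}ᶜ))
    rwa [sub_sub_cancel] at h2
  refine tendsto_nhds_unique ht (tendsto_const_nhds.congr' ?_)
  have h2 : ∀ᶠ w : ℂ in 𝓝[≠] b, 2 < w.re :=
    nhdsWithin_le_nhds (Complex.continuous_re.continuousAt.eventually (lt_mem_nhds hb2))
  filter_upwards [eventually_ne_intCast b, h2] with w hw hw2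
  have := fourier_gKer_eq_kummerUFormula hw2 hw hy hn (w - (b - a))
  rw [show w - (w - (b - a)) = b - a by ring, h] at this
  rw [this]
  simp

/-- The Fourier transform of `z^{-α} z̄^{-β}` at positive frequencies. -/
theorem fourier_gKer_of_pos {b : ℂ} (hb2 : 2 < b.re) {y n : ℝ} (hy : 0 < y) (hn : 0 < n) (a : ℂ) :
    𝓕 (gKer (b - a) a y) n = Complex.exp (-(Real.pi * Complex.I / 2) * (b - a - a)) *
      (2 * Real.pi : ℂ) ^ b * (n : ℂ) ^ (b - 1) * Complex.exp (-(2 * Real.pi * n * y : ℝ)) *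
      (Complex.Gamma (b - a))⁻¹ * kummerU a b ((4 * Real.pi * n * y : ℝ) : ℂ) := by
  -- Where 1/Γ(b-a) vanishes, the transform does not determine U, but both sides are 0.
  by_cases hΓ : Complex.Gamma (b - a) = 0
  · rw [fourier_gKer_eq_zero hb2 hy hn hΓ, hΓ]; simp
  have hnc : (n : ℂ) ≠ 0 := by exact_mod_cast hn.ne'
  set P : ℂ → ℂ := fun b => Complex.exp (-(Real.pi * Complex.I / 2) * (b - a - a)) *
      (2 * Real.pi : ℂ) ^ b * (n : ℂ) ^ (b - 1) * Complex.exp (-(2 * Real.pi * n * y : ℝ)) with hP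
  have hP0 : ∀ b, P b ≠ 0 := by
    intro b
    simp [hP, Complex.exp_ne_zero, Complex.cpow_eq_zero_iff, hnc, Real.pi_ne_zero]
  have hPc : ContinuousAt P b := by
    refine ContinuousAt.mul (ContinuousAt.mul (ContinuousAt.mul (by fun_prop) ?_) ?_) (by fun_prop)
    · exact ContinuousAt.const_cpow (by fun_prop) (Or.inl two_pi_ne_zero')
    · exact ContinuousAt.const_cpow (by fun_prop) (Or.inl hnc)
  have hGc : ContinuousAt (fun w : ℂ => (Complex.Gamma (w - a))⁻¹) b :=
    (Complex.differentiable_one_div_Gamma.continuous.comp (by fun_prop)).continuousAt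
  have hJc : ContinuousAt (fun w : ℂ => 𝓕 (gKer (w - a) a y) n) b :=
    continuousAt_fourier_gKer_comp (u := fun w => w - a) (v := fun _ => a) (by fun_prop)
      (by fun_prop) (by simp; linarith) hy n
  have hlim : Tendsto (fun w => 𝓕 (gKer (w - a) a y) n / (P w * (Complex.Gamma (w - a))⁻¹)) (𝓝[≠] b)
      (𝓝 (𝓕 (gKer (b - a) a y) n / (P b * (Complex.Gamma (b - a))⁻¹))) :=
    (hJc.div (hPc.mul hGc) (mul_ne_zero (hP0 b) (inv_ne_zero hΓ))).tendsto.mono_left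
      nhdsWithin_le_nhds
  -- Otherwise U is, near b, the transform divided by a continuous nonvanishing factor, so the limit
  -- defining it exists and is the quotient at b.
  have hU : kummerU a b ((4 * Real.pi * n * y : ℝ) : ℂ) =
      𝓕 (gKer (b - a) a y) n / (P b * (Complex.Gamma (b - a))⁻¹) := by
    refine Tendsto.limUnder_eq (hlim.congr' ?_)
    have h2 : ∀ᶠ w : ℂ in 𝓝[≠] b, 2 < w.re :=
      nhdsWithin_le_nhds (Complex.continuous_re.continuousAt.eventually (lt_mem_nhds hb2))
    have h3 : ∀ᶠ w : ℂ in 𝓝[≠] b, (Complex.Gamma (w - a))⁻¹ ≠ 0 :=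
      nhdsWithin_le_nhds (hGc.eventually_ne (inv_ne_zero hΓ))
    filter_upwards [eventually_ne_intCast b, h2, h3] with w hw hw2 hw3
    rw [fourier_gKer_eq_kummerUFormula hw2 hw hy hn a]
    exact mul_div_cancel_left₀ _ (mul_ne_zero (hP0 w) hw3)
  rw [hU]
  exact (mul_div_cancel₀ _ (mul_ne_zero (hP0 b) (inv_ne_zero hΓ))).symm

/-- The reflection x ↦ -x replaces z by -z̄, which interchanges the exponents. The phase is the
accumulated change of arguments. -/
theorem gKer_neg (α β : ℂ) {y : ℝ} (hy : 0 < y) (x : ℝ) :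
    gKer α β y (-x) = Complex.exp (-(Real.pi * Complex.I) * (α - β)) * gKer β α y x := by
  unfold gKer
  rw [cpow_add_mul_I hy, cpow_sub_mul_I hy, cpow_add_mul_I hy, cpow_sub_mul_I hy]
  have : Complex.exp (-(Real.pi * Complex.I) * (α - β)) *
      (Complex.exp (Real.pi * Complex.I / 2 * -β) * Complex.exp (-(Real.pi * Complex.I / 2) * -α)) =
      Complex.exp (Real.pi * Complex.I / 2 * -α) * Complex.exp (-(Real.pi * Complex.I / 2) * -β) := by
    rw [← Complex.exp_add, ← Complex.exp_add, ← Complex.exp_add]; congr 1; ring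
  push_cast
  rw [neg_mul, sub_neg_eq_add, ← sub_eq_add_neg]
  linear_combination (-((y : ℂ) + x * Complex.I) ^ (-α) * ((y : ℂ) - x * Complex.I) ^ (-β)) * this

/-- The Fourier transform of `z^{-α} z̄^{-β}` at negative frequencies. -/
theorem fourier_gKer_neg (α β : ℂ) {y : ℝ} (hy : 0 < y) (n : ℝ) :
    𝓕 (gKer α β y) (-n) =
      Complex.exp (-(Real.pi * Complex.I) * (α - β)) * 𝓕 (gKer β α y) n := by
  rw [fourier_eq_integral, fourier_eq_integral, ← integral_const_mul, ← integral_neg_eq_self]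
  congr 1
  funext x
  rw [gKer_neg _ _ hy]
  rw [show (-2 * Real.pi * ((-n : ℝ) : ℂ) * ((-x : ℝ) : ℂ) * Complex.I : ℂ) =
    -2 * Real.pi * n * x * Complex.I by push_cast; ring]
  ring

end MaassPoincare

namespace MaassPoincare

open MeasureTheory
open scoped FourierTransform

/-! ### The derivatives of `z^{-α} z̄^{-β}` and their generating series -/

/-- The Leibniz rule for the coefficients of a product of two generating series. -/
theorem sum_antidiagonal_succ_mul {R : Type*} [CommRing R] (a b : ℕ → R) (j : ℕ) :
    (j + 1 : R) * ∑ p ∈ Finset.HasAntidiagonal.antidiagonal (j + 1), a p.1 * b p.2 =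
      ∑ p ∈ Finset.HasAntidiagonal.antidiagonal j, ((p.1 + 1 : R) * a (p.1 + 1) * b p.2 +
        a p.1 * ((p.2 + 1 : R) * b (p.2 + 1))) := by
  have h1 := Finset.Nat.sum_antidiagonal_succ (n := j) (f := fun p => (p.1 : R) * a p.1 * b p.2)
  have h2 := Finset.Nat.sum_antidiagonal_succ' (n := j) (f := fun p => a p.1 * ((p.2 : R) * b p.2))
  simp only [Nat.cast_zero, zero_mul, mul_zero, zero_add, Nat.cast_add,
    Nat.cast_one] at h1 h2
  rw [Finset.sum_add_distrib, ← h1, ← h2, ← Finset.sum_add_distrib, Finset.mul_sum]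
  refine Finset.sum_congr rfl fun p hp => ?_
  have : ((p.1 + p.2 : ℕ) : R) = ((j + 1 : ℕ) : R) := by rw [Finset.HasAntidiagonal.mem_antidiagonal.1 hp]
  push_cast at this
  rw [← this]
  ring

/-- Compares coefficients in (1-X)^{-A} (1-X)^{-B} = (1-X)^{-A-B}. The induction uses the
first-order recursion of the coefficients together with the Leibniz rule above. -/
theorem vandermonde_ascPochhammer {K : Type*} [Field K] [CharZero K] (A B : K) (j : ℕ) :
    ∑ p ∈ Finset.HasAntidiagonal.antidiagonal j, (ascPochhammer K p.1).eval A / p.1.factorial *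
      ((ascPochhammer K p.2).eval B / p.2.factorial) =
      (ascPochhammer K j).eval (A + B) / j.factorial := by
  have hs : ∀ (C : K) (n : ℕ), (n + 1 : K) * ((ascPochhammer K (n + 1)).eval C /
      (n + 1).factorial) = (C + n) * ((ascPochhammer K n).eval C / n.factorial) := by
    intro C n
    have h1 : (n + 1 : K) ≠ 0 := by exact_mod_cast n.succ_ne_zero
    have h2 : (n.factorial : K) ≠ 0 := by exact_mod_cast n.factorial_ne_zero
    rw [ascPochhammer_succ_eval, Nat.factorial_succ]
    push_cast
    field_simp
  induction j with
  | zero => simp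
  | succ j ih =>
    have h1 : (j + 1 : K) ≠ 0 := by exact_mod_cast j.succ_ne_zero
    apply mul_left_cancel₀ h1
    rw [sum_antidiagonal_succ_mul (fun p => (ascPochhammer K p).eval A / p.factorial)
      (fun p => (ascPochhammer K p).eval B / p.factorial), hs, ← ih, Finset.mul_sum]
    refine Finset.sum_congr rfl fun p hp => ?_
    have : ((p.1 + p.2 : ℕ) : K) = (j : K) := by rw [Finset.HasAntidiagonal.mem_antidiagonal.1 hp]
    push_cast at this
    rw [hs, hs, ← this]
    ring

/-- The Taylor coefficients `(-1)^p (α)_p / p! w^{-α-p}` of `w ↦ w^{-α}`. -/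
def powCoeff (α w : ℂ) (p : ℕ) : ℂ :=
  (ascPochhammer ℂ p).eval α / p.factorial * ((-1) ^ p * w ^ (-α - p))

/-- The `j`-th derivative of `x ↦ z^{-α} z̄^{-β}`, divided by `j!`. -/
def gDer (α β : ℂ) (y : ℝ) (j : ℕ) (x : ℝ) : ℂ :=
  ∑ p ∈ Finset.HasAntidiagonal.antidiagonal j, powCoeff α (x + y * Complex.I) p.1 *
    powCoeff β (x - y * Complex.I) p.2

theorem gDer_zero (α β : ℂ) (y : ℝ) : gDer α β y 0 = gKer α β y := by
  funext x; simp [gDer, powCoeff, gKer]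

theorem powCoeff_succ (α w : ℂ) (p : ℕ) :
    (p + 1 : ℂ) * powCoeff α w (p + 1) = (ascPochhammer ℂ p).eval α / p.factorial *
      ((-1) ^ p * ((-α - p) * w ^ (-α - p - 1))) := by
  have h1 : (p + 1 : ℂ) ≠ 0 := by exact_mod_cast p.succ_ne_zero
  have h2 : (p.factorial : ℂ) ≠ 0 := by exact_mod_cast p.factorial_ne_zero
  unfold powCoeff
  rw [ascPochhammer_eval_succ', Nat.factorial_succ, pow_succ]
  push_cast
  rw [sub_add_eq_sub_sub]
  field_simp
  ring

theorem hasDerivAt_powCoeff (α : ℂ) (p : ℕ) {d : ℂ} {x : ℝ} (h : (x : ℂ) + d ∈ Complex.slitPlane) :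
    HasDerivAt (fun x : ℝ => powCoeff α (x + d) p) ((p + 1 : ℂ) * powCoeff α (x + d) (p + 1)) x := by
  rw [powCoeff_succ]
  unfold powCoeff
  refine HasDerivAt.const_mul _ (HasDerivAt.const_mul _ ?_)
  have := ((hasDerivAt_id (x : ℂ)).add_const d).cpow_const (c := -α - p) h
  simpa using this.comp_ofReal

theorem hasDerivAt_gDer (α β : ℂ) {y : ℝ} (hy : 0 < y) (j : ℕ) (x : ℝ) :
    HasDerivAt (gDer α β y j) ((j + 1 : ℂ) * gDer α β y (j + 1) x) x := by
  have h1 : (x : ℂ) + y * Complex.I ∈ Complex.slitPlane := Or.inr (by simp [hy.ne'])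
  have h2 : (x : ℂ) + -(y * Complex.I) ∈ Complex.slitPlane := Or.inr (by simp [hy.ne'])
  unfold gDer
  rw [sum_antidiagonal_succ_mul (powCoeff α (x + y * Complex.I))
    (powCoeff β (x - y * Complex.I))]
  refine HasDerivAt.fun_sum fun p _ => ?_
  have d1 := hasDerivAt_powCoeff α p.1 h1
  have d2 := hasDerivAt_powCoeff β p.2 h2
  simp only [← sub_eq_add_neg] at d2
  exact d1.mul d2

theorem norm_powCoeff_le {α : ℂ} {A : ℝ} (hA : ‖α‖ ≤ A) {w : ℂ} {y : ℝ} (hy : 0 < y)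
    (hw : y ≤ ‖w‖) (p : ℕ) :
    ‖powCoeff α w p‖ ≤ (ascPochhammer ℝ p).eval A / p.factorial * (‖w‖ ^ (-α.re) *
      Real.exp (Real.pi * |α.im|) * (y⁻¹) ^ p) := by
  have hw0 : 0 < ‖w‖ := hy.trans_le hw
  have hw' : w ≠ 0 := norm_pos_iff.1 hw0
  unfold powCoeff
  rw [norm_mul, norm_div, norm_mul, norm_pow, norm_neg, norm_one, one_pow, one_mul,
    Complex.norm_natCast, Complex.cpow_sub _ _ hw', norm_div, Complex.cpow_natCast, norm_pow,
    div_eq_mul_inv _ (‖w‖ ^ p), ← inv_pow]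
  have h1 := norm_ascPochhammer_eval_le hA p
  have h2 := norm_cpow_neg_le hw' α
  have h3 : 0 ≤ (ascPochhammer ℝ p).eval A := (norm_nonneg _).trans h1
  gcongr

/-- Each derivative costs at most a factor 1/y, because |z| ≥ y. Vandermonde's identity then adds up
the Leibniz terms exactly, leaving (2A)_j / j!. -/
theorem norm_gDer_le {α β : ℂ} {A : ℝ} (hα : ‖α‖ ≤ A) (hβ : ‖β‖ ≤ A) {y : ℝ} (hy : 0 < y) (j : ℕ)
    (x : ℝ) :
    ‖gDer α β y j x‖ ≤ (ascPochhammer ℝ j).eval (A + A) / j.factorial * (y⁻¹) ^ j *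
      (Real.exp (Real.pi * (|α.im| + |β.im|)) * (x ^ 2 + y ^ 2) ^ (-(α + β).re / 2)) := by
  have hpos : 0 < x ^ 2 + y ^ 2 := by positivity
  have hle : y ≤ (x ^ 2 + y ^ 2) ^ (1 / 2 : ℝ) := by
    rw [← Real.sqrt_eq_rpow]
    exact Real.le_sqrt_of_sq_le (by nlinarith [sq_nonneg x])
  have h1 := fun p => norm_powCoeff_le hα hy
    (by rw [norm_add_mul_I]; exact hle : y ≤ ‖(x : ℂ) + y * Complex.I‖) p
  have h2 := fun p => norm_powCoeff_le hβ hy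
    (by rw [norm_sub_mul_I]; exact hle : y ≤ ‖(x : ℂ) - y * Complex.I‖) p
  have hA0 : 0 ≤ A := (norm_nonneg _).trans hα
  rw [← vandermonde_ascPochhammer, Finset.sum_mul, Finset.sum_mul]
  refine (norm_sum_le _ _).trans (Finset.sum_le_sum fun p hp => ?_)
  rw [norm_mul]
  refine (mul_le_mul (h1 _) (h2 _) (norm_nonneg _) ((norm_nonneg _).trans (h1 _))).trans_eq ?_
  rw [norm_add_mul_I, norm_sub_mul_I, ← Real.rpow_mul hpos.le, ← Real.rpow_mul hpos.le,
    ← Finset.HasAntidiagonal.mem_antidiagonal.1 hp, pow_add, mul_add, Real.exp_add,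
    show -(α + β).re / 2 = 1 / 2 * -α.re + 1 / 2 * -β.re by simp; ring, Real.rpow_add hpos]
  ring

theorem continuous_gDer (α β : ℂ) {y : ℝ} (hy : 0 < y) (j : ℕ) : Continuous (gDer α β y j) :=
  continuous_iff_continuousAt.2 fun x => (hasDerivAt_gDer α β hy j x).continuousAt

theorem integrable_gDer {α β : ℂ} (h : 1 < (α + β).re) {y : ℝ} (hy : 0 < y) (j : ℕ) :
    Integrable (gDer α β y j) := by
  refine (((integrable_japanese h).const_mul ((min 1 (y ^ 2)) ^ (-(α + β).re / 2))).const_mul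
    ((ascPochhammer ℝ j).eval (max ‖α‖ ‖β‖ + max ‖α‖ ‖β‖) / j.factorial * (y⁻¹) ^ j *
      Real.exp (Real.pi * (|α.im| + |β.im|)))).mono'
    (continuous_gDer α β hy j).aestronglyMeasurable (Eventually.of_forall fun x => ?_)
  have hb := norm_gDer_le (le_max_left ‖α‖ ‖β‖) (le_max_right ‖α‖ ‖β‖) hy j x
  refine hb.trans ?_
  rw [← mul_assoc]
  have hP : 0 ≤ (ascPochhammer ℝ j).eval (max ‖α‖ ‖β‖ + max ‖α‖ ‖β‖) :=
    (norm_nonneg _).trans (norm_ascPochhammer_eval_le (a := 0) (by simp) j)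
  gcongr
  exact rpow_sq_add_sq_le hy le_rfl (by linarith) le_rfl x

theorem fourier_gDer_succ {α β : ℂ} (h : 1 < (α + β).re) {y : ℝ} (hy : 0 < y) (j : ℕ) (n : ℝ) :
    (j + 1 : ℂ) * 𝓕 (gDer α β y (j + 1)) n = 2 * Real.pi * Complex.I * n * 𝓕 (gDer α β y j) n := by
  have hd : deriv (gDer α β y j) = fun x => (j + 1 : ℂ) * gDer α β y (j + 1) x :=
    funext fun x => (hasDerivAt_gDer α β hy j x).deriv
  have h1 := congrFun (Real.fourier_deriv (integrable_gDer h hy j)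
    (fun x => (hasDerivAt_gDer α β hy j x).differentiableAt)
    (by rw [hd]; exact (integrable_gDer h hy (j + 1)).const_mul _)) n
  rw [hd, smul_eq_mul] at h1
  rw [← h1, fourier_eq_integral, fourier_eq_integral, ← integral_const_mul]
  congr 1
  funext x
  ring

theorem fourier_gDer {α β : ℂ} (h : 1 < (α + β).re) {y : ℝ} (hy : 0 < y) (j : ℕ) (n : ℝ) :
    𝓕 (gDer α β y j) n = (2 * Real.pi * Complex.I * n) ^ j / j.factorial * 𝓕 (gKer α β y) n := by
  induction j with
  | zero => simp [gDer_zero]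
  | succ j ih =>
    have h1 : (j + 1 : ℂ) ≠ 0 := by exact_mod_cast j.succ_ne_zero
    have h2 : (j.factorial : ℂ) ≠ 0 := by exact_mod_cast j.factorial_ne_zero
    apply mul_left_cancel₀ h1
    rw [fourier_gDer_succ h hy, ih, Nat.factorial_succ]
    push_cast
    field_simp
    ring

theorem norm_fourier_le_integral (f : ℝ → ℂ) (n : ℝ) : ‖𝓕 f n‖ ≤ ∫ x, ‖f x‖ := by
  rw [fourier_eq_integral]
  refine (norm_integral_le_integral_norm _).trans_eq ?_
  simp_rw [norm_mul, norm_exp_mul_I', one_mul]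

/-- The constant in the bound for the `j`-th derivative. -/
def gBound (α β : ℂ) (y : ℝ) (j : ℕ) : ℝ :=
  (ascPochhammer ℝ j).eval (max ‖α‖ ‖β‖ + 1 + (max ‖α‖ ‖β‖ + 1)) / j.factorial * (y⁻¹) ^ j *
    Real.exp (Real.pi * (|α.im| + |β.im|))

/-- The shifts by 1 in `gBound` keep the Pochhammer argument positive even for α = β = 0. -/
theorem gBound_pos (α β : ℂ) {y : ℝ} (hy : 0 < y) (j : ℕ) : 0 < gBound α β y j := by
  have := ascPochhammer_pos j (max ‖α‖ ‖β‖ + 1 + (max ‖α‖ ‖β‖ + 1)) (by positivity)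
  unfold gBound
  positivity

theorem norm_gDer_le_gBound (α β : ℂ) {y : ℝ} (hy : 0 < y) (j : ℕ) (x : ℝ) :
    ‖gDer α β y j x‖ ≤ gBound α β y j * (x ^ 2 + y ^ 2) ^ (-(α + β).re / 2) := by
  unfold gBound
  rw [mul_assoc]
  exact norm_gDer_le ((le_max_left _ _).trans (by linarith))
    ((le_max_right _ _).trans (by linarith)) hy j x

theorem integrable_sq_add_sq {ρ : ℝ} (hρ : 1 < ρ) {y : ℝ} (hy : 0 < y) :
    Integrable fun x : ℝ => (x ^ 2 + y ^ 2) ^ (-ρ / 2) := by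
  have hc : Continuous fun x : ℝ => (x ^ 2 + y ^ 2) ^ (-ρ / 2) :=
    Continuous.rpow_const (by fun_prop) fun x => Or.inl (by positivity)
  refine ((integrable_japanese hρ).const_mul ((min 1 (y ^ 2)) ^ (-ρ / 2))).mono'
    hc.aestronglyMeasurable (Eventually.of_forall fun x => ?_)
  rw [Real.norm_of_nonneg (by positivity)]
  exact rpow_sq_add_sq_le hy le_rfl (by linarith) le_rfl x

theorem norm_integral_gDer_le {α β : ℂ} (h : 1 < (α + β).re) {y : ℝ} (hy : 0 < y) (j : ℕ) :
    ∫ x, ‖gDer α β y j x‖ ≤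
      gBound α β y j * ∫ x : ℝ, (x ^ 2 + y ^ 2) ^ (-(α + β).re / 2) := by
  rw [← integral_const_mul]
  exact integral_mono (integrable_gDer h hy j).norm ((integrable_sq_add_sq h hy).const_mul _)
    (norm_gDer_le_gBound α β hy j)

/-- Multiplication of the transform of the j-th term by (2πi n)² gives (j+1)(j+2) times the
transform of the (j+2)-nd. This summability yields the decay n^{-2}. -/
theorem summable_gBound_add_two (α β : ℂ) {b : ℂ} (hb : ∀ m : ℕ, b ≠ -m) {y : ℝ} (hy : 0 < y)
    {T : ℝ} (hT : 0 < T) :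
    Summable fun j : ℕ => T ^ j / ‖(ascPochhammer ℂ j).eval b‖ *
      ((j + 1) * (j + 2) * gBound α β y (j + 2)) := by
  set A := max ‖α‖ ‖β‖ + 1 + (max ‖α‖ ‖β‖ + 1) with hA
  have hA0 : 0 < A := by positivity
  have := (summable_kummer_majorant (A := A + 1 + 1) (r := T * y⁻¹) (by positivity) hb
    (by positivity)).mul_left (A * (A + 1) * (y⁻¹) ^ 2 * Real.exp (Real.pi * (|α.im| + |β.im|)))
  refine this.congr fun j => ?_
  have e1 : (ascPochhammer ℝ (j + 2)).eval A = A * ((A + 1) * (ascPochhammer ℝ j).eval (A + 1 + 1)) := by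
    rw [ascPochhammer_succ_left, ascPochhammer_succ_left]; simp
  have e2 : ((j + 2).factorial : ℝ) = (j + 2) * ((j + 1) * j.factorial) := by
    rw [Nat.factorial_succ, Nat.factorial_succ]; push_cast; ring
  have h5 : (j.factorial : ℝ) ≠ 0 := by exact_mod_cast j.factorial_ne_zero
  have h6 : (j + 1 : ℝ) ≠ 0 := by positivity
  have h7 : (j + 2 : ℝ) ≠ 0 := by positivity
  have h8 := norm_ne_zero_iff.2 (ascPochhammer_eval_ne_zero hb j)
  rw [gBound, ← hA, e1, e2, mul_pow, pow_add]
  field_simp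

theorem summable_gBound (α β : ℂ) {b : ℂ} (hb : ∀ m : ℕ, b ≠ -m) {y : ℝ} (hy : 0 < y)
    {T : ℝ} (hT : 0 < T) :
    Summable fun j : ℕ => T ^ j / ‖(ascPochhammer ℂ j).eval b‖ * gBound α β y j := by
  set A := max ‖α‖ ‖β‖ + 1 + (max ‖α‖ ‖β‖ + 1) with hA
  have hA0 : 0 < A := by positivity
  have := (summable_kummer_majorant (A := A) (r := T * y⁻¹) (by positivity) hb
    (by positivity)).mul_left (Real.exp (Real.pi * (|α.im| + |β.im|)))
  refine this.congr fun j => ?_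
  rw [gBound, ← hA, mul_pow]
  ring

/-- The series `∑ⱼ t^j / (α+β)_j · (∂^j/j!) z^{-α} z̄^{-β}`. -/
def hSer (α β t : ℂ) (y x : ℝ) : ℂ :=
  ∑' j : ℕ, t ^ j / (ascPochhammer ℂ j).eval (α + β) * gDer α β y j x

theorem norm_hSer_term_le (α β t : ℂ) {y : ℝ} (hy : 0 < y) (j : ℕ) (x : ℝ) :
    ‖t ^ j / (ascPochhammer ℂ j).eval (α + β) * gDer α β y j x‖ ≤
      (‖t‖ + 1) ^ j / ‖(ascPochhammer ℂ j).eval (α + β)‖ * gBound α β y j *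
        (x ^ 2 + y ^ 2) ^ (-(α + β).re / 2) := by
  rw [norm_mul, norm_div, norm_pow, mul_assoc]
  gcongr
  · simp
  · exact norm_gDer_le_gBound α β hy j x

theorem continuous_hSer {α β : ℂ} (h : 0 < (α + β).re) (t : ℂ) {y : ℝ} (hy : 0 < y) :
    Continuous (hSer α β t y) := by
  refine continuous_tsum (fun j => (continuous_gDer α β hy j).const_mul _)
    ((summable_gBound α β (ne_neg_nat_of_re_pos h) hy (T := ‖t‖ + 1) (by positivity)).mul_right
      ((y ^ 2) ^ (-(α + β).re / 2))) fun j x => (norm_hSer_term_le α β t hy j x).trans ?_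
  have := (gBound_pos α β hy j).le
  gcongr ?_ * ?_
  exact Real.rpow_le_rpow_of_nonpos (by positivity) (by nlinarith [sq_nonneg x]) (by linarith)

/-- The bound for `hSer`, uniform for `‖t‖ ≤ T`. -/
theorem exists_norm_hSer_le {α β : ℂ} (h : 0 < (α + β).re) {y : ℝ} (hy : 0 < y) (T : ℝ) :
    ∃ C, 0 ≤ C ∧ ∀ t : ℂ, ‖t‖ ≤ T → ∀ x : ℝ,
      ‖hSer α β t y x‖ ≤ C * (x ^ 2 + y ^ 2) ^ (-(α + β).re / 2) := by
  have hs := summable_gBound α β (ne_neg_nat_of_re_pos h) hy (T := |T| + 1) (by positivity)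
  refine ⟨_, tsum_nonneg (L := .unconditional ℕ) (g := fun j : ℕ => (|T| + 1) ^ j /
    ‖(ascPochhammer ℂ j).eval (α + β)‖ * gBound α β y j) fun j => ?_, fun t ht x => ?_⟩
  · have := (gBound_pos α β hy j).le
    positivity
  · rw [← tsum_mul_right]
    refine tsum_of_norm_bounded (hs.mul_right _).hasSum fun j => ?_
    refine (norm_hSer_term_le α β t hy j x).trans ?_
    have := (gBound_pos α β hy j).le
    gcongr
    exact ht.trans (le_abs_self _)

/-- The L¹ norms of the terms are summable, which allows the series to be integrated term by term.
-/
theorem hasSum_fourier_hSer {α β : ℂ} (h : 1 < (α + β).re) (t : ℂ) {y : ℝ} (hy : 0 < y) (n : ℝ) :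
    HasSum (fun j : ℕ => t ^ j / (ascPochhammer ℂ j).eval (α + β) * 𝓕 (gDer α β y j) n)
      (𝓕 (hSer α β t y) n) := by
  have hb := ne_neg_nat_of_re_pos (by linarith : 0 < (α + β).re)
  have key := hasSum_integral_of_summable_integral_norm (μ := volume)
    (F := fun (j : ℕ) (x : ℝ) => Complex.exp (-2 * Real.pi * n * x * Complex.I) *
      (t ^ j / (ascPochhammer ℂ j).eval (α + β) * gDer α β y j x))
    (fun j => ((integrable_gDer h hy j).const_mul _).bdd_mul (c := 1) (by fun_prop)
      (Eventually.of_forall fun x => (norm_exp_mul_I' n x).le)) ?_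
  · rw [fourier_eq_integral]
    simp_rw [tsum_mul_left] at key
    refine key.congr_fun fun j => ?_
    rw [fourier_eq_integral, ← integral_const_mul]
    congr 1
    funext x
    ring
  · refine Summable.of_nonneg_of_le (fun j => integral_nonneg fun x => norm_nonneg _) (fun j => ?_)
      ((summable_gBound α β hb hy (T := ‖t‖ + 1) (by positivity)).mul_right
        (∫ x : ℝ, (x ^ 2 + y ^ 2) ^ (-(α + β).re / 2)))
    rw [← integral_const_mul]
    refine integral_mono ?_ ((integrable_sq_add_sq h hy).const_mul _) fun x => ?_
    · exact (((integrable_gDer h hy j).const_mul _).bdd_mul (c := 1) (by fun_prop)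
        (Eventually.of_forall fun x => (norm_exp_mul_I' n x).le)).norm
    · simp only []
      rw [norm_mul, norm_exp_mul_I', one_mul]
      exact norm_hSer_term_le α β t hy j x

/-- The Fourier transform of `hSer`. -/
theorem fourier_hSer {α β : ℂ} (h : 1 < (α + β).re) (t : ℂ) {y : ℝ} (hy : 0 < y) (n : ℝ) :
    𝓕 (hSer α β t y) n = 𝓕 (gKer α β y) n *
      ∑' j : ℕ, (2 * Real.pi * Complex.I * n * t) ^ j /
        ((ascPochhammer ℂ j).eval (α + β) * j.factorial) := by
  rw [← (hasSum_fourier_hSer h t hy n).tsum_eq, ← tsum_mul_left]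
  refine tsum_congr fun j => ?_
  rw [fourier_gDer h hy, mul_pow _ t]
  have h1 := ascPochhammer_eval_ne_zero (ne_neg_nat_of_re_pos (by linarith : 0 < (α + β).re)) j
  have h2 : (j.factorial : ℂ) ≠ 0 := by exact_mod_cast j.factorial_ne_zero
  field_simp

/-- Uniform decay of the Fourier transform of `hSer`. -/
theorem exists_norm_fourier_hSer_le {α β : ℂ} (h : 1 < (α + β).re) {y : ℝ} (hy : 0 < y) (T : ℝ) :
    ∃ C, 0 ≤ C ∧ ∀ t : ℂ, ‖t‖ ≤ T → ∀ n : ℝ, ‖𝓕 (hSer α β t y) n‖ * (1 + n ^ 2) ≤ C := by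
  have hb := ne_neg_nat_of_re_pos (by linarith : 0 < (α + β).re)
  set I0 := ∫ x : ℝ, (x ^ 2 + y ^ 2) ^ (-(α + β).re / 2) with hI0
  have hI0' : 0 ≤ I0 := integral_nonneg fun x => by positivity
  have s0 := (summable_gBound α β hb hy (T := |T| + 1) (by positivity)).mul_right I0
  have s2 := (summable_gBound_add_two α β hb hy (T := |T| + 1) (by positivity)).mul_right I0
  refine ⟨_, add_nonneg (tsum_nonneg (L := .unconditional ℕ) (g := fun j : ℕ => (|T| + 1) ^ j /
    ‖(ascPochhammer ℂ j).eval (α + β)‖ * gBound α β y j * I0) fun j => ?_)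
    (tsum_nonneg (L := .unconditional ℕ) (g := fun j : ℕ => (|T| + 1) ^ j / ‖(ascPochhammer ℂ j).eval (α + β)‖ *
      ((j + 1) * (j + 2) * gBound α β y (j + 2)) * I0) fun j => ?_), fun t ht n => ?_⟩
  · have := (gBound_pos α β hy j).le
    positivity
  · have := (gBound_pos α β hy (j + 2)).le
    positivity
  · have htT : ‖t‖ ≤ |T| + 1 := ht.trans ((le_abs_self T).trans (by linarith))
    have hF : ∀ j, ‖𝓕 (gDer α β y j) n‖ ≤ gBound α β y j * I0 := fun j =>
      (norm_fourier_le_integral _ n).trans (norm_integral_gDer_le h hy j)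
    have key := hasSum_fourier_hSer h t hy n
    have b0 : ‖𝓕 (hSer α β t y) n‖ ≤ ∑' j : ℕ, (|T| + 1) ^ j /
        ‖(ascPochhammer ℂ j).eval (α + β)‖ * gBound α β y j * I0 := by
      rw [← key.tsum_eq]
      refine tsum_of_norm_bounded s0.hasSum fun j => ?_
      rw [norm_mul, norm_div, norm_pow, mul_assoc _ _ I0]
      have := hF j
      gcongr
    -- Two factors 2πi n are two derivatives, so they shift the index j by two. The resulting bound
    -- does not depend on n, and depends on t only through T.
    have b2 : ‖(2 * Real.pi * Complex.I * n) ^ 2 * 𝓕 (hSer α β t y) n‖ ≤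
        ∑' j : ℕ, (|T| + 1) ^ j / ‖(ascPochhammer ℂ j).eval (α + β)‖ *
      ((j + 1) * (j + 2) * gBound α β y (j + 2)) * I0 := by
      rw [← (key.mul_left ((2 * Real.pi * Complex.I * n) ^ 2)).tsum_eq]
      refine tsum_of_norm_bounded s2.hasSum fun j => ?_
      have e : (2 * Real.pi * Complex.I * n) ^ 2 * (t ^ j / (ascPochhammer ℂ j).eval (α + β) *
          𝓕 (gDer α β y j) n) = t ^ j / (ascPochhammer ℂ j).eval (α + β) *
          ((j + 1) * (j + 2) * 𝓕 (gDer α β y (j + 2)) n) := by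
        have e1 := fourier_gDer_succ h hy j n
        have e2 := fourier_gDer_succ h hy (j + 1) n
        push_cast at e2
        linear_combination (-(2 * Real.pi * Complex.I * n) *
          (t ^ j / (ascPochhammer ℂ j).eval (α + β))) * e1 - (j + 1 : ℂ) *
          (t ^ j / (ascPochhammer ℂ j).eval (α + β)) * e2
      have hj : ‖(j + 1 : ℂ)‖ = j + 1 := by
        exact_mod_cast Complex.norm_natCast (j + 1)
      have hj2 : ‖(j + 2 : ℂ)‖ = j + 2 := by
        exact_mod_cast Complex.norm_natCast (j + 2)
      rw [e, norm_mul, norm_div, norm_pow, norm_mul, norm_mul, hj, hj2, mul_assoc _ _ I0,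
        mul_assoc _ _ I0]
      have := hF (j + 2)
      gcongr
    have e3 : ‖(2 * Real.pi * Complex.I * n) ^ 2 * 𝓕 (hSer α β t y) n‖ =
        (2 * Real.pi) ^ 2 * n ^ 2 * ‖𝓕 (hSer α β t y) n‖ := by
      rw [norm_mul, norm_pow, norm_mul, norm_mul, norm_mul, Complex.norm_I, Complex.norm_real,
        Complex.norm_real, Real.norm_of_nonneg Real.pi_pos.le, Real.norm_eq_abs, mul_one, mul_pow,
        sq_abs]
      norm_num
    rw [e3] at b2
    have hpi : (1 : ℝ) ≤ (2 * Real.pi) ^ 2 := by nlinarith [Real.pi_gt_three]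
    have h5 : n ^ 2 * ‖𝓕 (hSer α β t y) n‖ ≤ (2 * Real.pi) ^ 2 * n ^ 2 * ‖𝓕 (hSer α β t y) n‖ := by
      rw [mul_assoc]
      exact le_mul_of_one_le_left (by positivity) hpi
    linarith

/-! ### The double series for `e^v M(A, A+B, u-v)` -/

/-- The part of degree j in the expansion of e^v M(A, A+B, u-v). Differentiation in u lowers j and
raises A by one, so by induction both sides have the same u-derivative. At u = v the left side is
v^j/j! and the right side is evaluated by Vandermonde's identity. -/
theorem exp_mul_kummer_coeff (j : ℕ) (A B u v : ℂ) (hb : ∀ m : ℕ, A + B ≠ -m) :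
    ∑ p ∈ Finset.HasAntidiagonal.antidiagonal j, kummerCoeff A (A + B) p.1 * (u - v) ^ p.1 *
      (v ^ p.2 / p.2.factorial) = (∑ p ∈ Finset.HasAntidiagonal.antidiagonal j,
        (ascPochhammer ℂ p.1).eval A / p.1.factorial * u ^ p.1 *
          ((ascPochhammer ℂ p.2).eval B / p.2.factorial * v ^ p.2)) /
        (ascPochhammer ℂ j).eval (A + B) := by
  induction j generalizing A u with
  | zero => simp [kummerCoeff]
  | succ j ih =>
    set L : ℂ → ℂ := fun u => ∑ p ∈ Finset.HasAntidiagonal.antidiagonal (j + 1),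
      kummerCoeff A (A + B) p.1 * (u - v) ^ p.1 * (v ^ p.2 / p.2.factorial) with hL
    set Q : ℂ → ℂ := fun u => (∑ p ∈ Finset.HasAntidiagonal.antidiagonal (j + 1),
        (ascPochhammer ℂ p.1).eval A / p.1.factorial * u ^ p.1 *
          ((ascPochhammer ℂ p.2).eval B / p.2.factorial * v ^ p.2)) /
        (ascPochhammer ℂ (j + 1)).eval (A + B) with hQ
    have hb1 : ∀ m : ℕ, A + 1 + B ≠ -m := by
      rw [add_right_comm]; exact add_one_ne_neg_nat hb
    have hb0 : A + B ≠ 0 := by simpa using hb 0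
    have dL : ∀ u, HasDerivAt L (A / (A + B) * ∑ p ∈ Finset.HasAntidiagonal.antidiagonal j,
        kummerCoeff (A + 1) (A + 1 + B) p.1 * (u - v) ^ p.1 * (v ^ p.2 / p.2.factorial)) u := by
      intro u
      have : HasDerivAt L (∑ p ∈ Finset.HasAntidiagonal.antidiagonal (j + 1), kummerCoeff A (A + B) p.1 *
          (p.1 * (u - v) ^ (p.1 - 1)) * (v ^ p.2 / p.2.factorial)) u := by
        refine HasDerivAt.fun_sum fun p _ => ((HasDerivAt.const_mul _ ?_).mul_const _)
        simpa using ((hasDerivAt_id u).sub_const v).fun_pow p.1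
      convert this using 1
      rw [Finset.Nat.sum_antidiagonal_succ, Finset.mul_sum]
      simp only [Nat.cast_zero, zero_mul, mul_zero, zero_add, Nat.add_sub_cancel]
      refine Finset.sum_congr rfl fun p _ => ?_
      have := kummerCoeff_succ' A hb p.1
      rw [add_right_comm] at this
      push_cast
      linear_combination (-(u - v) ^ p.1 * (v ^ p.2 / p.2.factorial)) * this
    have dQ : ∀ u, HasDerivAt Q (A / (A + B) * ((∑ p ∈ Finset.HasAntidiagonal.antidiagonal j,
        (ascPochhammer ℂ p.1).eval (A + 1) / p.1.factorial * u ^ p.1 *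
          ((ascPochhammer ℂ p.2).eval B / p.2.factorial * v ^ p.2)) /
        (ascPochhammer ℂ j).eval (A + 1 + B))) u := by
      intro u
      have : HasDerivAt Q ((∑ p ∈ Finset.HasAntidiagonal.antidiagonal (j + 1),
          (ascPochhammer ℂ p.1).eval A / p.1.factorial * (p.1 * u ^ (p.1 - 1)) *
          ((ascPochhammer ℂ p.2).eval B / p.2.factorial * v ^ p.2)) /
          (ascPochhammer ℂ (j + 1)).eval (A + B)) u := by
        refine HasDerivAt.div_const (HasDerivAt.fun_sum fun p _ =>
          ((HasDerivAt.const_mul _ ?_).mul_const _)) _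
        exact hasDerivAt_pow p.1 u
      convert this using 1
      have hA1 : (ascPochhammer ℂ (j + 1)).eval (A + B) =
          (A + B) * (ascPochhammer ℂ j).eval (A + 1 + B) := by
        rw [ascPochhammer_eval_succ_left, add_right_comm]
      rw [Finset.Nat.sum_antidiagonal_succ, hA1, div_mul_div_comm, Finset.mul_sum]
      simp only [Nat.cast_zero, zero_mul, mul_zero, zero_add, Nat.add_sub_cancel]
      congr 1
      refine Finset.sum_congr rfl fun p _ => ?_
      rw [ascPochhammer_eval_succ_left, Nat.factorial_succ]
      have h1 : (p.1 + 1 : ℂ) ≠ 0 := by exact_mod_cast p.1.succ_ne_zero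
      have h2 : (p.1.factorial : ℂ) ≠ 0 := by exact_mod_cast p.1.factorial_ne_zero
      push_cast
      field_simp
    have hd : ∀ u, L u = Q u := by
      intro u
      have hconst := is_const_of_deriv_eq_zero (f := fun u => L u - Q u)
        (fun u => ((dL u).fun_sub (dQ u)).differentiableAt)
        (fun u => by rw [((dL u).fun_sub (dQ u)).deriv, ih (A + 1) u hb1, sub_self]) u v
      have hv : L v = Q v := by
        have hP := ascPochhammer_eval_ne_zero hb (j + 1)
        have e1 : L v = v ^ (j + 1) / (j + 1).factorial := by
          simp only [hL, sub_self]
          rw [Finset.Nat.sum_antidiagonal_succ]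
          simp [kummerCoeff]
        have e2 : Q v = (ascPochhammer ℂ (j + 1)).eval (A + B) / (j + 1).factorial *
            v ^ (j + 1) / (ascPochhammer ℂ (j + 1)).eval (A + B) := by
          simp only [hQ]
          rw [← vandermonde_ascPochhammer, Finset.sum_mul]
          congr 1
          refine Finset.sum_congr rfl fun p hp => ?_
          rw [← Finset.HasAntidiagonal.mem_antidiagonal.1 hp, pow_add]
          ring
        rw [e1, e2]
        field_simp
      rw [hv, sub_self] at hconst
      exact sub_eq_zero.1 hconst
    exact hd u

/-- The right side is a Humbert series, symmetric under exchange of (A, u) with (B, v). This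
contains Kummer's transformation, and gives two closed forms of `hSer`. -/
theorem exp_mul_kummerM (A B u v : ℂ) (hb : ∀ m : ℕ, A + B ≠ -m) :
    Complex.exp v * kummerM A (A + B) (u - v) =
      ∑' j : ℕ, (∑ p ∈ Finset.HasAntidiagonal.antidiagonal j,
        (ascPochhammer ℂ p.1).eval A / p.1.factorial * u ^ p.1 *
          ((ascPochhammer ℂ p.2).eval B / p.2.factorial * v ^ p.2)) /
        (ascPochhammer ℂ j).eval (A + B) := by
  have hf : Summable fun n => ‖kummerCoeff A (A + B) n * (u - v) ^ n‖ := by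
    refine (summable_norm_kummerCoeff A hb (r := ‖u - v‖ + 1) (by positivity)).of_nonneg_of_le
      (fun _ => norm_nonneg _) fun n => ?_
    rw [norm_mul, norm_pow]
    gcongr
    simp
  have hg : Summable fun n : ℕ => ‖v ^ n / (n.factorial : ℂ)‖ := by
    simpa using Real.summable_pow_div_factorial ‖v‖
  have hexp : Complex.exp v = ∑' n : ℕ, v ^ n / (n.factorial : ℂ) := by
    rw [Complex.exp_eq_exp_ℂ, NormedSpace.exp_eq_tsum_div]
  rw [hexp, kummerM_eq, mul_comm, tsum_mul_tsum_eq_tsum_sum_antidiagonal_of_summable_norm hf hg]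
  exact tsum_congr fun j => exp_mul_kummer_coeff j A B u v hb

theorem pow_mul_powCoeff (α t : ℂ) {w : ℂ} (hw : w ≠ 0) (p : ℕ) :
    t ^ p * powCoeff α w p = w ^ (-α) *
      ((ascPochhammer ℂ p).eval α / p.factorial * (-t / w) ^ p) := by
  rw [powCoeff, Complex.cpow_sub _ _ hw, Complex.cpow_natCast, div_pow, neg_pow t]
  ring

theorem hSer_eq {α β : ℂ} (hb : ∀ m : ℕ, α + β ≠ -m) (t : ℂ) {y : ℝ} (hy : 0 < y) (x : ℝ) :
    hSer α β t y x = gKer α β y x * (Complex.exp (-t / (x - y * Complex.I)) *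
      kummerM α (α + β) (-t / (x + y * Complex.I) - -t / (x - y * Complex.I))) := by
  rw [exp_mul_kummerM _ _ _ _ hb, hSer, ← tsum_mul_left]
  refine tsum_congr fun j => ?_
  rw [gDer, ← mul_div_assoc, div_mul_eq_mul_div]
  congr 1
  rw [Finset.mul_sum, Finset.mul_sum]
  refine Finset.sum_congr rfl fun p hp => ?_
  have h1 := pow_mul_powCoeff α t (add_mul_I_ne_zero hy.ne' x) p.1
  have h2 := pow_mul_powCoeff β t (sub_mul_I_ne_zero hy.ne' x) p.2
  rw [← Finset.HasAntidiagonal.mem_antidiagonal.1 hp, pow_add, mul_mul_mul_comm, h1, h2, gKer]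
  ring

/-- The second reading of the symmetric double series. It is the form that matches φ for m > 0,
while `hSer_eq` matches m < 0. -/
theorem hSer_eq' {α β : ℂ} (hb : ∀ m : ℕ, α + β ≠ -m) (t : ℂ) {y : ℝ} (hy : 0 < y) (x : ℝ) :
    hSer α β t y x = gKer α β y x * (Complex.exp (-t / (x + y * Complex.I)) *
      kummerM β (α + β) (-t / (x - y * Complex.I) - -t / (x + y * Complex.I))) := by
  have hb' : ∀ m : ℕ, β + α ≠ -m := by rwa [add_comm]
  rw [add_comm α β, exp_mul_kummerM _ _ _ _ hb', hSer, ← tsum_mul_left]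
  refine tsum_congr fun j => ?_
  rw [gDer, ← mul_div_assoc, div_mul_eq_mul_div, add_comm β α]
  congr 1
  rw [Finset.mul_sum, Finset.mul_sum, ← Finset.Nat.sum_antidiagonal_swap]
  refine Finset.sum_congr rfl fun p hp => ?_
  have h1 := pow_mul_powCoeff α t (add_mul_I_ne_zero hy.ne' x) p.2
  have h2 := pow_mul_powCoeff β t (sub_mul_I_ne_zero hy.ne' x) p.1
  simp only [Prod.fst_swap, Prod.snd_swap]
  rw [← Finset.HasAntidiagonal.mem_antidiagonal.1 hp, add_comm p.1, pow_add, mul_mul_mul_comm, h1,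
    h2, gKer]
  ring

end MaassPoincare

namespace MaassPoincare

open UpperHalfPlane

/-! ### The terms of the Poincaré series -/

/-- The constant `Γ(2s)⁻¹ (4π|m|)^{s-k/2}` in `φ`, and `1` for `m = 0`. -/
def phiConst (m : ℤ) (k s : ℂ) : ℂ :=
  if m = 0 then 1
  else (Complex.Gamma (2 * s))⁻¹ * ((4 * Real.pi * |(m : ℝ)| : ℝ) : ℂ) ^ (s - k / 2)

theorem maassM_of_ne_zero {m : ℤ} (hm : m ≠ 0) (k s : ℂ) {y : ℝ} (hy : 0 < y) :
    maassM m k y s = phiConst m k s * (y : ℂ) ^ (s - k / 2) *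
      (Complex.exp (-((4 * Real.pi * |(m : ℝ)| * y : ℝ) : ℂ) / 2) *
        kummerM (s - k / 2 * (m.sign : ℂ)) (2 * s) ((4 * Real.pi * |(m : ℝ)| * y : ℝ) : ℂ)) := by
  have hm' : 0 < |(m : ℝ)| := abs_pos.2 (by exact_mod_cast hm)
  have hY : ((4 * Real.pi * |(m : ℝ)| * y : ℝ) : ℂ) ≠ 0 := by
    have : 0 < 4 * Real.pi * |(m : ℝ)| * y := by positivity
    exact_mod_cast this.ne'
  have h1 : ((4 * Real.pi * |(m : ℝ)| * y : ℝ) : ℂ) ^ (-k / 2) *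
      ((4 * Real.pi * |(m : ℝ)| * y : ℝ) : ℂ) ^ (s - 1 / 2 + 1 / 2) =
      ((4 * Real.pi * |(m : ℝ)| : ℝ) : ℂ) ^ (s - k / 2) * (y : ℂ) ^ (s - k / 2) := by
    rw [← Complex.cpow_add _ _ hY, ← Complex.mul_cpow_ofReal_nonneg (by positivity) hy.le,
      ← Complex.ofReal_mul]
    congr 1
    ring
  rw [maassM, phiConst, if_neg hm, if_neg hm, whittakerM,
    show s - 1 / 2 - k / 2 * (m.sign : ℂ) + 1 / 2 = s - k / 2 * (m.sign : ℂ) by ring,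
    show 1 + 2 * (s - 1 / 2) = 2 * s by ring]
  linear_combination ((Complex.Gamma (2 * s))⁻¹ *
    (Complex.exp (-((4 * Real.pi * |(m : ℝ)| * y : ℝ) : ℂ) / 2) *
        kummerM (s - k / 2 * (m.sign : ℂ)) (2 * s) ((4 * Real.pi * |(m : ℝ)| * y : ℝ) : ℂ))) * h1

theorem phi_zero_left (k s : ℂ) (z : ℍ) : phi 0 k s z = (z.im : ℂ) ^ (s - k / 2) := by
  simp [phi, maassM, e]

/-- With 4πmy = 2πim(z̄ - z), φ becomes an expression in z and z̄ to which the substitution z ↦ γz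
applies directly. -/
theorem phi_of_pos {m : ℤ} (hm : 0 < m) (k s : ℂ) (z : ℍ) :
    phi m k s z = phiConst m k s * (z.im : ℂ) ^ (s - k / 2) *
      (Complex.exp (2 * Real.pi * Complex.I * m * z) * kummerM (s - k / 2) (2 * s)
        (2 * Real.pi * Complex.I * m * (starRingEnd ℂ) z - 2 * Real.pi * Complex.I * m * z)) := by
  have hz : (z : ℂ) = z.re + z.im * Complex.I := (Complex.re_add_im (z : ℂ)).symm
  have hz' : (starRingEnd ℂ) (z : ℂ) = z.re - z.im * Complex.I := by
    rw [hz]; simp [sub_eq_add_neg]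
  have h1 : ((4 * Real.pi * |(m : ℝ)| * z.im : ℝ) : ℂ) =
      2 * Real.pi * Complex.I * m * (starRingEnd ℂ) z - 2 * Real.pi * Complex.I * m * z := by
    rw [hz', hz, abs_of_pos (by exact_mod_cast hm)]
    push_cast
    linear_combination (4 * Real.pi * m * z.im : ℂ) * Complex.I_sq
  have h2 : Complex.exp (2 * Real.pi * Complex.I * m * z) =
      Complex.exp (-((4 * Real.pi * |(m : ℝ)| * z.im : ℝ) : ℂ) / 2) * e (m * z.re) := by
    rw [h1, e, ← Complex.exp_add, hz', hz]
    ring_nf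
  rw [phi, maassM_of_ne_zero hm.ne' k s z.im_pos, h2, ← h1, Int.sign_eq_one_of_pos hm]
  push_cast
  ring_nf

theorem phi_of_neg {m : ℤ} (hm : m < 0) (k s : ℂ) (z : ℍ) :
    phi m k s z = phiConst m k s * (z.im : ℂ) ^ (s - k / 2) *
      (Complex.exp (2 * Real.pi * Complex.I * m * (starRingEnd ℂ) z) *
        kummerM (s + k / 2) (2 * s)
        (2 * Real.pi * Complex.I * m * z - 2 * Real.pi * Complex.I * m * (starRingEnd ℂ) z)) := by
  have hz : (z : ℂ) = z.re + z.im * Complex.I := (Complex.re_add_im (z : ℂ)).symm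
  have hz' : (starRingEnd ℂ) (z : ℂ) = z.re - z.im * Complex.I := by
    rw [hz]; simp [sub_eq_add_neg]
  have h1 : ((4 * Real.pi * |(m : ℝ)| * z.im : ℝ) : ℂ) =
      2 * Real.pi * Complex.I * m * z - 2 * Real.pi * Complex.I * m * (starRingEnd ℂ) z := by
    rw [hz', hz, abs_of_neg (by exact_mod_cast hm)]
    push_cast
    linear_combination (-4 * Real.pi * m * z.im : ℂ) * Complex.I_sq
  have h2 : Complex.exp (2 * Real.pi * Complex.I * m * (starRingEnd ℂ) z) =
      Complex.exp (-((4 * Real.pi * |(m : ℝ)| * z.im : ℝ) : ℂ) / 2) * e (m * z.re) := by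
    rw [h1, e, ← Complex.exp_add, hz', hz]
    ring_nf
  rw [phi, maassM_of_ne_zero hm.ne k s z.im_pos, h2, ← h1, Int.sign_eq_neg_one_of_neg hm]
  push_cast
  ring_nf

theorem coe_smul_eq {γ : SL(2, ℤ)} (hc : γ 1 0 ≠ 0) (z : ℍ) :
    ((γ • z : ℍ) : ℂ) = (γ 0 0 : ℂ) / (γ 1 0 : ℂ) -
      1 / ((γ 1 0 : ℂ) ^ 2 * (((z.re + γ 1 1 / γ 1 0 : ℝ) : ℂ) + z.im * Complex.I)) := by
  have hc' : (γ 1 0 : ℂ) ≠ 0 := by exact_mod_cast hc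
  have hz : (z : ℂ) = z.re + z.im * Complex.I := (Complex.re_add_im (z : ℂ)).symm
  have hw := add_mul_I_ne_zero z.im_pos.ne' (z.re + γ 1 1 / γ 1 0)
  have hdet := γ.det_coe
  rw [Matrix.det_fin_two] at hdet
  have hdet' : (γ 0 0 : ℂ) * γ 1 1 - γ 0 1 * γ 1 0 = 1 := by exact_mod_cast hdet
  have hden : (γ 1 0 : ℂ) * z + γ 1 1 = γ 1 0 *
      (((z.re + γ 1 1 / γ 1 0 : ℝ) : ℂ) + z.im * Complex.I) := by
    rw [hz]; push_cast; field_simp; ring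
  rw [UpperHalfPlane.coe_specialLinearGroup_apply]
  simp only [algebraMap_int_eq, eq_intCast, Complex.ofReal_intCast]
  rw [hden, div_eq_iff (mul_ne_zero hc' hw)]
  set w := (((z.re + γ 1 1 / γ 1 0 : ℝ) : ℂ) + z.im * Complex.I) with hwdef
  have hz2 : (z : ℂ) = w - γ 1 1 / γ 1 0 := by
    field_simp; linear_combination hden
  rw [hz2]
  field_simp
  linear_combination -hdet'

theorem inv_sq_cpow {r : ℝ} (hr : 0 < r) (β : ℂ) :
    (((r ^ 2)⁻¹ : ℝ) : ℂ) ^ β = (r : ℂ) ^ (-2 * β) := by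
  have h1 : (r : ℂ) ≠ 0 := by exact_mod_cast hr.ne'
  have h2 : (((r ^ 2)⁻¹ : ℝ) : ℂ) ≠ 0 := by
    have : 0 < (r ^ 2)⁻¹ := by positivity
    exact_mod_cast this.ne'
  rw [Complex.cpow_def_of_ne_zero h1, Complex.cpow_def_of_ne_zero h2, ← Complex.ofReal_log hr.le,
    ← Complex.ofReal_log (by positivity), Real.log_inv, Real.log_pow]
  push_cast
  ring_nf

/-- Principal powers are multiplicative here because log z + log z̄ = log |z|² off the negative real
axis. -/
theorem inv_sq_add_sq_cpow (x : ℝ) {y : ℝ} (hy : 0 < y) (β : ℂ) :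
    (((x ^ 2 + y ^ 2)⁻¹ : ℝ) : ℂ) ^ β =
      (x + y * Complex.I) ^ (-β) * (x - y * Complex.I) ^ (-β) := by
  have hw := add_mul_I_ne_zero hy.ne' x
  have hw' := sub_mul_I_ne_zero hy.ne' x
  have hpos : 0 < x ^ 2 + y ^ 2 := by positivity
  have h2 : (((x ^ 2 + y ^ 2)⁻¹ : ℝ) : ℂ) ≠ 0 := by
    exact_mod_cast (inv_pos.2 hpos).ne'
  have hconj : (x : ℂ) - y * Complex.I = (starRingEnd ℂ) (x + y * Complex.I) := by
    simp [sub_eq_add_neg]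
  have harg : ((x : ℂ) + y * Complex.I).arg ≠ Real.pi := by
    intro h
    have := (Complex.arg_eq_pi_iff.1 h).2
    simp [hy.ne'] at this
  have hlog : Complex.log (x + y * Complex.I) + Complex.log (x - y * Complex.I) =
      (Real.log (x ^ 2 + y ^ 2) : ℂ) := by
    rw [hconj, Complex.log_conj _ harg, Complex.add_conj, Complex.log_re, norm_add_mul_I,
      Real.log_rpow hpos]
    push_cast
    ring
  rw [Complex.cpow_def_of_ne_zero hw, Complex.cpow_def_of_ne_zero hw',
    Complex.cpow_def_of_ne_zero h2, ← Complex.ofReal_log (inv_pos.2 hpos).le, Real.log_inv,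
    ← Complex.exp_add]
  congr 1
  push_cast
  linear_combination β * hlog

theorem im_smul_cpow {γ : SL(2, ℤ)} (hc : 0 < γ 1 0) (z : ℍ) (β : ℂ) :
    (((γ • z : ℍ).im : ℝ) : ℂ) ^ β = (z.im : ℂ) ^ β * (γ 1 0 : ℂ) ^ (-2 * β) *
      ((((z.re + γ 1 1 / γ 1 0 : ℝ) : ℂ) + z.im * Complex.I) ^ (-β) *
        (((z.re + γ 1 1 / γ 1 0 : ℝ) : ℂ) - z.im * Complex.I) ^ (-β)) := by
  have hc' : (0 : ℝ) < γ 1 0 := by exact_mod_cast hc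
  have hy := z.im_pos
  have him : (γ • z : ℍ).im = z.im * ((((γ 1 0 : ℝ)) ^ 2)⁻¹ *
      ((z.re + γ 1 1 / γ 1 0) ^ 2 + z.im ^ 2)⁻¹) := by
    rw [ModularGroup.im_smul_eq_div_normSq]
    rw [UpperHalfPlane.denom, Complex.normSq_apply]
    simp
    field_simp
  rw [him, Complex.ofReal_mul, Complex.mul_cpow_ofReal_nonneg hy.le (by positivity),
    Complex.ofReal_mul, Complex.mul_cpow_ofReal_nonneg (by positivity) (by positivity),
    inv_sq_cpow hc', inv_sq_add_sq_cpow _ hy]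
  push_cast
  ring

/-- With w = z + d/c, the weight factor contributes w^{-k} and Im(γz)^{s-k/2} contributes
w^{-(s-k/2)} w̄^{-(s-k/2)}, together w^{-α} w̄^{-β}. Since γz = a/c - 1/(c²w), the exponential and
the Kummer function of φ contribute e(ma/c) times the second factor in a closed form of `hSer`. -/
theorem phi_smul (m : ℤ) (k : ℂ) {s : ℂ} (hs : 1 < s.re) {γ : SL(2, ℤ)} (hc : 0 < γ 1 0) (z : ℍ) :
    ((γ 1 0 : ℂ) * z + γ 1 1) ^ (-k) * phi m k s (γ • z) =
      e ((m : ℂ) * γ 0 0 / γ 1 0) * (phiConst m k s * (z.im : ℂ) ^ (s - k / 2) *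
        (γ 1 0 : ℂ) ^ (-(2 * s))) *
        hSer (s + k / 2) (s - k / 2) (2 * Real.pi * Complex.I * m / (γ 1 0 : ℂ) ^ 2) z.im
          (z.re + γ 1 1 / γ 1 0) := by
  have hc' : (0 : ℝ) < γ 1 0 := by exact_mod_cast hc
  have hc0 : (γ 1 0 : ℂ) ≠ 0 := by exact_mod_cast hc.ne'
  have hy := z.im_pos
  set X : ℝ := z.re + γ 1 1 / γ 1 0 with hX
  set w : ℂ := X + z.im * Complex.I with hw
  set w' : ℂ := X - z.im * Complex.I with hw'
  have hw0 : w ≠ 0 := add_mul_I_ne_zero hy.ne' X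
  have hw0' : w' ≠ 0 := sub_mul_I_ne_zero hy.ne' X
  have hconj : (starRingEnd ℂ) w = w' := by simp [hw, hw', sub_eq_add_neg]
  have hz : (z : ℂ) = z.re + z.im * Complex.I := (Complex.re_add_im (z : ℂ)).symm
  have hden : (γ 1 0 : ℂ) * z + γ 1 1 = (γ 1 0 : ℝ) * w := by
    rw [hz, hw, hX]; push_cast; field_simp; ring
  have hab : s + k / 2 + (s - k / 2) = 2 * s := by ring
  have hb : ∀ j : ℕ, s + k / 2 + (s - k / 2) ≠ -j := by
    rw [hab]; exact ne_neg_nat_of_re_pos (by simp; linarith)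
  set t : ℂ := 2 * Real.pi * Complex.I * m / (γ 1 0 : ℂ) ^ 2 with ht
  have e1 : 2 * Real.pi * Complex.I * m * ((γ • z : ℍ) : ℂ) =
      2 * Real.pi * Complex.I * (m * γ 0 0 / γ 1 0) + -t / w := by
    rw [coe_smul_eq hc.ne', ← hX, ← hw, ht]; field_simp; ring
  have e2 : 2 * Real.pi * Complex.I * m * (starRingEnd ℂ) ((γ • z : ℍ) : ℂ) =
      2 * Real.pi * Complex.I * (m * γ 0 0 / γ 1 0) + -t / w' := by
    have : (starRingEnd ℂ) ((γ • z : ℍ) : ℂ) =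
        (γ 0 0 : ℂ) / (γ 1 0 : ℂ) - 1 / ((γ 1 0 : ℂ) ^ 2 * w') := by
      rw [coe_smul_eq hc.ne', ← hX, ← hw, ← hconj]; simp
    rw [this, ht]; field_simp; ring
  have hg : w ^ (-k) * (w ^ (-(s - k / 2)) * w' ^ (-(s - k / 2))) =
      gKer (s + k / 2) (s - k / 2) z.im X := by
    rw [gKer, ← mul_assoc, ← Complex.cpow_add _ _ hw0]
    congr 2
    ring
  have hcc : (γ 1 0 : ℂ) ^ (-k) * (γ 1 0 : ℂ) ^ (-2 * (s - k / 2)) = (γ 1 0 : ℂ) ^ (-(2 * s)) := by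
    rw [← Complex.cpow_add _ _ hc0]; congr 1; ring
  have hE : phi m k s (γ • z) = phiConst m k s * (((γ • z : ℍ).im : ℝ) : ℂ) ^ (s - k / 2) *
      (e ((m : ℂ) * γ 0 0 / γ 1 0) * (hSer (s + k / 2) (s - k / 2) t z.im X /
        gKer (s + k / 2) (s - k / 2) z.im X)) := by
    have hg0 : gKer (s + k / 2) (s - k / 2) z.im X ≠ 0 :=
      mul_ne_zero (by simp [Complex.cpow_eq_zero_iff, ← hw, hw0])
        (by simp [Complex.cpow_eq_zero_iff, ← hw', hw0'])
    -- In the Kummer argument the common phase 2πi ma/c cancels. Only the exponential retains it.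
    rcases lt_trichotomy m 0 with hm | hm | hm
    · rw [phi_of_neg hm, e1, e2, Complex.exp_add, hSer_eq hb t hy X, hab,
        mul_div_cancel_left₀ _ hg0, add_sub_add_left_eq_sub, e]
      ring
    · have ht0 : t = 0 := by simp [ht, hm]
      rw [ht0, hSer_eq hb 0 hy X, mul_div_cancel_left₀ _ hg0, hm, phi_zero_left]
      simp [kummerM_zero, phiConst, e]
    · rw [phi_of_pos hm, e1, e2, Complex.exp_add, hSer_eq' hb t hy X, hab,
        mul_div_cancel_left₀ _ hg0, add_sub_add_left_eq_sub, e]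
      ring
  have hg0 : gKer (s + k / 2) (s - k / 2) z.im X ≠ 0 :=
    mul_ne_zero (by simp [Complex.cpow_eq_zero_iff, ← hw, hw0])
      (by simp [Complex.cpow_eq_zero_iff, ← hw', hw0'])
  rw [hE, im_smul_cpow hc, hden, ofReal_mul_cpow hc', ← hX, ← hw, ← hw', ← hcc]
  push_cast
  rw [← mul_div_assoc, ← mul_div_assoc, ← mul_div_assoc, div_eq_iff hg0, ← hg]
  ring

/-- The factor `(c/d)^{2k} ε_d^{2k}` of the terms, `k = κ/2`, and `1` for integral `k`. -/
def quadMult (κ c d : ℤ) : ℂ := if Even κ then 1 else (quadSymbol c d : ℂ) ^ κ * eps d ^ κ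

theorem quadSymbol_trichotomy (c d : ℤ) :
    quadSymbol c d = 0 ∨ quadSymbol c d = 1 ∨ quadSymbol c d = -1 := by
  unfold quadSymbol
  rcases jacobiSym.trichotomy c d.natAbs with h | h | h <;> split_ifs <;> simp [h]

theorem autFactor_zpow (κ : ℤ) (γ : SL(2, ℤ)) (z : ℍ) :
    autFactor κ γ z ^ (-κ) =
      quadMult κ (γ 1 0) (γ 1 1) * ((γ 1 0 : ℂ) * z + γ 1 1) ^ (-((κ : ℂ) / 2)) := by
  have h : (((γ 1 0 : ℂ) * z + γ 1 1) ^ (1 / 2 : ℂ)) ^ (-κ) =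
      ((γ 1 0 : ℂ) * z + γ 1 1) ^ (-((κ : ℂ) / 2)) := by
    rw [← Complex.cpow_mul_int]; congr 1; push_cast; ring
  unfold autFactor quadMult
  split_ifs
  · rw [h, one_mul]
  · rw [mul_zpow, mul_zpow, h, inv_zpow', neg_neg]
    congr 2
    -- The symbol is 0 or ±1, so replacing its exponent by the negative changes nothing. The value 0
    -- relies on 0⁻¹ = 0.
    rcases quadSymbol_trichotomy (γ 1 0) (γ 1 1) with h | h | h <;> rw [h]
    · by_cases hκ : κ = 0 <;> simp [hκ, zero_zpow]
    · simp
    · simp [zpow_neg, ← inv_zpow]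

theorem norm_quadMult_le (κ c d : ℤ) : ‖quadMult κ c d‖ ≤ 1 := by
  unfold quadMult
  split_ifs with hκ
  · simp
  · have h0 : κ ≠ 0 := by rintro rfl; simp at hκ
    have he : ‖eps d‖ = 1 := by unfold eps; split_ifs <;> simp
    rw [norm_mul, norm_zpow, norm_zpow, he, one_zpow, mul_one]
    rcases quadSymbol_trichotomy c d with h | h | h <;> rw [h] <;> simp [zero_zpow _ h0]

/-- The term of the Poincaré series for a matrix with `c > 0`. -/
theorem slash_phi_of_pos (m κ : ℤ) {s : ℂ} (hs : 1 < s.re) {γ : SL(2, ℤ)} (hc : 0 < γ 1 0)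
    (z : ℍ) :
    slash κ (phi m ((κ : ℂ) / 2) s) γ z = quadMult κ (γ 1 0) (γ 1 1) *
      e ((m : ℂ) * γ 0 0 / γ 1 0) * (phiConst m ((κ : ℂ) / 2) s *
        (z.im : ℂ) ^ (s - (κ : ℂ) / 2 / 2) * (γ 1 0 : ℂ) ^ (-(2 * s))) *
        hSer (s + (κ : ℂ) / 2 / 2) (s - (κ : ℂ) / 2 / 2)
          (2 * Real.pi * Complex.I * m / (γ 1 0 : ℂ) ^ 2) z.im (z.re + γ 1 1 / γ 1 0) := by
  rw [slash, autFactor_zpow, mul_assoc, phi_smul m _ hs hc]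
  ring

end MaassPoincare

namespace MaassPoincare

open scoped FourierTransform

/-! ### The Fourier coefficients of the terms -/

/-- Once all powers of positive reals are exponentials, identities between the constants reduce to
polynomial identities in logarithms and exponents, which `ring` settles. -/
theorem cpow_eq_exp_log {r : ℝ} (hr : 0 < r) (c : ℂ) :
    (r : ℂ) ^ c = Complex.exp ((Real.log r : ℂ) * c) := by
  rw [Complex.cpow_def_of_ne_zero (by exact_mod_cast hr.ne'), ← Complex.ofReal_log hr.le]

theorem ofReal_eq_exp_log {r : ℝ} (hr : 0 < r) : (r : ℂ) = Complex.exp (Real.log r : ℂ) := by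
  rw [← Complex.ofReal_exp, Real.exp_log hr]

theorem Gamma_add_nat_eq {b : ℂ} (hb : ∀ m : ℕ, b ≠ -m) (j : ℕ) :
    Complex.Gamma (b + j) = (ascPochhammer ℂ j).eval b * Complex.Gamma b := by
  induction j with
  | zero => simp
  | succ j ih =>
    have : b + j ≠ 0 := fun h => hb j (by linear_combination h)
    rw [ascPochhammer_eval_succ', Nat.cast_succ, ← add_assoc, Complex.Gamma_add_one _ this, ih]
    ring

/-- The series `∑ⱼ z^j / ((b)_j j!)`. -/
def hyp01 (b z : ℂ) : ℂ := ∑' j : ℕ, z ^ j / ((ascPochhammer ℂ j).eval b * j.factorial)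

theorem hyp01_zero (b : ℂ) : hyp01 b 0 = 1 := by
  rw [hyp01, tsum_eq_single 0 fun j hj => by simp [hj]]
  simp

theorem besselJ_eq {b : ℂ} (hb : ∀ m : ℕ, b ≠ -m) (x : ℝ) :
    besselJ (b - 1) x = ((x : ℂ) / 2) ^ (b - 1) * ((Complex.Gamma b)⁻¹ *
      hyp01 b (-((x : ℂ) / 2) ^ 2)) := by
  rw [besselJ, hyp01]
  congr 1
  rw [← tsum_mul_left]
  refine tsum_congr fun j => ?_
  rw [show (j : ℂ) + (b - 1) + 1 = b + j by ring, Gamma_add_nat_eq hb, neg_pow (_ ^ 2), ← pow_mul]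
  simp only [div_eq_mul_inv, mul_inv]
  ring

theorem besselI_eq {b : ℂ} (hb : ∀ m : ℕ, b ≠ -m) (x : ℝ) :
    besselI (b - 1) x = ((x : ℂ) / 2) ^ (b - 1) * ((Complex.Gamma b)⁻¹ *
      hyp01 b (((x : ℂ) / 2) ^ 2)) := by
  rw [besselI, hyp01]
  congr 1
  rw [← tsum_mul_left]
  refine tsum_congr fun j => ?_
  rw [show (j : ℂ) + (b - 1) + 1 = b + j by ring, Gamma_add_nat_eq hb, ← pow_mul]
  simp only [div_eq_mul_inv, mul_inv]
  ring

theorem I_cpow (k : ℂ) : Complex.I ^ (-k) = Complex.exp (-(Real.pi * Complex.I / 2) * k) := by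
  rw [Complex.cpow_def_of_ne_zero Complex.I_ne_zero, Complex.log_I]
  congr 1
  ring

theorem log_two_mul_pi : Real.log (2 * Real.pi) = Real.log 2 + Real.log Real.pi :=
  Real.log_mul two_ne_zero Real.pi_pos.ne'

theorem log_four_mul_pi_mul {r : ℝ} (hr : 0 < r) :
    Real.log (4 * Real.pi * r) = 2 * Real.log 2 + Real.log Real.pi + Real.log r := by
  rw [Real.log_mul (by positivity) hr.ne', Real.log_mul (by norm_num) Real.pi_pos.ne',
    show (4 : ℝ) = 2 ^ 2 by norm_num, Real.log_pow]
  norm_num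

theorem log_four_mul_pi : Real.log (4 * Real.pi) = 2 * Real.log 2 + Real.log Real.pi := by
  simpa using log_four_mul_pi_mul one_pos

theorem maassW_of_ne_zero {n : ℤ} (hn : n ≠ 0) (k s : ℂ) {y : ℝ} (hy : 0 < y) :
    maassW n k y s = ((|(n : ℝ)| : ℝ) : ℂ) ^ (s + k / 2 - 1) * ((4 * Real.pi * y : ℝ) : ℂ) ^ (s - k / 2) *
      ((Complex.Gamma (s + k / 2 * (n.sign : ℂ)))⁻¹ *
      (Complex.exp (-((2 * Real.pi * |(n : ℝ)| * y : ℝ) : ℂ)) *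
        kummerU (s - k / 2 * (n.sign : ℂ)) (2 * s) ((4 * Real.pi * |(n : ℝ)| * y : ℝ) : ℂ))) := by
  have hn' : 0 < |(n : ℝ)| := abs_pos.2 (by exact_mod_cast hn)
  have h1 : ((|(n : ℝ)| : ℝ) : ℂ) ^ (k / 2 - 1) * ((4 * Real.pi * y : ℝ) : ℂ) ^ (-k / 2) *
      ((4 * Real.pi * |(n : ℝ)| * y : ℝ) : ℂ) ^ (s - 1 / 2 + 1 / 2) =
      ((|(n : ℝ)| : ℝ) : ℂ) ^ (s + k / 2 - 1) * ((4 * Real.pi * y : ℝ) : ℂ) ^ (s - k / 2) := by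
    have hl : Real.log (4 * Real.pi * |(n : ℝ)| * y) =
        Real.log |(n : ℝ)| + Real.log (4 * Real.pi * y) := by
      rw [← Real.log_mul hn'.ne' (by positivity)]; congr 1; ring
    rw [cpow_eq_exp_log hn', cpow_eq_exp_log hn', cpow_eq_exp_log (by positivity),
      cpow_eq_exp_log (by positivity), cpow_eq_exp_log (by positivity), hl, ← Complex.exp_add,
      ← Complex.exp_add, ← Complex.exp_add]
    congr 1
    push_cast
    ring
  have h2 : Complex.exp (-((4 * Real.pi * |(n : ℝ)| * y : ℝ) : ℂ) / 2) =
      Complex.exp (-((2 * Real.pi * |(n : ℝ)| * y : ℝ) : ℂ)) := by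
    congr 1; push_cast; ring
  rw [maassW, if_neg hn, whittakerW, h2,
    show s - 1 / 2 - k / 2 * (n.sign : ℂ) + 1 / 2 = s - k / 2 * (n.sign : ℂ) by ring,
    show 1 + 2 * (s - 1 / 2) = 2 * s by ring, ← h1]
  ring

/-- For n > 0 the phase is e^{-πi(α-β)/2} with α - β = k. For n < 0 reflection exchanges α and β and
contributes e^{-πik} against e^{πik/2}. Both signs give i^{-k}, and the exchange accounts for sgn(n)
in the Whittaker index. -/
theorem fourier_gKer_eq_maassW_of_ne_zero {n : ℤ} (hn : n ≠ 0) (k : ℂ) {s : ℂ} (hs : 1 < s.re) {y : ℝ}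
    (hy : 0 < y) :
    𝓕 (gKer (s + k / 2) (s - k / 2) y) (n : ℝ) = Complex.I ^ (-k) *
      (((2 * Real.pi : ℝ) : ℂ) ^ (2 * s) * ((|(n : ℝ)| : ℝ) : ℂ) ^ (s - k / 2) *
      ((4 * Real.pi * y : ℝ) : ℂ) ^ (-(s - k / 2))) * maassW n k y s := by
  have hn' : 0 < |(n : ℝ)| := abs_pos.2 (by exact_mod_cast hn)
  have hb : 2 < (2 * s).re := by simp; linarith
  have h1 : ((|(n : ℝ)| : ℝ) : ℂ) ^ (s - k / 2) * ((4 * Real.pi * y : ℝ) : ℂ) ^ (-(s - k / 2)) *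
      (((|(n : ℝ)| : ℝ) : ℂ) ^ (s + k / 2 - 1) * ((4 * Real.pi * y : ℝ) : ℂ) ^ (s - k / 2)) =
      ((|(n : ℝ)| : ℝ) : ℂ) ^ (2 * s - 1) := by
    rw [cpow_eq_exp_log hn', cpow_eq_exp_log hn', cpow_eq_exp_log hn',
      cpow_eq_exp_log (by positivity), cpow_eq_exp_log (by positivity), ← Complex.exp_add,
      ← Complex.exp_add, ← Complex.exp_add]
    congr 1
    ring
  rw [maassW_of_ne_zero hn k s hy, I_cpow]
  rcases hn.lt_or_gt with h | h
  · have habs : (n : ℝ) = -|(n : ℝ)| := by rw [abs_of_neg (by exact_mod_cast h), neg_neg]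
    have key := fourier_gKer_of_pos hb hy hn' (s + k / 2)
    rw [show 2 * s - (s + k / 2) = s - k / 2 by ring] at key
    have e1 : Complex.exp (-(Real.pi * Complex.I) * (s + k / 2 - (s - k / 2))) *
        Complex.exp (-(Real.pi * Complex.I / 2) * (s - k / 2 - (s + k / 2))) =
        Complex.exp (-(Real.pi * Complex.I / 2) * k) := by
      rw [← Complex.exp_add]; congr 1; ring
    rw [congrArg (𝓕 (gKer (s + k / 2) (s - k / 2) y)) habs, fourier_gKer_neg _ _ hy, key, ← e1,
      Int.sign_eq_neg_one_of_neg h]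
    push_cast at h1 ⊢
    rw [← h1]
    ring_nf
  · have habs : (n : ℝ) = |(n : ℝ)| := by rw [abs_of_pos (by exact_mod_cast h)]
    have key := fourier_gKer_of_pos hb hy hn' (s - k / 2)
    rw [show 2 * s - (s - k / 2) = s + k / 2 by ring] at key
    have e1 : Complex.exp (-(Real.pi * Complex.I / 2) * (s + k / 2 - (s - k / 2))) =
        Complex.exp (-(Real.pi * Complex.I / 2) * k) := by
      congr 1; ring
    rw [congrArg (𝓕 (gKer (s + k / 2) (s - k / 2) y)) habs, key, e1,
      Int.sign_eq_one_of_pos h]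
    push_cast at h1 ⊢
    rw [← h1]
    ring_nf

theorem fourier_gKer_eq_maassW_zero (k : ℂ) {s : ℂ} (hs : 1 < s.re) {y : ℝ} (hy : 0 < y) :
    𝓕 (gKer (s + k / 2) (s - k / 2) y) 0 = Complex.I ^ (-k) *
      (((2 * Real.pi : ℝ) : ℂ) ^ (2 * s) * ((4 * Real.pi : ℝ) : ℂ) ^ (k - 2 * s) *
      (y : ℂ) ^ (-(s - k / 2))) * Complex.Gamma (2 * s) * maassW 0 k y s := by
  have hb : 2 < (2 * s).re := by simp; linarith
  have hb1 : 2 * s - 1 ≠ 0 := by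
    intro h
    have := congrArg Complex.re h
    simp at this; linarith
  have hG : Complex.Gamma (2 * s) = (2 * s - 1) * Complex.Gamma (2 * s - 1) := by
    rw [← Complex.Gamma_add_one _ hb1]; congr 1; ring
  have h1 : ((4 * Real.pi : ℝ) : ℂ) ^ (k - 2 * s) * (y : ℂ) ^ (-(s - k / 2)) *
      (((4 * Real.pi : ℝ) : ℂ) ^ (1 - k) * (y : ℂ) ^ (1 - s - k / 2)) =
      ((4 * Real.pi * y : ℝ) : ℂ) ^ (1 - 2 * s) := by
    rw [cpow_eq_exp_log hy, cpow_eq_exp_log hy, cpow_eq_exp_log (by positivity),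
      cpow_eq_exp_log (by positivity), cpow_eq_exp_log (by positivity), ← Complex.exp_add,
      ← Complex.exp_add, ← Complex.exp_add, Real.log_mul (by positivity) hy.ne']
    congr 1
    push_cast
    ring
  have key := fourier_gKer_zero hb hy (s - k / 2)
  rw [show 2 * s - (s - k / 2) = s + k / 2 by ring, ← h1] at key
  rw [key, maassW, if_pos rfl, I_cpow, hG,
    show -(Real.pi * Complex.I / 2) * (s + k / 2 - (s - k / 2)) =
      -(Real.pi * Complex.I / 2) * k by ring]
  push_cast
  field_simp

/-! ### Comparison of the constants with the coefficient formula -/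

theorem coeff_cpow_of_ne_zero {M n y q : ℝ} (hM : 0 < M) (hn : 0 < n) (hy : 0 < y) (hq : 0 < q)
    (k s : ℂ) :
    ((4 * Real.pi * M : ℝ) : ℂ) ^ (s - k / 2) * (y : ℂ) ^ (s - k / 2) * (q : ℂ) ^ (-(2 * s)) *
      (((2 * Real.pi : ℝ) : ℂ) ^ (2 * s) * (n : ℂ) ^ (s - k / 2) *
      ((4 * Real.pi * y : ℝ) : ℂ) ^ (-(s - k / 2))) =
    ((2 * Real.pi : ℝ) : ℂ) / q * (((M * n : ℝ) : ℂ) ^ ((1 - k) / 2) *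
      ((2 * Real.pi * √(M * n) / q : ℝ) : ℂ) ^ (2 * s - 1)) := by
  have hpi := Real.pi_pos
  have hMn : 0 < √(M * n) := Real.sqrt_pos.2 (by positivity)
  have hl : Real.log (2 * Real.pi * √(M * n) / q) = Real.log 2 + Real.log Real.pi +
      (Real.log M + Real.log n) / 2 - Real.log q := by
    rw [Real.log_div (by positivity) hq.ne', Real.log_mul (by positivity) hMn.ne', log_two_mul_pi,
      Real.log_sqrt (by positivity), Real.log_mul hM.ne' hn.ne']
  rw [cpow_eq_exp_log (by positivity : 0 < 4 * Real.pi * M), cpow_eq_exp_log hy,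
    cpow_eq_exp_log hq, cpow_eq_exp_log (by positivity : 0 < 2 * Real.pi), cpow_eq_exp_log hn,
    cpow_eq_exp_log (by positivity : 0 < 4 * Real.pi * y), cpow_eq_exp_log (by positivity : 0 < M * n),
    cpow_eq_exp_log (by positivity : 0 < 2 * Real.pi * √(M * n) / q),
    ofReal_eq_exp_log (by positivity : 0 < 2 * Real.pi), ofReal_eq_exp_log hq, hl, log_two_mul_pi,
    log_four_mul_pi_mul hM, log_four_mul_pi_mul hy, Real.log_mul hM.ne' hn.ne']
  simp only [← Complex.exp_add, ← Complex.exp_sub]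
  congr 1
  push_cast
  ring

theorem coeff_cpow_of_eq_zero {n q : ℝ} (hn : 0 < n) (hq : 0 < q) (k s : ℂ) :
    (q : ℂ) ^ (-(2 * s)) * (((2 * Real.pi : ℝ) : ℂ) ^ (2 * s) * (n : ℂ) ^ (s - k / 2) *
      ((4 * Real.pi : ℝ) : ℂ) ^ (-(s - k / 2))) =
    ((2 * Real.pi : ℝ) : ℂ) / q * (((2 : ℝ) : ℂ) ^ (k - 1) * (Real.pi : ℂ) ^ (s + k / 2 - 1) *
      (n : ℂ) ^ (s - k / 2) * (q : ℂ) ^ (1 - 2 * s)) := by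
  have hpi := Real.pi_pos
  rw [cpow_eq_exp_log hq, cpow_eq_exp_log (by positivity : 0 < 2 * Real.pi), cpow_eq_exp_log hn,
    cpow_eq_exp_log (by positivity : 0 < 4 * Real.pi), cpow_eq_exp_log hq,
    cpow_eq_exp_log two_pos, cpow_eq_exp_log hpi,
    ofReal_eq_exp_log (by positivity : 0 < 2 * Real.pi), ofReal_eq_exp_log hq, log_two_mul_pi,
    log_four_mul_pi]
  simp only [← Complex.exp_add, ← Complex.exp_sub]
  congr 1
  push_cast
  ring

theorem coeff_cpow_zero_zero {q : ℝ} (hq : 0 < q) (k s : ℂ) :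
    (q : ℂ) ^ (-(2 * s)) * (((2 * Real.pi : ℝ) : ℂ) ^ (2 * s) *
      ((4 * Real.pi : ℝ) : ℂ) ^ (k - 2 * s)) =
    ((2 * Real.pi : ℝ) : ℂ) / q * (((2 : ℝ) : ℂ) ^ (2 * k - 2) * (Real.pi : ℂ) ^ (k - 1) *
      ((2 * q : ℝ) : ℂ) ^ (1 - 2 * s)) := by
  have hpi := Real.pi_pos
  rw [cpow_eq_exp_log hq, cpow_eq_exp_log (by positivity : 0 < 2 * Real.pi),
    cpow_eq_exp_log (by positivity : 0 < 4 * Real.pi),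
    cpow_eq_exp_log (by positivity : 0 < 2 * q),
    cpow_eq_exp_log two_pos, cpow_eq_exp_log hpi,
    ofReal_eq_exp_log (by positivity : 0 < 2 * Real.pi), ofReal_eq_exp_log hq, log_two_mul_pi,
    log_four_mul_pi, Real.log_mul two_ne_zero hq.ne']
  simp only [← Complex.exp_add, ← Complex.exp_sub]
  congr 1
  push_cast
  ring

/-- J and I are the same ₀F₁ up to the sign of its argument, and the argument -4π²mn/q² takes the
right sign in both cases. -/
theorem coeffFactor_of_mul_ne_zero {m n : ℤ} (hmn : m * n ≠ 0) (k : ℂ) {s : ℂ} (hs : 1 < s.re)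
    (q : ℝ) :
    coeffFactor m n k s q = ((|(m : ℝ)| * |(n : ℝ)| : ℝ) : ℂ) ^ ((1 - k) / 2) *
      ((2 * Real.pi * √(|(m : ℝ)| * |(n : ℝ)|) / q : ℝ) : ℂ) ^ (2 * s - 1) *
      ((Complex.Gamma (2 * s))⁻¹ * hyp01 (2 * s) (-(4 * Real.pi ^ 2 * m * n / q ^ 2))) := by
  have hb : ∀ j : ℕ, 2 * s ≠ -j := ne_neg_nat_of_re_pos (by simp; linarith)
  have hx : (((4 * Real.pi * √|(m * n : ℝ)| / q : ℝ) : ℂ) / 2) =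
      ((2 * Real.pi * √|(m * n : ℝ)| / q : ℝ) : ℂ) := by
    push_cast; ring
  have hx2 : (((4 * Real.pi * √|(m * n : ℝ)| / q : ℝ) : ℂ) / 2) ^ 2 =
      ((4 * Real.pi ^ 2 * |(m * n : ℝ)| / q ^ 2 : ℝ) : ℂ) := by
    rw [hx, ← Complex.ofReal_pow, div_pow, mul_pow, Real.sq_sqrt (abs_nonneg _)]
    push_cast; ring
  rw [← abs_mul]
  rcases hmn.lt_or_gt with h | h
  · have hr : (m * n : ℝ) < 0 := by exact_mod_cast h
    rw [coeffFactor, if_neg h.not_gt, if_pos h, besselI_eq hb, hx2, hx, abs_of_neg hr,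
      show ((4 * Real.pi ^ 2 * -(m * n : ℝ) / q ^ 2 : ℝ) : ℂ) =
        -(4 * Real.pi ^ 2 * m * n / q ^ 2) by push_cast; ring]
    ring
  · have hr : 0 < (m * n : ℝ) := by exact_mod_cast h
    rw [coeffFactor, if_pos h, besselJ_eq hb, hx2, hx, abs_of_pos hr,
      show ((4 * Real.pi ^ 2 * (m * n : ℝ) / q ^ 2 : ℝ) : ℂ) =
        4 * Real.pi ^ 2 * m * n / q ^ 2 by push_cast; ring]
    ring

/-- The Fourier coefficients of the terms of the Poincaré series. -/
theorem fourier_term (m n : ℤ) (k : ℂ) {s : ℂ} (hs : 1 < s.re) {y : ℝ} (hy : 0 < y) {q : ℝ}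
    (hq : 0 < q) :
    phiConst m k s * (y : ℂ) ^ (s - k / 2) * (q : ℂ) ^ (-(2 * s)) *
      𝓕 (hSer (s + k / 2) (s - k / 2) (2 * Real.pi * Complex.I * m / (q : ℂ) ^ 2) y) (n : ℝ) =
    2 * Real.pi * Complex.I ^ (-k) / q * coeffFactor m n k s q * maassW n k y s := by
  have hq' : (q : ℂ) ≠ 0 := by exact_mod_cast hq.ne'
  have hab : s + k / 2 + (s - k / 2) = 2 * s := by ring
  have hG : Complex.Gamma (2 * s) ≠ 0 :=
    Complex.Gamma_ne_zero_of_re_pos (by simp; linarith)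
  have hz : 2 * Real.pi * Complex.I * ((n : ℝ) : ℂ) * (2 * Real.pi * Complex.I * m / (q : ℂ) ^ 2) =
      -(4 * Real.pi ^ 2 * m * n / q ^ 2) := by
    push_cast
    linear_combination (4 * Real.pi ^ 2 * m * n / q ^ 2 : ℂ) * Complex.I_sq
  have hF : 𝓕 (hSer (s + k / 2) (s - k / 2) (2 * Real.pi * Complex.I * m / (q : ℂ) ^ 2) y) (n : ℝ) =
      𝓕 (gKer (s + k / 2) (s - k / 2) y) (n : ℝ) *
        hyp01 (2 * s) (-(4 * Real.pi ^ 2 * m * n / q ^ 2)) := by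
    rw [fourier_hSer (by rw [hab]; simp; linarith) _ hy, hz, hab, hyp01]
  rw [hF]
  by_cases hm : m = 0
  · subst hm
    rw [phiConst, if_pos rfl, Int.cast_zero, mul_zero, zero_mul, zero_div, neg_zero, hyp01_zero]
    by_cases hn : n = 0
    · subst hn
      rw [Int.cast_zero, fourier_gKer_eq_maassW_zero k hs hy, coeffFactor, if_neg (by simp),
        if_neg (by simp), if_neg (by simp)]
      have h1 := coeff_cpow_zero_zero hq k s
      have h2 : (y : ℂ) ^ (s - k / 2) * (y : ℂ) ^ (-(s - k / 2)) = 1 := by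
        rw [← Complex.cpow_add _ _ (by exact_mod_cast hy.ne'), add_neg_cancel, Complex.cpow_zero]
      push_cast at h1 ⊢
      linear_combination (Complex.I ^ (-k) * Complex.Gamma (2 * s) * maassW 0 k y s) * h1 +
        ((q : ℂ) ^ (-(2 * s)) * ((2 * Real.pi : ℂ) ^ (2 * s) * (4 * Real.pi : ℂ) ^ (k - 2 * s)) *
        Complex.I ^ (-k) * Complex.Gamma (2 * s) * maassW 0 k y s) * h2
    · have hn' : 0 < |(n : ℝ)| := abs_pos.2 (by exact_mod_cast hn)
      rw [fourier_gKer_eq_maassW_of_ne_zero hn k hs hy, coeffFactor, if_neg (by simp),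
        if_neg (by simp), if_pos (by simpa using hn)]
      have h1 := coeff_cpow_of_eq_zero hn' hq k s
      have h2 : (y : ℂ) ^ (s - k / 2) * ((4 * Real.pi * y : ℝ) : ℂ) ^ (-(s - k / 2)) =
          ((4 * Real.pi : ℝ) : ℂ) ^ (-(s - k / 2)) := by
        rw [cpow_eq_exp_log hy, cpow_eq_exp_log (by positivity), cpow_eq_exp_log (by positivity),
          ← Complex.exp_add, Real.log_mul (by positivity) hy.ne']
        congr 1
        push_cast
        ring
      simp only [Int.cast_zero, zero_add]
      push_cast at h1 h2 ⊢
      linear_combination (Complex.I ^ (-k) * maassW n k y s) * h1 +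
        ((q : ℂ) ^ (-(2 * s)) * ((2 * Real.pi : ℂ) ^ (2 * s) *
          ((|(n : ℝ)| : ℝ) : ℂ) ^ (s - k / 2)) * Complex.I ^ (-k) * maassW n k y s) * h2
  · have hm' : 0 < |(m : ℝ)| := abs_pos.2 (by exact_mod_cast hm)
    rw [phiConst, if_neg hm]
    by_cases hn : n = 0
    · subst hn
      rw [Int.cast_zero, fourier_gKer_eq_maassW_zero k hs hy, coeffFactor, if_neg (by simp),
        if_neg (by simp), if_pos (by simpa using hm), Int.cast_zero, mul_zero, zero_div, neg_zero,
        hyp01_zero]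
      have h1 := coeff_cpow_of_eq_zero hm' hq k s
      have h2 : (y : ℂ) ^ (s - k / 2) * (y : ℂ) ^ (-(s - k / 2)) = 1 := by
        rw [← Complex.cpow_add _ _ (by exact_mod_cast hy.ne'), add_neg_cancel, Complex.cpow_zero]
      have h3 : ((4 * Real.pi * |(m : ℝ)| : ℝ) : ℂ) ^ (s - k / 2) *
          ((4 * Real.pi : ℝ) : ℂ) ^ (k - 2 * s) =
          ((|(m : ℝ)| : ℝ) : ℂ) ^ (s - k / 2) * ((4 * Real.pi : ℝ) : ℂ) ^ (-(s - k / 2)) := by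
        rw [cpow_eq_exp_log hm', cpow_eq_exp_log (by positivity), cpow_eq_exp_log (by positivity),
          cpow_eq_exp_log (by positivity), ← Complex.exp_add, ← Complex.exp_add,
          Real.log_mul (by positivity) hm'.ne']
        congr 1
        push_cast
        ring
      have h4 := inv_mul_cancel₀ hG
      simp only [Int.cast_zero, add_zero]
      push_cast at h1 h2 h3 ⊢
      linear_combination (Complex.I ^ (-k) * maassW 0 k y s) * h1 +
        ((q : ℂ) ^ (-(2 * s)) * (2 * Real.pi : ℂ) ^ (2 * s) * Complex.I ^ (-k) *
          maassW 0 k y s) * h3 +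
        ((4 * Real.pi * ((|(m : ℝ)| : ℝ) : ℂ)) ^ (s - k / 2) * (4 * Real.pi : ℂ) ^ (k - 2 * s) *
          (q : ℂ) ^ (-(2 * s)) * (2 * Real.pi : ℂ) ^ (2 * s) * Complex.I ^ (-k) *
          maassW 0 k y s) * h4 +
        ((Complex.Gamma (2 * s))⁻¹ * Complex.Gamma (2 * s) *
          (4 * Real.pi * ((|(m : ℝ)| : ℝ) : ℂ)) ^ (s - k / 2) * (4 * Real.pi : ℂ) ^ (k - 2 * s) *
          (q : ℂ) ^ (-(2 * s)) * (2 * Real.pi : ℂ) ^ (2 * s) * Complex.I ^ (-k) *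
          maassW 0 k y s) * h2
    · have hn' : 0 < |(n : ℝ)| := abs_pos.2 (by exact_mod_cast hn)
      rw [fourier_gKer_eq_maassW_of_ne_zero hn k hs hy, coeffFactor_of_mul_ne_zero (mul_ne_zero hm hn) k hs q]
      have h1 := coeff_cpow_of_ne_zero hm' hn' hy hq k s
      push_cast at h1 ⊢
      linear_combination (Complex.I ^ (-k) * maassW n k y s * ((Complex.Gamma (2 * s))⁻¹ *
        hyp01 (2 * s) (-(4 * Real.pi ^ 2 * m * n / q ^ 2)))) * h1

end MaassPoincare

namespace MaassPoincare

open scoped FourierTransform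

/-! ### Poisson summation -/

theorem norm_e (x : ℝ) : ‖e x‖ = 1 := by
  rw [e, show 2 * (Real.pi : ℂ) * Complex.I * (x : ℂ) = ((2 * Real.pi * x : ℝ) : ℂ) * Complex.I by
    push_cast; ring, Complex.norm_exp_ofReal_mul_I]

theorem e_add (u v : ℂ) : e (u + v) = e u * e v := by
  rw [e, e, e, ← Complex.exp_add]; congr 1; ring

theorem e_intCast (n : ℤ) : e n = 1 := by
  rw [e, Complex.exp_eq_one_iff]; exact ⟨n, by ring⟩

theorem summable_inv_one_add_sq : Summable fun n : ℤ => (1 + (n : ℝ) ^ 2)⁻¹ := by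
  -- The shift by 1/2 keeps the comparison series finite at n = 0, and (n + 1/2)² ≤ 2(1 + n²)
  -- explains the factor 2.
  refine (((Real.summable_one_div_int_add_rpow (1 / 2) 2).2 one_lt_two).mul_left 2).of_nonneg_of_le
    (fun n => by positivity) fun n => ?_
  have h0 : (n : ℝ) + 1 / 2 ≠ 0 := by
    intro h
    have : (2 * n + 1 : ℤ) = 0 := by
      have : (2 * n + 1 : ℝ) = 0 := by linarith
      exact_mod_cast this
    omega
  have h1 : 0 < ((n : ℝ) + 1 / 2) ^ 2 := by positivity
  rw [Real.rpow_two, sq_abs, ← div_eq_mul_one_div, inv_eq_one_div, div_le_div_iff₀ (by positivity) h1]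
  nlinarith [sq_nonneg ((n : ℝ) - 1 / 2)]

theorem summable_fourier_hSer {α β : ℂ} (h : 1 < (α + β).re) (t : ℂ) {y : ℝ} (hy : 0 < y) :
    Summable fun n : ℤ => 𝓕 (hSer α β t y) n := by
  obtain ⟨C, hC0, hC⟩ := exists_norm_fourier_hSer_le h hy ‖t‖
  refine Summable.of_norm_bounded (summable_inv_one_add_sq.mul_left C) fun n => ?_
  rw [← div_eq_mul_inv, le_div_iff₀ (by positivity)]
  exact hC t le_rfl n

theorem tsum_hSer_add_int {α β : ℂ} (h : 1 < (α + β).re) (t : ℂ) {y : ℝ} (hy : 0 < y) (x : ℝ) :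
    ∑' r : ℤ, hSer α β t y (x + r) = ∑' n : ℤ, 𝓕 (hSer α β t y) n * e (n * x) := by
  obtain ⟨C, hC0, hC⟩ := exists_norm_hSer_le (by linarith : 0 < (α + β).re) hy ‖t‖
  have hO : hSer α β t y =O[cocompact ℝ] fun x => |x| ^ (-(α + β).re) := by
    refine Asymptotics.IsBigO.of_bound C ?_
    -- Decay matters only at infinity, so the origin, where |x| has no useful negative power, is
    -- discarded.
    filter_upwards [(isCompact_singleton (x := (0 : ℝ))).compl_mem_cocompact] with x hx
    have hx0 : x ≠ 0 := hx
    refine (hC t le_rfl x).trans ?_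
    rw [Real.norm_of_nonneg (by positivity)]
    gcongr
    have : |x| ^ (-(α + β).re) = (x ^ 2) ^ (-(α + β).re / 2) := by
      rw [← sq_abs, ← Real.rpow_natCast, ← Real.rpow_mul (abs_nonneg _)]
      congr 1
      push_cast
      ring
    rw [this]
    exact Real.rpow_le_rpow_of_nonpos (by positivity) (by nlinarith) (by linarith)
  rw [Real.tsum_eq_tsum_fourier_of_rpow_decay_of_summable (continuous_hSer (by linarith) t hy) h hO
    (summable_fourier_hSer h t hy)]
  refine tsum_congr fun n => ?_
  rw [fourier_coe_apply, e]
  congr 2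
  push_cast
  ring

theorem tsum_periodic_mul {q : ℕ} (hq : 0 < q) {w g : ℤ → ℂ}
    (hw : ∀ d r, w (d + q * r) = w d) (hs : Summable fun d => w d * g d) :
    ∑' d, w d * g d = ∑ v ∈ Finset.range q, w v * ∑' r : ℤ, g (v + q * r) := by
  have : NeZero q := ⟨hq.ne'⟩
  set σ : Fin q × ℤ ≃ ℤ := (Equiv.prodComm _ _).trans (Int.divModEquiv q).symm with hσ
  have hσ' : ∀ v r, σ (v, r) = (v : ℤ) + q * r := by
    intro v r
    simp [hσ, Int.divModEquiv]
    ring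
  have hs' : Summable ((fun d => w d * g d) ∘ σ) := σ.summable_iff.2 hs
  have hp := hs'.tsum_prod
  simp only [Function.comp] at hp
  rw [← σ.tsum_eq, hp, tsum_fintype, Finset.sum_range]
  refine Finset.sum_congr rfl fun v _ => ?_
  rw [← tsum_mul_left]
  refine tsum_congr fun r => ?_
  rw [hσ', hw]

/-- Writing d = v + qr gives x + d/q = (x + v/q) + r. Poisson summation in r produces e(nv/q), and
the finite sum over v collects into an exponential sum attached to w. -/
theorem tsum_periodic_mul_hSer {α β : ℂ} (h : 1 < (α + β).re) (t : ℂ) {y : ℝ} (hy : 0 < y) (x : ℝ)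
    {q : ℕ} (hq : 0 < q) {w : ℤ → ℂ} (hw : ∀ d r, w (d + q * r) = w d)
    (hs : Summable fun d : ℤ => w d * hSer α β t y (x + d / q)) :
    ∑' d : ℤ, w d * hSer α β t y (x + d / q) =
      ∑' n : ℤ, (∑ v ∈ Finset.range q, w v * e (n * v / q)) * 𝓕 (hSer α β t y) n * e (n * x) := by
  have hq' : (q : ℝ) ≠ 0 := by exact_mod_cast hq.ne'
  have h1 : ∀ v : ℕ, ∑' r : ℤ, hSer α β t y (x + ((v + q * r : ℤ) : ℝ) / q) =
      ∑' n : ℤ, 𝓕 (hSer α β t y) n * e (n * (x + v / q)) := by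
    intro v
    have := tsum_hSer_add_int h t hy (x + v / q)
    push_cast at this
    rw [← this]
    refine tsum_congr fun r => ?_
    congr 1
    push_cast
    field_simp
    ring
  have hsum : ∀ v : ℕ, Summable fun n : ℤ => 𝓕 (hSer α β t y) n * e (n * (x + v / q)) := by
    intro v
    refine Summable.of_norm ((summable_fourier_hSer h t hy).norm.congr fun n => ?_)
    rw [norm_mul, show (n : ℂ) * (x + v / q) = ((n * (x + v / q) : ℝ) : ℂ) by push_cast; rfl,
      norm_e, mul_one]
  rw [tsum_periodic_mul hq hw (g := fun d => hSer α β t y (x + d / q)) hs]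
  simp_rw [h1, ← tsum_mul_left]
  rw [← Summable.tsum_finsetSum fun v _ => (hsum v).mul_left _]
  refine tsum_congr fun n => ?_
  rw [Finset.sum_mul, Finset.sum_mul]
  refine Finset.sum_congr rfl fun v _ => ?_
  rw [mul_add, e_add, ← mul_div_assoc]
  ring

/-- Each term equals |Nc z + d|^{-ρ}, so this is part of a majorant of an Eisenstein series,
convergent for ρ > 2. -/
theorem summable_norm_mul_add {ρ : ℝ} (hρ : 2 < ρ) (z : ℍ) {N : ℕ} (hN : 0 < N) :
    Summable fun p : ℕ+ × ℤ => ((N * p.1 : ℕ) : ℝ) ^ (-ρ) *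
      ((z.re + p.2 / (N * p.1 : ℕ)) ^ 2 + z.im ^ 2) ^ (-ρ / 2) := by
  have h1 := (EisensteinSeries.summable_one_div_norm_rpow hρ).mul_left (EisensteinSeries.r z ^ (-ρ))
  have h2 : Summable fun x : Fin 2 → ℤ => ‖(x 0 : ℂ) * z + x 1‖ ^ (-ρ) :=
    h1.of_nonneg_of_le (fun x => by positivity)
      fun x => EisensteinSeries.summand_bound z (by linarith) x
  have hinj : Function.Injective fun p : ℕ+ × ℤ => (![((N * p.1 : ℕ) : ℤ), p.2] : Fin 2 → ℤ) := by
    intro p p' hp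
    have e0 := congrFun hp 0
    have e1 := congrFun hp 1
    simp only [Matrix.cons_val_zero, Matrix.cons_val_one, Nat.cast_inj] at e0 e1
    exact Prod.ext (PNat.eq (Nat.eq_of_mul_eq_mul_left hN e0)) e1
  refine (h2.comp_injective hinj).congr fun p => ?_
  have hq : 0 < ((N * p.1 : ℕ) : ℝ) := by have := p.1.pos; positivity
  have hw : (((N * p.1 : ℕ) : ℤ) : ℂ) * z + p.2 = ((N * p.1 : ℕ) : ℝ) *
      (((z.re + p.2 / (N * p.1 : ℕ) : ℝ) : ℂ) + z.im * Complex.I) := by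
    have hz : (z : ℂ) = z.re + z.im * Complex.I := (Complex.re_add_im (z : ℂ)).symm
    have hN' : (N : ℂ) ≠ 0 := by exact_mod_cast hN.ne'
    have hp' : ((p.1 : ℕ) : ℂ) ≠ 0 := by exact_mod_cast p.1.ne_zero
    rw [hz]
    push_cast
    field_simp
    ring
  simp only [Function.comp, Matrix.cons_val_zero, Matrix.cons_val_one]
  rw [hw, norm_mul, Complex.norm_real, Real.norm_of_nonneg hq.le, norm_add_mul_I,
    Real.mul_rpow hq.le (by positivity), ← Real.rpow_mul (by positivity)]
  congr 2
  ring

theorem summable_pnat_mul_rpow {ρ : ℝ} (hρ : 1 < ρ) {N : ℕ} (hN : 0 < N) :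
    Summable fun c : ℕ+ => ((N * c : ℕ) : ℝ) ^ (-ρ) :=
  (Real.summable_nat_rpow.2 (by linarith : -ρ < -1)).comp_injective
    (i := fun c : ℕ+ => N * c) fun c c' h => PNat.eq (Nat.eq_of_mul_eq_mul_left hN h)

theorem norm_natCast_cpow_neg (b : ℂ) {N : ℕ} (hN : 0 < N) (c : ℕ+) :
    ‖((N * c : ℕ) : ℂ) ^ (-b)‖ = ((N * c : ℕ) : ℝ) ^ (-b.re) := by
  rw [Complex.norm_natCast_cpow_of_pos (Nat.mul_pos hN c.pos), Complex.neg_re]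

theorem summable_mul_hSer {α β : ℂ} (h : 2 < (α + β).re) (z : ℍ) {N : ℕ} (hN : 0 < N) {t : ℕ+ → ℂ}
    {T : ℝ} (ht : ∀ c, ‖t c‖ ≤ T) {w : ℕ+ → ℤ → ℂ} (hw : ∀ c d, ‖w c d‖ ≤ 1) :
    Summable fun p : ℕ+ × ℤ => w p.1 p.2 * ((N * p.1 : ℕ) : ℂ) ^ (-(α + β)) *
      hSer α β (t p.1) z.im (z.re + p.2 / (N * p.1 : ℕ)) := by
  obtain ⟨C, hC0, hC⟩ := exists_norm_hSer_le (by linarith : 0 < (α + β).re) z.im_pos T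
  refine Summable.of_norm_bounded ((summable_norm_mul_add h z hN).mul_left C) fun p => ?_
  rw [norm_mul, norm_mul, norm_natCast_cpow_neg _ hN]
  calc _ ≤ 1 * ((N * p.1 : ℕ) : ℝ) ^ (-(α + β).re) *
        (C * ((z.re + p.2 / (N * p.1 : ℕ)) ^ 2 + z.im ^ 2) ^ (-(α + β).re / 2)) := by
        gcongr
        · exact hw _ _
        · exact hC _ (ht _) _
    _ = _ := by ring

/-- The trivial bound Nc for the inner sum costs one power of c and leaves (Nc)^{1-Re(α+β)}, still
summable. The decay n^{-2} is uniform in c because the parameters t c are bounded. -/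
theorem summable_mul_fourier_hSer {α β : ℂ} (h : 2 < (α + β).re) (z : ℍ) {N : ℕ} (hN : 0 < N)
    {t : ℕ+ → ℂ} {T : ℝ} (ht : ∀ c, ‖t c‖ ≤ T) {w : ℕ+ → ℤ → ℂ} (hw : ∀ c d, ‖w c d‖ ≤ 1) :
    Summable fun p : ℕ+ × ℤ => (∑ v ∈ Finset.range (N * p.1), w p.1 v * e (p.2 * v / (N * p.1 : ℕ))) *
      ((N * p.1 : ℕ) : ℂ) ^ (-(α + β)) * 𝓕 (hSer α β (t p.1) z.im) p.2 * e (p.2 * z.re) := by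
  obtain ⟨C, hC0, hC⟩ := exists_norm_fourier_hSer_le (by linarith : 1 < (α + β).re) z.im_pos T
  refine Summable.of_norm_bounded ((((summable_pnat_mul_rpow (ρ := (α + β).re - 1) (by linarith)
    hN).mul_of_nonneg summable_inv_one_add_sq (fun c => by positivity)
    fun n => by positivity)).mul_left C) fun p => ?_
  have hq : 0 < ((N * p.1 : ℕ) : ℝ) := by exact_mod_cast Nat.mul_pos hN p.1.pos
  have h1 : ‖∑ v ∈ Finset.range (N * p.1), w p.1 v * e (p.2 * v / (N * p.1 : ℕ))‖ ≤
      (N * p.1 : ℕ) := by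
    refine (norm_sum_le_of_le _ (n := fun _ => 1) fun v _ => ?_).trans_eq (by simp)
    rw [norm_mul, show (p.2 : ℂ) * v / (N * p.1 : ℕ) = ((p.2 * v / (N * p.1 : ℕ) : ℝ) : ℂ) by
      push_cast; rfl, norm_e, mul_one]
    exact hw _ _
  have h2 : ‖𝓕 (hSer α β (t p.1) z.im) p.2‖ ≤ C * (1 + (p.2 : ℝ) ^ 2)⁻¹ := by
    rw [← div_eq_mul_inv, le_div_iff₀ (by positivity)]
    exact hC _ (ht _) _
  rw [norm_mul, norm_mul, norm_mul, norm_natCast_cpow_neg _ hN,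
    show (p.2 : ℂ) * z.re = ((p.2 * z.re : ℝ) : ℂ) by push_cast; rfl, norm_e, mul_one]
  calc _ ≤ ((N * p.1 : ℕ) : ℝ) * ((N * p.1 : ℕ) : ℝ) ^ (-(α + β).re) *
        (C * (1 + (p.2 : ℝ) ^ 2)⁻¹) := by gcongr
    _ = _ := by
        rw [neg_sub, sub_eq_add_neg, Real.rpow_add hq, Real.rpow_one]
        ring

/-- Poisson summation in d for each c. The double summability on both sides justifies iterating the
sums and moving the sum over n outside. -/
theorem tsum_mul_hSer {α β : ℂ} (h : 2 < (α + β).re) (z : ℍ) {N : ℕ} (hN : 0 < N) {t : ℕ+ → ℂ}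
    {T : ℝ} (ht : ∀ c, ‖t c‖ ≤ T) {w : ℕ+ → ℤ → ℂ} (hw : ∀ c d, ‖w c d‖ ≤ 1)
    (hper : ∀ c d r, w c (d + (N * c : ℕ) * r) = w c d) :
    ∑' p : ℕ+ × ℤ, w p.1 p.2 * ((N * p.1 : ℕ) : ℂ) ^ (-(α + β)) *
      hSer α β (t p.1) z.im (z.re + p.2 / (N * p.1 : ℕ)) =
    ∑' (n : ℤ) (c : ℕ+), (∑ v ∈ Finset.range (N * c), w c v * e (n * v / (N * c : ℕ))) *
      ((N * c : ℕ) : ℂ) ^ (-(α + β)) * 𝓕 (hSer α β (t c) z.im) n * e (n * z.re) := by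
  have hS := summable_mul_hSer h z hN ht hw
  have hF := summable_mul_fourier_hSer h z hN ht hw
  have hcomm := Summable.tsum_comm (f := fun (c : ℕ+) (n : ℤ) =>
    (∑ v ∈ Finset.range (N * c), w c v * e (n * v / (N * c : ℕ))) *
      ((N * c : ℕ) : ℂ) ^ (-(α + β)) * 𝓕 (hSer α β (t c) z.im) n * e (n * z.re)) hF
  rw [hcomm, hS.tsum_prod]
  refine tsum_congr fun c => ?_
  have hq0 : ((N * c : ℕ) : ℂ) ≠ 0 := by exact_mod_cast (Nat.mul_pos hN c.pos).ne'
  have hq : ((N * c : ℕ) : ℂ) ^ (-(α + β)) ≠ 0 := by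
    rw [Ne, Complex.cpow_eq_zero_iff]; tauto
  have hSc : Summable fun d : ℤ => w c d * hSer α β (t c) z.im (z.re + d / (N * c : ℕ)) := by
    refine ((hS.prod_factor c).mul_left (((N * c : ℕ) : ℂ) ^ (-(α + β)))⁻¹).congr fun d => ?_
    simp only []
    field_simp
  have key := tsum_periodic_mul_hSer (by linarith) (t c) z.im_pos z.re (Nat.mul_pos hN c.pos)
    (w := w c) (hper c) hSc
  have e1 := congrArg (((N * c : ℕ) : ℂ) ^ (-(α + β)) * ·) key
  simp only [← tsum_mul_left] at e1
  refine Eq.trans (tsum_congr fun d => ?_) (Eq.trans e1 (tsum_congr fun n => ?_))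
  · ring
  · ring

end MaassPoincare

namespace MaassPoincare

/-! ### Periodicity of the quadratic symbol -/

theorem jacobiSym_four_mul (a : ℤ) {n : ℕ} (hn : Odd n) : jacobiSym (4 * a) n = jacobiSym a n := by
  have h : (2 : ℤ).gcd n = 1 := Nat.coprime_two_left.2 hn
  rw [jacobiSym.mul_left, show (4 : ℤ) = 2 ^ 2 by norm_num, jacobiSym.sq_one' h, one_mul]

/-- The symbol (a/·) depends on its lower entry modulo 4a. Since n(4a-n) ≡ n²(4a-1) modulo 4a and
(a/(4a-1)) = (4a/(4a-1)) = (1/(4a-1)) = 1, the product of the two symbols is 1. -/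
theorem jacobiSym_four_mul_sub {a n : ℕ} (hn : Odd n) (hna : n < 4 * a) (h : Nat.Coprime a n) :
    jacobiSym a (4 * a - n) = jacobiSym a n := by
  obtain ⟨j, rfl⟩ := hn
  have hodd : Odd (4 * a - (2 * j + 1)) := ⟨2 * a - j - 1, by omega⟩
  have hodd' : Odd (4 * a - 1) := ⟨2 * a - 1, by omega⟩
  have hodd0 : Odd (2 * j + 1) := ⟨j, rfl⟩
  have h1 : jacobiSym a (4 * a - 1) = 1 := by
    rw [← jacobiSym_four_mul _ hodd', jacobiSym.mod_left' (a₂ := 1), jacobiSym.one_left]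
    have : ((4 * a - 1 : ℕ) : ℤ) = 4 * a - 1 := by omega
    rw [this]
    exact Int.modEq_iff_dvd.2 ⟨-1, by ring⟩
  have h2 : jacobiSym a ((2 * j + 1) * (4 * a - (2 * j + 1))) =
      jacobiSym a ((2 * j + 1) * (2 * j + 1) * (4 * a - 1)) := by
    rw [jacobiSym.mod_right' a (hodd0.mul hodd), jacobiSym.mod_right' a ((hodd0.mul hodd0).mul hodd')]
    congr 1
    change _ ≡ _ [MOD 4 * a]
    rw [← Int.natCast_modEq_iff, Int.modEq_iff_dvd]
    have c1 : ((4 * a - (2 * j + 1) : ℕ) : ℤ) = 4 * a - (2 * j + 1) := by omega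
    have c2 : ((4 * a - 1 : ℕ) : ℤ) = 4 * a - 1 := by omega
    rw [Nat.cast_mul _ (4 * a - 1), Nat.cast_mul _ (4 * a - _), c1, c2]
    refine ⟨(2 * j + 1) * (2 * j + 1) - (2 * j + 1), ?_⟩
    push_cast
    ring
  have h3 : jacobiSym a (2 * j + 1) ^ 2 = 1 := jacobiSym.sq_one (by exact_mod_cast h)
  rw [jacobiSym.mul_right' _ (by omega) (by omega), jacobiSym.mul_right' _ (by positivity) (by omega),
    jacobiSym.mul_right' _ (by omega) (by omega), h1, ← sq, h3] at h2
  have h4 : jacobiSym a (2 * j + 1) * (jacobiSym a (2 * j + 1) *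
      jacobiSym a (4 * a - (2 * j + 1))) = jacobiSym a (2 * j + 1) * 1 := by rw [h2]; ring
  rw [← mul_assoc, ← sq, h3, one_mul, mul_one] at h4
  exact h4

/-- The reason for requiring 4 ∣ N: then (q/d) depends only on d modulo q. For d < 0 the residue of
d is q minus that of |d|, which is the reflection treated above. -/
theorem quadSymbol_eq_emod {q : ℕ} (hq : 4 ∣ q) (hq0 : 0 < q) {d : ℤ} (hd : d.gcd q = 1) :
    quadSymbol q d = jacobiSym q (d % q).toNat := by
  obtain ⟨a, rfl⟩ := hq
  have hodd : Odd d.natAbs := by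
    rw [← Nat.not_even_iff_odd]
    intro h
    have h2 : 2 ∣ d.gcd (4 * a : ℕ) := by
      rw [Int.gcd, Int.natAbs_natCast]
      exact Nat.dvd_gcd h.two_dvd ⟨2 * a, by ring⟩
    rw [hd] at h2
    omega
  have hcop : Nat.Coprime d.natAbs (4 * a) := by rwa [Int.gcd, Int.natAbs_natCast] at hd
  have hcop' : Nat.Coprime a (d.natAbs % (4 * a)) := by
    have h2 : Nat.Coprime (d.natAbs % (4 * a)) (4 * a) := by
      rw [Nat.Coprime, (Nat.mod_modEq d.natAbs (4 * a)).gcd_eq]; exact hcop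
    exact (Nat.Coprime.coprime_mul_left_right h2).symm
  have hodd2 : Odd (d.natAbs % (4 * a)) := by
    rw [Nat.odd_iff, Nat.mod_mod_of_dvd _ ⟨2 * a, by ring⟩]; exact Nat.odd_iff.1 hodd
  have hlt : d.natAbs % (4 * a) < 4 * a := Nat.mod_lt _ hq0
  rw [quadSymbol, if_neg (by omega), one_mul]
  have e0 : ∀ n : ℕ, Odd n → jacobiSym ((4 * a : ℕ) : ℤ) n = jacobiSym a n := fun n hn => by
    rw [Nat.cast_mul]; exact jacobiSym_four_mul _ hn
  rw [e0 _ hodd, jacobiSym.mod_right' a hodd]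
  rcases le_or_gt 0 d with h | h
  · have : (d % (4 * a : ℕ)).toNat = d.natAbs % (4 * a) := by
      obtain ⟨n, rfl⟩ := Int.eq_ofNat_of_zero_le h
      rw [← Int.natCast_mod, Int.toNat_natCast, Int.natAbs_natCast]
    rw [this, e0 _ hodd2]
  · have h1 : (d % (4 * a : ℕ)).toNat = 4 * a - d.natAbs % (4 * a) := by
      have hne : d.natAbs % (4 * a) ≠ 0 := fun h0 => by rw [h0] at hodd2; simp at hodd2
      have hd' : d = -(d.natAbs : ℤ) := by omega
      have h2 : d % (4 * a : ℕ) = ((4 * a - d.natAbs % (4 * a) : ℕ) : ℤ) := by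
        have h3 : ((4 * a - d.natAbs % (4 * a) : ℕ) : ℤ) =
            d + (4 * a : ℕ) * (1 + (d.natAbs / (4 * a) : ℕ)) := by
          rw [Nat.cast_sub hlt.le]
          have := Nat.div_add_mod d.natAbs (4 * a)
          have h4 : ((4 * a : ℕ) : ℤ) * ((d.natAbs / (4 * a) : ℕ) : ℤ) + ((d.natAbs % (4 * a) : ℕ) : ℤ) =
            (d.natAbs : ℤ) := by exact_mod_cast this
          linear_combination -h4 - hd'
        rw [← Int.add_mul_emod_self_left d (4 * a : ℕ) (1 + (d.natAbs / (4 * a) : ℕ)), ← h3]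
        exact_mod_cast Nat.mod_eq_of_lt (by omega)
      rw [h2, Int.toNat_natCast]
    rw [h1, e0 _ (by obtain ⟨j, hj⟩ := hodd2; exact ⟨2 * a - j - 1, by omega⟩),
      jacobiSym_four_mul_sub hodd2 hlt hcop']

theorem quadMult_add {κ : ℤ} {q : ℕ} (hκ : Odd κ → 4 ∣ q) (hq0 : 0 < q) {d : ℤ} (hd : d.gcd q = 1)
    (r : ℤ) : quadMult κ q (d + q * r) = quadMult κ q d := by
  unfold quadMult
  split_ifs with h
  · rfl
  · have h4 := hκ (Int.not_even_iff_odd.1 h)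
    have hd' : (d + q * r).gcd q = 1 := by
      rw [Int.gcd_comm, Int.gcd_add_mul_left_right, Int.gcd_comm, hd]
    rw [quadSymbol_eq_emod h4 hq0 hd, quadSymbol_eq_emod h4 hq0 hd', Int.add_mul_emod_self_left]
    congr 2
    obtain ⟨a, rfl⟩ := h4
    unfold eps
    have : (d + (4 * a : ℕ) * r) % 4 = d % 4 := by
      push_cast
      rw [mul_assoc, Int.add_mul_emod_self_left]
    rw [this]

/-! ### Independence of the sign of the matrix -/

/-- In the upper half plane arg(-w) = arg w - π, so the principal root acquires e^{-πi/2}. -/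
theorem neg_cpow_half {w : ℂ} (hw : 0 < w.im) :
    (-w) ^ (1 / 2 : ℂ) = -Complex.I * w ^ (1 / 2 : ℂ) := by
  have hw0 : w ≠ 0 := by rintro rfl; simp at hw
  have hlog : Complex.log (-w) = Complex.log w + -(Real.pi * Complex.I) := by
    rw [Complex.log, Complex.log, Complex.arg_neg_eq_arg_sub_pi_of_im_pos hw, norm_neg]
    push_cast
    ring
  rw [Complex.cpow_def_of_ne_zero (neg_ne_zero.2 hw0), Complex.cpow_def_of_ne_zero hw0, hlog, add_mul,
    Complex.exp_add, show -(Real.pi * Complex.I) * (1 / 2 : ℂ) = -(Real.pi / 2 * Complex.I) by ring,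
    Complex.exp_neg, Complex.exp_pi_div_two_mul_I, Complex.inv_I]
  ring

/-- The factor -i of the square root is compensated by ε and by the sign rules for the symbol,
according to the sign of d and its class modulo 4. Hence j(-γ, z) = j(γ, z) for κ odd. -/
theorem quadSymbol_neg_mul {c d : ℤ} (hc : 0 < c) (hd : Odd d) :
    (quadSymbol (-c) (-d) : ℂ) * (eps (-d))⁻¹ * -Complex.I = quadSymbol c d * (eps d)⁻¹ := by
  have hb : Odd d.natAbs := Int.natAbs_odd.2 hd
  have hd0 : d ≠ 0 := by rintro rfl; simp at hd
  unfold quadSymbol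
  rw [Int.natAbs_neg, jacobiSym.neg _ hb]
  have hodd := Int.odd_iff.1 hd
  have h4 : d % 4 = 1 ∨ d % 4 = 3 := by omega
  rcases lt_or_gt_of_ne hd0 with h | h <;> rcases h4 with h4 | h4
  · rw [ZMod.χ₄_nat_three_mod_four (by omega), if_neg (by omega), if_neg (by omega), eps, eps,
      if_neg (by omega), if_pos h4]
    push_cast; field_simp
  · rw [ZMod.χ₄_nat_one_mod_four (by omega), if_neg (by omega), if_neg (by omega), eps, eps,
      if_pos (by omega), if_neg (by omega)]
    push_cast; rw [Complex.inv_I]; ring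
  · rw [ZMod.χ₄_nat_one_mod_four (by omega), if_pos (by omega), if_neg (by omega), eps, eps,
      if_neg (by omega), if_pos h4]
    push_cast; field_simp
  · rw [ZMod.χ₄_nat_three_mod_four (by omega), if_pos (by omega), if_neg (by omega), eps, eps,
      if_pos (by omega), if_neg (by omega)]
    push_cast; rw [Complex.inv_I]; ring

/-- For κ divisible by 4 the factor (-i)^{-κ} is 1, and for κ odd the automorphy factor itself is
unchanged. Odd integral weight is excluded, since there the sign really changes. -/
theorem slash_neg_of_pos {κ : ℤ} (hκ : Odd κ ∨ 4 ∣ κ) (f : ℍ → ℂ) {γ : SL(2, ℤ)} (hc : 0 < γ 1 0)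
    (hd : Odd κ → Odd (γ 1 1)) (z : ℍ) : slash κ f (-γ) z = slash κ f γ z := by
  have hsm : (-γ) • z = γ • z := ModularGroup.SL_neg_smul γ z
  have h10 : (-γ) 1 0 = -(γ 1 0) := by simp
  have h11 : (-γ) 1 1 = -(γ 1 1) := by simp
  have him : 0 < ((γ 1 0 : ℂ) * z + γ 1 1).im := by
    have : (0 : ℝ) < γ 1 0 := by exact_mod_cast hc
    simpa using mul_pos this z.im_pos
  have hw : ((-(γ 1 0) : ℤ) : ℂ) * z + ((-(γ 1 1) : ℤ) : ℂ) = -((γ 1 0 : ℂ) * z + γ 1 1) := by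
    push_cast; ring
  rw [slash, slash, hsm]
  congr 1
  unfold autFactor
  rw [h10, h11, hw, neg_cpow_half him]
  split_ifs with h
  · obtain ⟨l, rfl⟩ : 4 ∣ κ := hκ.resolve_left (Int.not_odd_iff_even.2 h)
    rw [mul_zpow, ← mul_neg, zpow_mul]
    have : (-Complex.I) ^ (4 : ℤ) = 1 := by
      rw [show (4 : ℤ) = (4 : ℕ) by norm_num, zpow_natCast, neg_pow, Complex.I_pow_four]; norm_num
    rw [this, one_zpow, one_mul]
  · congr 1
    rw [← quadSymbol_neg_mul hc (hd (Int.not_even_iff_odd.1 h))]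
    ring

end MaassPoincare

namespace MaassPoincare

/-! ### Representatives of `Γ_∞ \ Γ₀(N)` and bottom rows -/

theorem det_eq_one (γ : SL(2, ℤ)) : γ 0 0 * γ 1 1 - γ 0 1 * γ 1 0 = 1 := by
  have := γ.det_coe
  rwa [Matrix.det_fin_two] at this

theorem mem_translationGroup_iff (γ : SL(2, ℤ)) : γ ∈ translationGroup ↔ γ 1 0 = 0 := by
  constructor
  · rintro ⟨n, h | h⟩ <;> simp [h]
  · intro h
    have hd := det_eq_one γ
    rw [h, mul_zero, sub_zero] at hd
    rcases Int.mul_eq_one_iff_eq_one_or_neg_one.1 hd with ⟨h0, h1⟩ | ⟨h0, h1⟩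
    · refine ⟨γ 0 1, Or.inl ?_⟩
      rw [Matrix.eta_fin_two (γ : Matrix (Fin 2) (Fin 2) ℤ), h, h0, h1]
      simp
    · refine ⟨-(γ 0 1), Or.inr ?_⟩
      rw [Matrix.eta_fin_two (γ : Matrix (Fin 2) (Fin 2) ℤ), h, h0, h1]
      simp

/-- The bottom row of `γ ∈ Γ₀(N)` up to sign: `(c, d)` if the row is `±(Nc, d)` with `c > 0`, and
`none` if its first entry vanishes. -/
def bottomRow (N : ℕ) (γ : SL(2, ℤ)) : Option (ℕ+ × ℤ) :=
  if γ 1 0 = 0 then none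
  else some (((γ 1 0).natAbs / N).toPNat', (γ 1 0).sign * γ 1 1)

theorem bottomRow_eq_some {N : ℕ} (hN : 0 < N) {γ : SL(2, ℤ)}
    (hγ : γ ∈ CongruenceSubgroup.Gamma0 N) (h : γ 1 0 ≠ 0) :
    ∃ c : ℕ+, bottomRow N γ = some (c, (γ 1 0).sign * γ 1 1) ∧
      ((N * c : ℕ) : ℤ) = (γ 1 0).sign * γ 1 0 := by
  refine ⟨_, if_neg h, ?_⟩
  rw [CongruenceSubgroup.Gamma0_mem, ZMod.intCast_zmod_eq_zero_iff_dvd] at hγ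
  have h1 : N ∣ (γ 1 0).natAbs := Int.natCast_dvd.1 hγ
  have h2 : 0 < (γ 1 0).natAbs / N :=
    Nat.div_pos (Nat.le_of_dvd (Int.natAbs_pos.2 h) h1) hN
  rw [Nat.toPNat'_coe, if_pos h2, Nat.mul_div_cancel' h1, Int.sign_mul_self_eq_natAbs]

theorem bottomRow_mul (N : ℕ) {h : SL(2, ℤ)} (hh : h 1 0 = 0) (γ : SL(2, ℤ)) :
    bottomRow N (h * γ) = bottomRow N γ := by
  have hd := det_eq_one h
  rw [hh, mul_zero, sub_zero] at hd
  have e0 : (h * γ) 1 0 = h 1 1 * γ 1 0 := by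
    simp [Matrix.SpecialLinearGroup.coe_mul, Matrix.mul_apply, Fin.sum_univ_two, hh]
  have e1 : (h * γ) 1 1 = h 1 1 * γ 1 1 := by
    simp [Matrix.SpecialLinearGroup.coe_mul, Matrix.mul_apply, Fin.sum_univ_two, hh]
  unfold bottomRow
  rw [e0, e1]
  rcases Int.mul_eq_one_iff_eq_one_or_neg_one.1 hd with ⟨-, h1⟩ | ⟨-, h1⟩ <;> simp [h1]

/-- The difference of the two products is, up to sign, the lower left entry of γ γ'⁻¹. Its vanishing
puts γ γ'⁻¹ into Γ_∞. -/
theorem mul_eq_mul_of_bottomRow_eq {N : ℕ} (hN : 0 < N) {γ γ' : SL(2, ℤ)}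
    (hγ : γ ∈ CongruenceSubgroup.Gamma0 N) (hγ' : γ' ∈ CongruenceSubgroup.Gamma0 N)
    (h : bottomRow N γ = bottomRow N γ') : γ 1 0 * γ' 1 1 = γ 1 1 * γ' 1 0 := by
  by_cases h0 : γ 1 0 = 0
  · have h0' : γ' 1 0 = 0 := by
      by_contra h0'
      simp [bottomRow, h0, h0'] at h
    rw [h0, h0', zero_mul, mul_zero]
  · have h0' : γ' 1 0 ≠ 0 := by
      intro h0'
      simp [bottomRow, h0, h0'] at h
    obtain ⟨c, h1, h2⟩ := bottomRow_eq_some hN hγ h0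
    obtain ⟨c', h1', h2'⟩ := bottomRow_eq_some hN hγ' h0'
    rw [h1, h1', Option.some_inj, Prod.mk.injEq] at h
    obtain ⟨rfl, h3⟩ := h
    have hs : (γ 1 0).sign * (γ' 1 0).sign ≠ 0 := by simp [h0, h0']
    apply mul_left_cancel₀ hs
    rw [h2'] at h2
    linear_combination (-(γ' 1 0).sign * γ' 1 1) * h2 - ((γ' 1 0).sign * γ' 1 0) * h3

theorem injective_bottomRow {N : ℕ} (hN : 0 < N) {R : Set (CongruenceSubgroup.Gamma0 N)}
    (hR : Subgroup.IsComplement (gammaInf N : Set (CongruenceSubgroup.Gamma0 N)) R) :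
    Function.Injective fun γ : R => bottomRow N (γ : CongruenceSubgroup.Gamma0 N) := by
  intro γ γ' h
  have h1 := mul_eq_mul_of_bottomRow_eq hN (γ : CongruenceSubgroup.Gamma0 N).2
    (γ' : CongruenceSubgroup.Gamma0 N).2 h
  set g : CongruenceSubgroup.Gamma0 N := γ * (γ' : CongruenceSubgroup.Gamma0 N)⁻¹ with hg
  have hmem : g ∈ gammaInf N := by
    rw [gammaInf, Subgroup.mem_subgroupOf, mem_translationGroup_iff, hg]
    simp [Matrix.SpecialLinearGroup.coe_mul, Matrix.SpecialLinearGroup.coe_inv,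
      Matrix.mul_apply, Fin.sum_univ_two, Matrix.adjugate_fin_two]
    linear_combination h1
  -- Both g · γ' and 1 · γ decompose the element γ, so uniqueness forces γ' = γ.
  have := hR.1 (a₁ := (⟨g, hmem⟩, γ')) (a₂ := (⟨1, (gammaInf N).one_mem⟩, γ)) (by simp [hg])
  exact (congrArg Prod.snd this).symm

theorem exists_bottomRow_eq {N : ℕ} {R : Set (CongruenceSubgroup.Gamma0 N)}
    (hR : Subgroup.IsComplement (gammaInf N : Set (CongruenceSubgroup.Gamma0 N)) R)
    (g : CongruenceSubgroup.Gamma0 N) :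
    ∃ γ : R, bottomRow N (γ : CongruenceSubgroup.Gamma0 N) = bottomRow N g := by
  obtain ⟨⟨h, γ⟩, hg⟩ := hR.2 g
  refine ⟨γ, ?_⟩
  have hh : ((h : CongruenceSubgroup.Gamma0 N) : SL(2, ℤ)) 1 0 = 0 :=
    (mem_translationGroup_iff _).1 h.2
  rw [← hg]
  exact (bottomRow_mul N hh _).symm

theorem exists_mem_bottomRow_eq {N : ℕ} {R : Set (CongruenceSubgroup.Gamma0 N)}
    (hN : 0 < N) (hR : Subgroup.IsComplement (gammaInf N : Set (CongruenceSubgroup.Gamma0 N)) R)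
    {c : ℕ+} {d : ℤ} (h : d.gcd (N * c : ℕ) = 1) :
    ∃ γ : R, bottomRow N (γ : CongruenceSubgroup.Gamma0 N) = some (c, d) := by
  have hq : 0 < N * c := Nat.mul_pos hN c.pos
  obtain ⟨g, h0, h1⟩ := (Int.isCoprime_iff_gcd_eq_one.2 (by rwa [Int.gcd_comm]) :
    IsCoprime ((N * c : ℕ) : ℤ) d).exists_SL2_row 1
  have hg : g ∈ CongruenceSubgroup.Gamma0 N := by
    rw [CongruenceSubgroup.Gamma0_mem, h0]; simp
  obtain ⟨γ, hγ⟩ := exists_bottomRow_eq hR ⟨g, hg⟩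
  refine ⟨γ, hγ.trans ?_⟩
  have hpos : (0 : ℤ) < g 1 0 := by rw [h0]; exact_mod_cast hq
  obtain ⟨c', e1, e2⟩ := bottomRow_eq_some hN hg hpos.ne'
  rw [Int.sign_eq_one_of_pos hpos, one_mul] at e1 e2
  rw [h0, Nat.cast_inj] at e2
  rw [e1, h1, PNat.eq (Nat.eq_of_mul_eq_mul_left hN e2)]

/-! ### The terms in terms of the bottom row -/

/-- Such a γ acts as an integral translation, which does not affect y or e(mx). It remains to see
that the automorphy factor is trivial. -/
theorem slash_phi_of_eq_zero (m : ℤ) {κ : ℤ} (k s : ℂ) {γ : SL(2, ℤ)} (hc : γ 1 0 = 0)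
    (hd : γ 1 1 = 1 ∨ Odd κ ∨ 4 ∣ κ) (z : ℍ) : slash κ (phi m k s) γ z = phi m k s z := by
  have hdet := det_eq_one γ
  rw [hc, mul_zero, sub_zero] at hdet
  have hcases := Int.mul_eq_one_iff_eq_one_or_neg_one.1 hdet
  obtain ⟨n, hn⟩ : ∃ n : ℤ, ((γ • z : ℍ) : ℂ) = z + n := by
    rw [UpperHalfPlane.coe_specialLinearGroup_apply]
    rcases hcases with ⟨h0, h1⟩ | ⟨h0, h1⟩
    · exact ⟨γ 0 1, by simp [hc, h0, h1]⟩
    · exact ⟨-(γ 0 1), by simp [hc, h0, h1]; ring⟩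
  have hphi : phi m k s (γ • z) = phi m k s z := by
    have hre : (γ • z).re = z.re + n := by simpa using congrArg Complex.re hn
    have him : (γ • z).im = z.im := by simpa using congrArg Complex.im hn
    rw [phi, phi, hre, him, show (m : ℂ) * ((z.re + n : ℝ) : ℂ) = m * z.re + ((m * n : ℤ) : ℂ) by
      push_cast; ring, e_add, e_intCast, mul_one]
  have haut : autFactor κ γ z ^ (-κ) = 1 := by
    have hI : (-1 : ℂ) ^ (1 / 2 : ℂ) = Complex.I := by
      rw [Complex.cpow_def_of_ne_zero (by norm_num), Complex.log_neg_one,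
        show (Real.pi : ℂ) * Complex.I * (1 / 2) = Real.pi / 2 * Complex.I by ring,
        Complex.exp_pi_div_two_mul_I]
    unfold autFactor
    rw [hc]
    rcases hcases with ⟨-, h1⟩ | ⟨-, h1⟩
    · rw [h1]
      split_ifs <;> simp [quadSymbol, eps]
    · rw [h1]
      split_ifs with h
      · obtain ⟨l, rfl⟩ : 4 ∣ κ :=
          (hd.resolve_left (by omega)).resolve_left (Int.not_odd_iff_even.2 h)
        simp only [Int.cast_zero, zero_mul, zero_add, Int.cast_neg, Int.cast_one]
        rw [hI, ← mul_neg, zpow_mul]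
        have : Complex.I ^ (4 : ℤ) = 1 := by
          rw [show (4 : ℤ) = (4 : ℕ) by norm_num, zpow_natCast, Complex.I_pow_four]
        rw [this, one_zpow]
      · simp only [Int.cast_zero, zero_mul, zero_add, Int.cast_neg, Int.cast_one]
        rw [hI]
        simp [quadSymbol, eps]
  rw [slash, haut, hphi, one_mul]

/-- The weight `(Nc/d)^{2k} ε_d^{2k} e(m d̄/(Nc))` of the term with bottom row `(Nc, d)`. -/
def rowWeight (m κ : ℤ) (N : ℕ) (c : ℕ+) (d : ℤ) : ℂ :=
  if d.gcd (N * c : ℕ) = 1 then quadMult κ (N * c : ℕ) d *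
    e ((m : ℂ) * (((d : ZMod (N * c))⁻¹).val : ℂ) / (N * c : ℕ)) else 0

theorem norm_rowWeight_le (m κ : ℤ) (N : ℕ) (c : ℕ+) (d : ℤ) : ‖rowWeight m κ N c d‖ ≤ 1 := by
  unfold rowWeight
  split_ifs
  · rw [norm_mul, show (m : ℂ) * (((d : ZMod (N * c))⁻¹).val : ℂ) / (N * c : ℕ) =
      ((m * (((d : ZMod (N * c))⁻¹).val : ℝ) / (N * c : ℕ) : ℝ) : ℂ) by push_cast; rfl, norm_e,
      mul_one]
    exact norm_quadMult_le _ _ _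
  · simp

theorem rowWeight_add (m : ℤ) {κ : ℤ} {N : ℕ} (hN : 0 < N) (hκ : Odd κ → 4 ∣ N) (c : ℕ+) (d r : ℤ) :
    rowWeight m κ N c (d + (N * c : ℕ) * r) = rowWeight m κ N c d := by
  have h1 : (d + (N * c : ℕ) * r).gcd (N * c : ℕ) = d.gcd (N * c : ℕ) := by
    rw [Int.gcd_comm, Int.gcd_add_mul_left_right, Int.gcd_comm]
  have h2 : ((d + (N * c : ℕ) * r : ℤ) : ZMod (N * c)) = d := by
    rw [Int.cast_add, Int.cast_mul, Int.cast_natCast, ZMod.natCast_self, zero_mul, add_zero]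
  unfold rowWeight
  rw [h1, h2]
  split_ifs with h
  · rw [quadMult_add (fun ho => (hκ ho).mul_right _) (Nat.mul_pos hN c.pos) h]
  · rfl

/-- The terms of the Poincaré series indexed by bottom rows. -/
def rowTerm (m κ : ℤ) (N : ℕ) (z : ℍ) (s : ℂ) (p : ℕ+ × ℤ) : ℂ :=
  rowWeight m κ N p.1 p.2 * ((N * p.1 : ℕ) : ℂ) ^ (-(2 * s)) *
    hSer (s + (κ : ℂ) / 2 / 2) (s - (κ : ℂ) / 2 / 2)
      (2 * Real.pi * Complex.I * m / ((N * p.1 : ℕ) : ℂ) ^ 2) z.im (z.re + p.2 / (N * p.1 : ℕ)) *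
    (phiConst m ((κ : ℂ) / 2) s * (z.im : ℂ) ^ (s - (κ : ℂ) / 2 / 2))

theorem slash_phi_eq_rowTerm_of_pos (m κ : ℤ) {N : ℕ} (hN : 0 < N) {s : ℂ} (hs : 1 < s.re) (z : ℍ)
    {γ : SL(2, ℤ)} (hγ : γ ∈ CongruenceSubgroup.Gamma0 N) (hc : 0 < γ 1 0) :
    slash κ (phi m ((κ : ℂ) / 2) s) γ z = (bottomRow N γ).elim (phi m ((κ : ℂ) / 2) s z)
      (rowTerm m κ N z s) := by
  obtain ⟨c, h1, h2⟩ := bottomRow_eq_some hN hγ hc.ne'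
  rw [Int.sign_eq_one_of_pos hc, one_mul] at h1 h2
  have hq : 0 < N * c := Nat.mul_pos hN c.pos
  have hq0 : ((N * c : ℕ) : ℂ) ≠ 0 := by exact_mod_cast hq.ne'
  have hdet := det_eq_one γ
  have hgcd : (γ 1 1).gcd (N * c : ℕ) = 1 := by
    rw [h2, ← Int.isCoprime_iff_gcd_eq_one]
    exact ⟨γ 0 0, -(γ 0 1), by linear_combination hdet⟩
  -- The determinant relation modulo Nc reads ad ≡ 1, so the phase e(ma/(Nc)) depends only on d.
  have hinv : ((γ 1 1 : ZMod (N * c))⁻¹) = ((γ 0 0 : ℤ) : ZMod (N * c)) := by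
    apply ZMod.inv_eq_of_mul_eq_one
    rw [← h2] at hdet
    have := congrArg (Int.cast : ℤ → ZMod (N * c)) hdet
    rw [Int.cast_sub, Int.cast_mul, Int.cast_mul, Int.cast_natCast, ZMod.natCast_self, mul_zero,
      sub_zero, Int.cast_one] at this
    exact (mul_comm _ _).trans this
  have hval : (((γ 1 1 : ZMod (N * c))⁻¹).val : ℤ) = γ 0 0 % (N * c : ℕ) := by
    have : NeZero (N * c) := ⟨hq.ne'⟩
    rw [hinv, ZMod.val_intCast]
  have he : e ((m : ℂ) * γ 0 0 / γ 1 0) =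
      e ((m : ℂ) * (((γ 1 1 : ZMod (N * c))⁻¹).val : ℂ) / (N * c : ℕ)) := by
    have h3 := Int.emod_add_mul_ediv (γ 0 0) (N * c : ℕ)
    rw [← hval] at h3
    have h4 : ((γ 0 0 : ℤ) : ℂ) = (((γ 1 1 : ZMod (N * c))⁻¹).val : ℂ) +
        ((N * c : ℕ) : ℂ) * ((γ 0 0 / (N * c : ℕ) : ℤ) : ℂ) := by
      conv_lhs => rw [← h3]
      push_cast
      rfl
    have h5 : ((γ 1 0 : ℤ) : ℂ) = ((N * c : ℕ) : ℂ) := by rw [← h2, Int.cast_natCast]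
    rw [h5, h4, show (m : ℂ) * ((((γ 1 1 : ZMod (N * c))⁻¹).val : ℂ) +
        ((N * c : ℕ) : ℂ) * ((γ 0 0 / (N * c : ℕ) : ℤ) : ℂ)) / ((N * c : ℕ) : ℂ) =
        (m : ℂ) * (((γ 1 1 : ZMod (N * c))⁻¹).val : ℂ) / (N * c : ℕ) +
          ((m * (γ 0 0 / (N * c : ℕ)) : ℤ) : ℂ) by
      rw [Int.cast_mul, mul_add, add_div]
      congr 1
      field_simp, e_add, e_intCast, mul_one]
  rw [slash_phi_of_pos m κ hs hc, h1, he, Option.elim_some, rowTerm, rowWeight, if_pos hgcd]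
  simp only [← h2, Int.cast_natCast]
  ring

theorem slash_phi_eq_rowTerm {m κ : ℤ} {N : ℕ} (hN : 0 < N) (hκ : Odd κ → 4 ∣ N) {s : ℂ}
    (hs : 1 < s.re) (z : ℍ) {γ : SL(2, ℤ)} (hγ : γ ∈ CongruenceSubgroup.Gamma0 N)
    (hsign : (Odd κ ∨ 4 ∣ κ) ∨ 0 < γ 1 0 ∨ (γ 1 0 = 0 ∧ 0 < γ 1 1)) :
    slash κ (phi m ((κ : ℂ) / 2) s) γ z = (bottomRow N γ).elim (phi m ((κ : ℂ) / 2) s z)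
      (rowTerm m κ N z s) := by
  have hdet := det_eq_one γ
  rcases lt_trichotomy (γ 1 0) 0 with hc | hc | hc
  · have hκ' : Odd κ ∨ 4 ∣ κ := hsign.resolve_right (by omega)
    have hneg : bottomRow N (-γ) = bottomRow N γ := by
      simp [bottomRow, Int.sign_neg]
    have h10 : (-γ) 1 0 = -(γ 1 0) := by simp
    have h11 : (-γ) 1 1 = -(γ 1 1) := by simp
    have hγ' : -γ ∈ CongruenceSubgroup.Gamma0 N := by
      rw [CongruenceSubgroup.Gamma0_mem, h10, Int.cast_neg, CongruenceSubgroup.Gamma0_mem.1 hγ,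
        neg_zero]
    -- For κ odd, 4 divides N and hence the lower left entry, so the determinant forces d to be odd.
    have hodd : Odd κ → Odd ((-γ) 1 1) := by
      intro ho
      rw [CongruenceSubgroup.Gamma0_mem, ZMod.intCast_zmod_eq_zero_iff_dvd] at hγ
      have h4 : (4 : ℤ) ∣ γ 1 0 := (Int.natCast_dvd_natCast.2 (hκ ho)).trans hγ
      rw [h11]
      refine Odd.neg (Int.not_even_iff_odd.1 ?_)
      intro hev
      have h2 : (2 : ℤ) ∣ 1 := by
        rw [← hdet]
        exact dvd_sub (hev.two_dvd.mul_left _) (((by norm_num : (2 : ℤ) ∣ 4).trans h4).mul_left _)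
      norm_num at h2
    have := slash_neg_of_pos hκ' (phi m ((κ : ℂ) / 2) s) (γ := -γ) (by omega) hodd z
    rw [neg_neg] at this
    rw [this, slash_phi_eq_rowTerm_of_pos m κ hN hs z hγ' (by omega), hneg]
  · rw [bottomRow, if_pos hc, Option.elim_none]
    refine slash_phi_of_eq_zero m _ s hc ?_ z
    rcases hsign with h | h | h
    · exact Or.inr h
    · omega
    · left
      rw [hc, mul_zero, sub_zero] at hdet
      rcases Int.mul_eq_one_iff_eq_one_or_neg_one.1 hdet with h1 | h1 <;> omega
  · exact slash_phi_eq_rowTerm_of_pos m κ hN hs z hγ hc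

end MaassPoincare

namespace MaassPoincare

open scoped FourierTransform

/-! ### The coefficients -/

/-- Because `rowWeight` is 0 off the units, the sum over all residues is already the sum over
primitive ones. -/
theorem sum_rowWeight_mul_e (m κ n : ℤ) (N : ℕ) (c : ℕ+) :
    ∑ v ∈ Finset.range (N * c), rowWeight m κ N c v * e (n * v / (N * c : ℕ)) =
      kloosterman κ m n (N * c) := by
  rw [kloosterman, Finset.sum_filter]
  refine Finset.sum_congr rfl fun v _ => ?_
  have h1 : (v : ℤ).gcd (N * c : ℕ) = 1 ↔ Nat.Coprime v (N * c) := by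
    rw [Int.gcd_natCast_natCast, Nat.Coprime]
  by_cases h : Nat.Coprime v (N * c)
  · rw [rowWeight, if_pos (h1.2 h), if_pos h, quadMult, add_div, e_add, Int.cast_natCast, mul_assoc]
  · rw [rowWeight, if_neg (fun h' => h (h1.1 h')), if_neg h, zero_mul]

theorem norm_kloosterman_le (κ m n : ℤ) {N : ℕ} (c : ℕ+) :
    ‖kloosterman κ m n (N * c)‖ ≤ (N * c : ℕ) := by
  rw [← sum_rowWeight_mul_e]
  refine (norm_sum_le_of_le _ (n := fun _ => 1) fun v _ => ?_).trans_eq (by simp)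
  rw [norm_mul, show (n : ℂ) * v / (N * c : ℕ) = ((n * v / (N * c : ℕ) : ℝ) : ℂ) by
    push_cast; rfl, norm_e, mul_one]
  exact norm_rowWeight_le _ _ _ _ _

theorem exists_norm_hyp01_le {b : ℂ} (hb : ∀ m : ℕ, b ≠ -m) (T : ℝ) :
    ∃ C, 0 ≤ C ∧ ∀ z : ℂ, ‖z‖ ≤ T → ‖hyp01 b z‖ ≤ C := by
  -- With A = 1 the numerator (1)_j = j! cancels the factorial. What remains still dominates the ₀F₁
  -- series.
  have hs := summable_kummer_majorant (A := 1) one_pos hb (r := |T| + 1) (by positivity)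
  have hn : ∀ j : ℕ, (ascPochhammer ℝ j).eval 1 = j.factorial := fun j => by
    rw [ascPochhammer_eval_one]
  have hbound : ∀ z : ℂ, ‖z‖ ≤ T → ‖hyp01 b z‖ ≤ _ := fun z hz =>
    tsum_of_norm_bounded hs.hasSum fun j => by
      have h1 : ‖z‖ ≤ |T| + 1 := hz.trans ((le_abs_self T).trans (by linarith))
      have h2 : (1 : ℝ) ≤ j.factorial := by exact_mod_cast j.factorial_pos
      rw [norm_div, norm_mul, norm_pow, Complex.norm_natCast, hn, div_mul_eq_mul_div]
      refine div_le_div_of_nonneg_right ?_ (by positivity)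
      calc ‖z‖ ^ j ≤ 1 * (|T| + 1) ^ j := by rw [one_mul]; gcongr
        _ ≤ _ := by gcongr
  refine ⟨_, tsum_nonneg fun j => ?_, hbound⟩
  rw [hn]
  positivity

/-- In every case the dependence on q is q^{1-2s} times a function bounded for q ≥ 1, since the ₀F₁
argument stays in a fixed disc. -/
theorem exists_norm_coeffFactor_le (m n : ℤ) (k : ℂ) {s : ℂ} (hs : 1 < s.re) :
    ∃ C, ∀ q : ℝ, 1 ≤ q → ‖coeffFactor m n k s q‖ ≤ C * q ^ (-(2 * s.re - 1)) := by
  have hb : ∀ j : ℕ, 2 * s ≠ -j := ne_neg_nat_of_re_pos (by simp; linarith)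
  have hre : ∀ q : ℝ, 0 < q → ‖(q : ℂ) ^ (1 - 2 * s)‖ = q ^ (-(2 * s.re - 1)) := fun q hq => by
    rw [Complex.norm_cpow_eq_rpow_re_of_pos hq]; simp
  by_cases hmn : m * n = 0
  · by_cases hmn' : m + n = 0
    · refine ⟨‖(2 : ℂ) ^ (2 * k - 2) * (Real.pi : ℂ) ^ (k - 1) * Complex.Gamma (2 * s) *
        ((2 : ℝ) : ℂ) ^ (1 - 2 * s)‖, fun q hq => ?_⟩
      rw [coeffFactor, if_neg (by omega), if_neg (by omega), if_neg (by omega), Complex.ofReal_mul,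
        Complex.mul_cpow_ofReal_nonneg (by norm_num) (by linarith), ← mul_assoc, norm_mul,
        hre q (by linarith)]
    · refine ⟨‖(2 : ℂ) ^ (k - 1) * (Real.pi : ℂ) ^ (s + k / 2 - 1) *
        ((|(m + n : ℝ)| : ℝ) : ℂ) ^ (s - k / 2)‖, fun q hq => ?_⟩
      rw [coeffFactor, if_neg (by omega), if_neg (by omega), if_pos (by omega), norm_mul,
        hre q (by linarith)]
  · obtain ⟨C, hC0, hC⟩ := exists_norm_hyp01_le hb ‖(4 * Real.pi ^ 2 * m * n : ℂ)‖
    set r := 2 * Real.pi * √(|(m : ℝ)| * |(n : ℝ)|) with hr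
    have hr0 : 0 < r := by
      have h1 : 0 < |(m : ℝ)| := abs_pos.2 (by exact_mod_cast left_ne_zero_of_mul hmn)
      have h2 : 0 < |(n : ℝ)| := abs_pos.2 (by exact_mod_cast right_ne_zero_of_mul hmn)
      positivity
    refine ⟨‖((|(m : ℝ)| * |(n : ℝ)| : ℝ) : ℂ) ^ ((1 - k) / 2)‖ * r ^ (2 * s.re - 1) *
      (‖(Complex.Gamma (2 * s))⁻¹‖ * C), fun q hq => ?_⟩
    have hq0 : 0 < q := by linarith
    have h1 : ‖((r / q : ℝ) : ℂ) ^ (2 * s - 1)‖ = r ^ (2 * s.re - 1) * q ^ (-(2 * s.re - 1)) := by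
      rw [Complex.norm_cpow_eq_rpow_re_of_pos (by positivity), Real.div_rpow hr0.le hq0.le,
        Real.rpow_neg hq0.le, div_eq_mul_inv]
      simp
    have h2 : ‖hyp01 (2 * s) (-(4 * Real.pi ^ 2 * m * n / q ^ 2))‖ ≤ C := by
      apply hC
      rw [norm_neg, norm_div, norm_pow, Complex.norm_real, Real.norm_of_nonneg hq0.le]
      exact div_le_self (norm_nonneg _) (one_le_pow₀ hq)
    rw [coeffFactor_of_mul_ne_zero hmn k hs, ← hr, norm_mul, norm_mul, norm_mul, h1]
    calc _ ≤ ‖((|(m : ℝ)| * |(n : ℝ)| : ℝ) : ℂ) ^ ((1 - k) / 2)‖ *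
          (r ^ (2 * s.re - 1) * q ^ (-(2 * s.re - 1))) * (‖(Complex.Gamma (2 * s))⁻¹‖ * C) := by
          gcongr
      _ = _ := by ring

/-- The trivial bound |K| ≤ Nc suffices, because 2 Re s - 1 > 1. -/
theorem summable_coeffTerm (m κ : ℤ) {N : ℕ} (hN : 0 < N) (n : ℤ) {s : ℂ} (hs : 1 < s.re) :
    Summable fun c : ℕ+ => coeffTerm m κ N n s c := by
  obtain ⟨C, hC⟩ := exists_norm_coeffFactor_le m n ((κ : ℂ) / 2) hs
  refine Summable.of_norm_bounded ((summable_pnat_mul_rpow (ρ := 2 * s.re - 1) (by linarith)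
    hN).mul_left C) fun c => ?_
  have hq : 0 < N * c := Nat.mul_pos hN c.pos
  have hq' : (0 : ℝ) < (N * c : ℕ) := by exact_mod_cast hq
  rw [coeffTerm, norm_mul, norm_div, Complex.norm_natCast]
  calc _ ≤ 1 * ‖coeffFactor m n ((κ : ℂ) / 2) s ((N * c : ℕ) : ℝ)‖ := by
        gcongr
        exact (div_le_one hq').2 (norm_kloosterman_le κ m n c)
    _ ≤ _ := by rw [one_mul]; exact hC _ (by exact_mod_cast hq)

theorem fourier_rowTerm (m κ : ℤ) {N : ℕ} (hN : 0 < N) (n : ℤ) {s : ℂ} (hs : 1 < s.re) (z : ℍ)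
    (c : ℕ+) :
    (∑ v ∈ Finset.range (N * c), rowWeight m κ N c v * e (n * v / (N * c : ℕ))) *
      ((N * c : ℕ) : ℂ) ^ (-(2 * s)) *
      𝓕 (hSer (s + (κ : ℂ) / 2 / 2) (s - (κ : ℂ) / 2 / 2)
        (2 * Real.pi * Complex.I * m / ((N * c : ℕ) : ℂ) ^ 2) z.im) n * e (n * z.re) *
      (phiConst m ((κ : ℂ) / 2) s * (z.im : ℂ) ^ (s - (κ : ℂ) / 2 / 2)) =
    coeffTerm m κ N n s c * (2 * Real.pi * Complex.I ^ (-((κ : ℂ) / 2)) *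
      maassW n ((κ : ℂ) / 2) z.im s * e (n * z.re)) := by
  have hq : (0 : ℝ) < (N * c : ℕ) := by exact_mod_cast Nat.mul_pos hN c.pos
  have key := fourier_term m n ((κ : ℂ) / 2) hs z.im_pos hq
  rw [Complex.ofReal_natCast] at key
  rw [sum_rowWeight_mul_e, coeffTerm]
  linear_combination (kloosterman κ m n (N * c) * e (n * z.re)) * key

theorem norm_param_le (m : ℤ) {N : ℕ} (hN : 0 < N) (c : ℕ+) :
    ‖2 * Real.pi * Complex.I * m / ((N * c : ℕ) : ℂ) ^ 2‖ ≤ ‖2 * Real.pi * Complex.I * m‖ := by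
  rw [norm_div, norm_pow, Complex.norm_natCast]
  exact div_le_self (norm_nonneg _)
    (one_le_pow₀ (by exact_mod_cast Nat.mul_pos hN c.pos))

/-- Combines Poisson summation over the rows with the evaluation of each Fourier coefficient. The
c-sum of the evaluated terms is the n-th term of the expansion, and summability over n descends from
the double sum. -/
theorem hasSum_rowTerm (m : ℤ) {κ : ℤ} {N : ℕ} (hN : 0 < N) (hκ : Odd κ → 4 ∣ N) {s : ℂ}
    (hs : 1 < s.re) (z : ℍ) :
    (Summable fun n : ℤ => coeff m κ N n s * maassW n ((κ : ℂ) / 2) z.im s * e (n * z.re)) ∧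
    HasSum (rowTerm m κ N z s)
      (∑' n : ℤ, coeff m κ N n s * maassW n ((κ : ℂ) / 2) z.im s * e (n * z.re)) := by
  have hab : s + (κ : ℂ) / 2 / 2 + (s - (κ : ℂ) / 2 / 2) = 2 * s := by ring
  have h2 : 2 < (s + (κ : ℂ) / 2 / 2 + (s - (κ : ℂ) / 2 / 2)).re := by
    rw [hab]; simp; linarith
  have ht := norm_param_le m hN
  have hw := norm_rowWeight_le m κ N
  have hS := (summable_mul_hSer h2 z hN ht hw).mul_right
    (phiConst m ((κ : ℂ) / 2) s * (z.im : ℂ) ^ (s - (κ : ℂ) / 2 / 2))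
  have hF := (summable_mul_fourier_hSer h2 z hN ht hw).mul_right
    (phiConst m ((κ : ℂ) / 2) s * (z.im : ℂ) ^ (s - (κ : ℂ) / 2 / 2))
  have hE := congrArg (· * (phiConst m ((κ : ℂ) / 2) s * (z.im : ℂ) ^ (s - (κ : ℂ) / 2 / 2)))
    (tsum_mul_hSer h2 z hN ht hw (rowWeight_add m hN hκ))
  simp only [hab] at hS hF hE
  simp only [← tsum_mul_right, fourier_rowTerm m κ hN _ hs z] at hF hE
  have hterm : ∀ n : ℤ, ∑' c : ℕ+, coeffTerm m κ N n s c * (2 * Real.pi *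
      Complex.I ^ (-((κ : ℂ) / 2)) * maassW n ((κ : ℂ) / 2) z.im s * e (n * z.re)) =
      coeff m κ N n s * maassW n ((κ : ℂ) / 2) z.im s * e (n * z.re) := by
    intro n
    rw [tsum_mul_right, coeff]
    ring
  refine ⟨?_, ?_⟩
  · have hF' : Summable fun p : ℤ × ℕ+ => coeffTerm m κ N p.1 s p.2 * (2 * Real.pi *
      Complex.I ^ (-((κ : ℂ) / 2)) * maassW p.1 ((κ : ℂ) / 2) z.im s * e (p.1 * z.re)) :=
      hF.prod_symm
    exact hF'.prod.congr hterm
  · have : Summable (rowTerm m κ N z s) := hS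
    rw [← tsum_congr hterm, ← hE]
    exact this.hasSum

/-! ### From bottom rows to the sum over coset representatives -/

theorem hasSum_option_elim {ι : Type*} {f : ι → ℂ} {a : ℂ} (h : HasSum f a) (b : ℂ) :
    HasSum (fun o : Option ι => o.elim b f) (b + a) := by
  classical
  have h1 : HasSum (fun o : Option ι => o.elim 0 f) a :=
    ((Option.some_injective ι).hasSum_iff (f := fun o : Option ι => o.elim 0 f) (by
      rintro (_ | x) hx
      · rfl
      · exact absurd ⟨x, rfl⟩ hx)).1 h
  refine ((hasSum_ite_eq (none : Option ι) b).add h1).congr_fun ?_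
  rintro (_ | x) <;> simp

/-- The map `bottomRow` embeds the representatives into the rows together with the point `none`,
which stands for the identity coset. Rows outside the image are not coprime and carry weight 0, so
both sums agree. -/
theorem hasSum_slash_phi (m : ℤ) {κ : ℤ} {N : ℕ} (hN : 0 < N) (hκ : Odd κ → 4 ∣ N) {s : ℂ}
    (hs : 1 < s.re) {R : Set (CongruenceSubgroup.Gamma0 N)}
    (hR : Subgroup.IsComplement (gammaInf N : Set (CongruenceSubgroup.Gamma0 N)) R)
    (hsign : (∃ k : ℤ, Odd k ∧ κ = 2 * k) → ∀ γ ∈ R,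
      0 < (γ : SL(2, ℤ)) 1 0 ∨ ((γ : SL(2, ℤ)) 1 0 = 0 ∧ 0 < (γ : SL(2, ℤ)) 1 1)) (z : ℍ) :
    HasSum (fun γ : R => slash κ (phi m ((κ : ℂ) / 2) s) (γ : CongruenceSubgroup.Gamma0 N) z)
      (phi m ((κ : ℂ) / 2) s z +
        ∑' n : ℤ, coeff m κ N n s * maassW n ((κ : ℂ) / 2) z.im s * e (n * z.re)) := by
  have h1 := hasSum_option_elim (hasSum_rowTerm m hN hκ hs z).2 (phi m ((κ : ℂ) / 2) s z)
  refine (((injective_bottomRow hN hR).hasSum_iff ?_).2 h1).congr_fun fun γ => ?_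
  · rintro (_ | ⟨c, d⟩) hx
    · obtain ⟨γ, hγ⟩ := exists_bottomRow_eq hR 1
      exact absurd ⟨γ, by simpa [bottomRow] using hγ⟩ hx
    · have hgcd : ¬ d.gcd (N * c : ℕ) = 1 := fun h => hx (exists_mem_bottomRow_eq hN hR h)
      rw [Option.elim_some, rowTerm, rowWeight, if_neg hgcd]
      simp only [zero_mul]
  · refine slash_phi_eq_rowTerm hN hκ hs z (γ : CongruenceSubgroup.Gamma0 N).2 ?_
    -- If κ is neither odd nor divisible by 4, then k is an odd integer. This is exactly the case in
    -- which the signs of the representatives are normalized.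
    by_cases hκ2 : Odd κ ∨ 4 ∣ κ
    · exact Or.inl hκ2
    · refine Or.inr (hsign ?_ γ γ.2)
      rw [not_or, Int.not_odd_iff_even] at hκ2
      obtain ⟨⟨k, hk⟩, h4⟩ := hκ2
      refine ⟨k, ?_, by omega⟩
      rw [← Int.not_even_iff_odd]
      rintro ⟨l, hl⟩
      exact h4 ⟨l, by omega⟩

end MaassPoincare

end

/-- Fourier expansion of the Poincaré series `F_{m,k,N}(z, s)` for `Re s > 1`, where `k = κ/2`.
The series is computed with any set `R` of representatives of `Γ_∞ \ Γ₀(N)`; only for odd integral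
`k`, where `(φ|_k γ)` changes sign with `γ`, the signs are normalized by `c > 0` or `c = 0 < d`. -/
theorem theorem3p2 (m κ : ℤ) (N : ℕ) (hN : 0 < N) (hκ : Odd κ → 4 ∣ N)
    (s : ℂ) (hs : 1 < s.re)
    (R : Set (CongruenceSubgroup.Gamma0 N))
    (hR : Subgroup.IsComplement (MaassPoincare.gammaInf N : Set (CongruenceSubgroup.Gamma0 N)) R)
    (hsign : (∃ k : ℤ, Odd k ∧ κ = 2 * k) → ∀ γ ∈ R,
      0 < (γ : SL(2, ℤ)) 1 0 ∨ ((γ : SL(2, ℤ)) 1 0 = 0 ∧ 0 < (γ : SL(2, ℤ)) 1 1))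
    (z : ℍ) :
    (Summable fun γ : R => MaassPoincare.slash κ (MaassPoincare.phi m ((κ : ℂ) / 2) s)
      (γ : CongruenceSubgroup.Gamma0 N) z) ∧
    (∀ n : ℤ, Summable fun c : ℕ+ => MaassPoincare.coeffTerm m κ N n s c) ∧
    (Summable fun n : ℤ => MaassPoincare.coeff m κ N n s *
      MaassPoincare.maassW n ((κ : ℂ) / 2) z.im s * MaassPoincare.e (n * (z.re : ℂ))) ∧
    MaassPoincare.poincareSeries m κ N R z s =
      MaassPoincare.maassM m ((κ : ℂ) / 2) z.im s * MaassPoincare.e (m * (z.re : ℂ)) +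
        ∑' n : ℤ, MaassPoincare.coeff m κ N n s *
          MaassPoincare.maassW n ((κ : ℂ) / 2) z.im s * MaassPoincare.e (n * (z.re : ℂ)) := by
  have h := MaassPoincare.hasSum_slash_phi m hN hκ hs hR hsign z
  exact ⟨h.summable, fun n => MaassPoincare.summable_coeffTerm m κ hN n hs,
    (MaassPoincare.hasSum_rowTerm m hN hκ hs z).1, h.tsum_eq⟩
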